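/- Let $\sigma$ be a finite relational signature all of whose symbols have arity at least $1$, and let $\mathbf{B}$ be a (finite or infinite) $\sigma$-structure with universe $B$. Suppose that the automorphism group of $\mathbf{B}$ has finitely many orbits on $B$, and that only finitely many binary relations on $B$ are definable in $\mathbf{B}$ by primitive positive formulas (formulas built from atomic formulas $R(w_1,\dots,w_n)$, $R\in\sigma$, with conjunction and existential quantification). Let $\wp(\mathbf{B})$ be the $\sigma$-structure whose universe is the set of nonempty subsets of $B$ and where $R^{\wp(\mathbf{B})}=\{(\pi_1 S,\dots,\pi_k S) : \emptyset\neq S\subseteq R^{\mathbf{B}}\}$ for each $k$-ary $R\in\sigma$. Suppose that peek arc consistency decides $\mathrm{CSP}(\mathbf{B})$, that is, every finite $\sigma$-structure $\mathbf{A}$ such that for each element $a$ of $\mathbf{A}$ there is a homomorphism $h:\mathbf{A}\to\wp(\mathbf{B})$ with $h(a)$ a singleton admits a homomorphism to $\mathbf{B}$. Then the problem $\mathrm{CSP}(\mathbf{B})$ of deciding whether a given finite $\sigma$-structure $\mathbf{A}$ has a homomorphism to $\mathbf{B}$ is decided by a quadratic-time and linear-space algorithm; moreover, it can be decided in linear time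 with a linear number of processors. Here $\mathbf{B}$ is fixed, the size $N$ of $\mathbf{A}$ is its number of elements plus the total length of the listed tuples in its relations, and the bounds are those of a random access machine, respectively of a parallel random access machine (concurrent read, exclusive write), whose memory cells hold numbers at most linear in $N$: there are a fixed program and a constant $c$ such that on every $\mathbf{A}$ the program, run on one processor, takes at most $c(N+1)^2$ steps and uses only memory cells with addresses, and contents, at most $c(N+1)$; and there are a fixed program and a constant $c$ such that on every $\mathbf{A}$ the program, run on $c(N+1)$ processors, takes at most $c(N+1)$ steps. -/

import Mathlib

open FirstOrder

/-! ### Primitive positive definability -/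

/-- Primitive positive formulas: built from atomic formulas `R(w₁, …, wₙ)` (no equality) with
conjunction and existential quantification. -/
inductive IsPrimitivePositive {L : Language} {α : Type} :
    ∀ {n : ℕ}, L.BoundedFormula α n → Prop
  | rel {n k : ℕ} (R : L.Relations k) (ts : Fin k → L.Term (α ⊕ Fin n)) :
      IsPrimitivePositive (Language.BoundedFormula.rel R ts)
  | inf {n : ℕ} {φ ψ : L.BoundedFormula α n} :
      IsPrimitivePositive φ → IsPrimitivePositive ψ → IsPrimitivePositive (φ ⊓ ψ)
  | ex {n : ℕ} {φ : L.BoundedFormula α (n + 1)} :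
      IsPrimitivePositive φ → IsPrimitivePositive φ.ex

/-- A `k`-ary relation on `B` is pp-definable (without parameters). -/
def PPDefinable (L : Language) {B : Type*} [L.Structure B] {k : ℕ} (S : Set (Fin k → B)) : Prop :=
  ∃ φ : L.Formula (Fin k), IsPrimitivePositive φ ∧ S = {x | φ.Realize x}

/-! ### Orbits -/

/-- Two elements lie in the same orbit if some automorphism maps one to the other. -/
def orbitSetoid (L : Language) (B : Type*) [L.Structure B] : Setoid B where
  r x y := ∃ f : B ≃[L] B, f x = y
  iseqv :=
    { refl := fun x => ⟨Language.Equiv.refl L B, rfl⟩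
      symm := by
        rintro x y ⟨f, rfl⟩
        exact ⟨f.symm, f.symm_apply_apply x⟩
      trans := by
        rintro x y z ⟨f, rfl⟩ ⟨g, rfl⟩
        exact ⟨g.comp f, rfl⟩ }

/-! ### The power structure and peek arc consistency -/

/-- The universe of the power structure: the nonempty subsets of `B`. -/
def NonemptySubset (B : Type*) : Type _ := {s : Set B // s.Nonempty}

/-- The power structure: a relation holds of `(t₁, …, tₖ)` iff the `tᵢ` are the projections
`π₁ S, …, πₖ S` of some nonempty subset `S` of the corresponding relation of `B`. -/
instance powerStructure (L : Language) [L.IsRelational] (B : Type*) [L.Structure B] :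
    L.Structure (NonemptySubset B) where
  funMap f _ := isEmptyElim f
  RelMap {k} R t :=
    ∃ S : Set (Fin k → B), S.Nonempty ∧ (∀ x ∈ S, Language.Structure.RelMap R x) ∧
      ∀ i, (t i).1 = (fun x => x i) '' S

/-- The peek arc consistency condition for an instance `(A, B)`. -/
def PACC (L : Language) [L.IsRelational] (A B : Type*) [L.Structure A] [L.Structure B] : Prop :=
  ∀ a : A, ∃ h : A →[L] NonemptySubset B, ∃ b : B, (h a).1 = {b}

/-- Peek arc consistency decides `CSP(B)`. -/
def PACDecides (L : Language) [L.IsRelational] (B : Type*) [L.Structure B] : Prop :=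
  ∀ (A : Type) [Finite A] [L.Structure A], PACC L A B → Nonempty (A →[L] B)

/-! ### Instances of the CSP and their representation -/

/-- A finite relational structure, given by the number of its elements and, for each relation
symbol, a list of the tuples in the relation. -/
structure FiniteInstance (L : Language) where
  card : ℕ
  tuples : ∀ {k : ℕ}, L.Relations k → List (Fin k → Fin card)

namespace FiniteInstance

variable {L : Language}

/-- The universe of the finite structure. -/
abbrev Carrier (A : FiniteInstance L) : Type := Fin A.card

instance [L.IsRelational] (A : FiniteInstance L) : L.Structure A.Carrier where
  funMap f _ := isEmptyElim f
  RelMap R x := x ∈ A.tuples R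

/-- The size of a finite structure, where `e` enumerates the relation symbols: the number of
elements plus the total length of all listed tuples. -/
def size {r : ℕ} (e : Fin r ≃ Σ k, L.Relations k) (A : FiniteInstance L) : ℕ :=
  A.card + ∑ i, (e i).1 * (A.tuples (e i).2).length

/-- The input handed to a machine: the number of elements, followed, for each relation symbol,
by the number of its tuples and the entries of these tuples. -/
def encode {r : ℕ} (e : Fin r ≃ Σ k, L.Relations k) (A : FiniteInstance L) : List ℕ :=
  A.card :: (List.finRange r).flatMap fun i =>
    (A.tuples (e i).2).length ::
      (A.tuples (e i).2).flatMap fun t => List.ofFn fun j => (t j : ℕ)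

end FiniteInstance

/-! ### Random access machines, sequential and parallel

A parallel random access machine consists of `p` processors that synchronously execute the same
program. Each has a program counter and a local memory, and all share a global memory, which
initially holds the input. With `p = 1` this is an ordinary sequential random access machine. -/

namespace RAM

/-- Instructions. Write `x` for the local memory and `G` for the global memory. -/
inductive Instr
  /-- `xᵢ := k` -/
  | const (i k : ℕ)
  /-- `xᵢ := xⱼ + xₖ` -/
  | add (i j k : ℕ)
  /-- `xᵢ := xⱼ - xₖ`, truncated at `0` -/
  | sub (i j k : ℕ)
  /-- `xᵢ := x_{xⱼ}` -/
  | load (i j : ℕ)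
  /-- `x_{xᵢ} := xⱼ` -/
  | store (i j : ℕ)
  /-- `xᵢ := G_{xⱼ}` -/
  | read (i j : ℕ)
  /-- `G_{xᵢ} := xⱼ` -/
  | write (i j : ℕ)
  /-- continue with instruction number `l` -/
  | jump (l : ℕ)
  /-- if `xᵢ = 0`, continue with instruction number `l` -/
  | jumpIfZero (i l : ℕ)

/-- A program is a finite list of instructions, numbered from `0`. -/
abbrev Program : Type := List Instr

/-- The state of one processor: program counter and local memory. -/
structure Proc where
  pc : ℕ
  mem : ℕ → ℕ

/-- The state of the processor `s` after executing an instruction, with global memory `G`. -/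
def Instr.next (G : ℕ → ℕ) (s : Proc) : Instr → Proc
  | const i k => ⟨s.pc + 1, Function.update s.mem i k⟩
  | add i j k => ⟨s.pc + 1, Function.update s.mem i (s.mem j + s.mem k)⟩
  | sub i j k => ⟨s.pc + 1, Function.update s.mem i (s.mem j - s.mem k)⟩
  | load i j => ⟨s.pc + 1, Function.update s.mem i (s.mem (s.mem j))⟩
  | store i j => ⟨s.pc + 1, Function.update s.mem (s.mem i) (s.mem j)⟩
  | read i j => ⟨s.pc + 1, Function.update s.mem i (G (s.mem j))⟩
  | write _ _ => ⟨s.pc + 1, s.mem⟩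
  | jump l => ⟨l, s.mem⟩
  | jumpIfZero i l => ⟨if s.mem i = 0 then l else s.pc + 1, s.mem⟩

/-- The pair (address, value) that an instruction writes to the global memory, if any. -/
def Instr.globalWrite (s : Proc) : Instr → Option (ℕ × ℕ)
  | write i j => some (s.mem i, s.mem j)
  | _ => none

/-- A processor has halted if its program counter points to no instruction. -/
def Proc.Halted (P : Program) (s : Proc) : Prop := P[s.pc]? = none

/-- One step of a processor; a halted processor remains unchanged. -/
def Proc.step (P : Program) (G : ℕ → ℕ) (s : Proc) : Proc :=
  match P[s.pc]? with
  | none => s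
  | some I => I.next G s

/-- The global write that a processor performs in its next step, if any. -/
def Proc.globalWrite (P : Program) (s : Proc) : Option (ℕ × ℕ) :=
  P[s.pc]?.bind (Instr.globalWrite s)

/-- Configurations of a machine with `p` processors. -/
structure Config (p : ℕ) where
  proc : Fin p → Proc
  glob : ℕ → ℕ

/-- Initially the global memory holds the input from address `0` on, and each processor has its
own index in local cell `0`; all other cells are `0`. -/
def Config.init (p : ℕ) (input : List ℕ) : Config p where
  proc i := ⟨0, fun a => if a = 0 then (i : ℕ) else 0⟩
  glob a := input.getD a 0

/-- One synchronous step: all reads take place before all writes. (If several processors write to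
the same global cell, the one with the least index succeeds; but see `ExclusiveWrite`.) -/
def Config.step (P : Program) {p : ℕ} (C : Config p) : Config p where
  proc i := (C.proc i).step P C.glob
  glob a := ((List.finRange p).findSome? fun i =>
    ((C.proc i).globalWrite P).bind fun w => if w.1 = a then some w.2 else none).getD (C.glob a)

/-- The configuration after `t` steps. -/
def run (P : Program) (p : ℕ) (input : List ℕ) (t : ℕ) : Config p :=
  (Config.step P)^[t] (Config.init p input)

/-- No two processors write to the same global cell in the next step. -/
def Config.ExclusiveWrite (P : Program) {p : ℕ} (C : Config p) : Prop :=
  ∀ (i j : Fin p) (a v w : ℕ), (C.proc i).globalWrite P = some (a, v) →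
    (C.proc j).globalWrite P = some (a, w) → i = j

/-- Only the cells with address at most `s`, in the global memory and in each local memory, are
in use, and all their contents (hence also all indirectly used addresses) are at most `s`. -/
def Config.BoundedBy (s : ℕ) {p : ℕ} (C : Config p) : Prop :=
  (∀ a, C.glob a ≤ s ∧ (s < a → C.glob a = 0)) ∧
  ∀ i a, (C.proc i).mem a ≤ s ∧ (s < a → (C.proc i).mem a = 0)

/-- The program `P`, run on `input` with `p` processors (concurrent read, exclusive write),
correctly answers the question whether `Q` holds: all processors halt within `T` steps, the
answer, `1` for yes and `0` for no, is then in local cell `0` of processor `0`, and throughout the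
run each memory uses only its cells up to `s`, with contents at most `s`. -/
structure Answers (P : Program) (p : ℕ) (input : List ℕ) (T s : ℕ) (Q : Prop) : Prop where
  halts : ∀ i, ((run P p input T).proc i).Halted P
  answer : ∃ i : Fin p, (i : ℕ) = 0 ∧
    (Q → ((run P p input T).proc i).mem 0 = 1) ∧ (¬ Q → ((run P p input T).proc i).mem 0 = 0)
  exclusive : ∀ t, (run P p input t).ExclusiveWrite P
  space : ∀ t, (run P p input t).BoundedBy s

end RAM

/-! Fix `b` in `B`. Arc consistency started with `{b}` at one element can be carried out with the
sets `∅`, `{b}`, `B` and the slices `{y | S(b, y)}` of primitive positive definable binary relations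
`S`: intersecting slices is conjunction, and projecting a relation whose entries are confined to
such sets is existential quantification, with one free variable for `b` and one for the projected
entry (`relProj_slice`, `nonempty_arcFamily`). By hypothesis this family is finite. An automorphism
moves the value of a homomorphism at the peeked element to the representative of its orbit, so
finitely many `b` suffice. All of them are treated at once, with values in one fixed finite
meet-semilattice.

Values propagate in a graph whose nodes are the elements, the listed tuples and one global node.
Elements and tuples inform each other; the global node learns for which representatives some element
has received the empty set. If, after exhaustive propagation, a representative survives at the
global node, the sets at the elements form a homomorphism to the power structure that sends the
peeked element to a singleton (`exists_hom_powerStructure`). Conversely, a homomorphism to `B`,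
suitably moved by an automorphism, is never excluded (`lowerBound_edge`), so its orbit survives.
Hence every peek is accepted if there is a homomorphism to `B`; and if every peek is accepted, the
peek arc consistency condition holds and the hypothesis provides a homomorphism.

For the time bound, the semilattice is numbered along a linear extension, so that updates only lower
numbers. A node returns to the worklist only when its number drops, that is, boundedly often, and
one peek takes linear time (`potential_push`, `wp_propagate`). Peeking at all elements in turn, in
the same memory, gives quadratic time and linear space. In parallel, each processor peeks at one
element, publishes one result in a cell behind the input, and then polls and combines all results
(`combineInv`, `combine_results`).

The algorithms are written in a small structured language, verified with time credits (`Cmd.Wp`) and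
compiled to machine code with constant overhead (`Exec.steps`). -/

namespace RAM

/-! ### Runs of a single processor -/

/-- The global memory that holds the input. -/
def inputMem (input : List ℕ) (a : ℕ) : ℕ := input.getD a 0

/-- Executing the instruction only puts numbers up to `s` into cells up to `s`. -/
def Instr.Fits (s : ℕ) (σ : Proc) : Instr → Prop
  | const i k => i ≤ s ∧ k ≤ s
  | add i j k => i ≤ s ∧ σ.mem j + σ.mem k ≤ s
  | sub i _ _ => i ≤ s
  | load i _ => i ≤ s
  | read i _ => i ≤ s
  | _ => True

/-- The instruction uses the global memory only to read its first `n` cells. -/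
def Instr.ReadsBelow (n : ℕ) (σ : Proc) : Instr → Prop
  | read _ j => σ.mem j < n
  | write _ _ => False
  | _ => True

/-- The memory of the processor uses only cells up to `s`, with contents up to `s`. -/
def Proc.BoundedBy (s : ℕ) (σ : Proc) : Prop :=
  ∀ a, σ.mem a ≤ s ∧ (s < a → σ.mem a = 0)

theorem update_boundedBy {m : ℕ → ℕ} {s i v : ℕ}
    (h : ∀ a, m a ≤ s ∧ (s < a → m a = 0)) (hi : i ≤ s) (hv : v ≤ s) (a : ℕ) :
    Function.update m i v a ≤ s ∧ (s < a → Function.update m i v a = 0) := by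
  rcases eq_or_ne a i with rfl | hne
  · simp only [Function.update_self]
    exact ⟨hv, fun hlt => absurd hi (by omega)⟩
  · simp only [Function.update_of_ne hne]
    exact h a

theorem Instr.next_boundedBy {G : ℕ → ℕ} {s : ℕ} {σ : Proc} {I : Instr} (hG : ∀ a, G a ≤ s)
    (h : σ.BoundedBy s) (hI : I.Fits s σ) : (I.next G σ).BoundedBy s := by
  cases I <;> simp only [Instr.Fits] at hI <;> intro a <;> simp only [Instr.next]
  case const => exact update_boundedBy h hI.1 hI.2 a
  case add => exact update_boundedBy h hI.1 hI.2 a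
  case sub j k => exact update_boundedBy h hI ((Nat.sub_le _ _).trans (h _).1) a
  case load => exact update_boundedBy h hI (h _).1 a
  case store => exact update_boundedBy h (h _).1 (h _).1 a
  case read => exact update_boundedBy h hI (hG _) a
  all_goals exact h a

/-- The next instruction exists, respects the space bound `s`, and uses the global memory only to
read the input. -/
def Proc.Safe (P : Program) (n s : ℕ) (σ : Proc) : Prop :=
  ∃ I, P[σ.pc]? = some I ∧ I.Fits s σ ∧ I.ReadsBelow n σ

/-- The processor gets from `σ` to `σ'` in `t` safe steps. -/
def Steps (P : Program) (input : List ℕ) (s t : ℕ) (σ σ' : Proc) : Prop :=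
  (Proc.step P (inputMem input))^[t] σ = σ' ∧
    ∀ u < t, ((Proc.step P (inputMem input))^[u] σ).Safe P input.length s

namespace Steps

variable {P : Program} {input : List ℕ} {s : ℕ}

theorem refl (σ : Proc) : Steps P input s 0 σ σ := ⟨rfl, by simp⟩

theorem trans {t u : ℕ} {σ σ' σ'' : Proc} (h : Steps P input s t σ σ')
    (h' : Steps P input s u σ' σ'') : Steps P input s (t + u) σ σ'' := by
  refine ⟨?_, fun v hv => ?_⟩
  · rw [Nat.add_comm, Function.iterate_add_apply, h.1, h'.1]
  · by_cases hvt : v < t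
    · exact h.2 v hvt
    · obtain ⟨w, rfl⟩ := Nat.exists_eq_add_of_le (not_lt.1 hvt)
      rw [Nat.add_comm, Function.iterate_add_apply, h.1]
      exact h'.2 w (by omega)

theorem single {σ : Proc} {I : Instr} (hI : P[σ.pc]? = some I) (hf : I.Fits s σ)
    (hr : I.ReadsBelow input.length σ) : Steps P input s 1 σ (I.next (inputMem input) σ) := by
  refine ⟨?_, fun u hu => ?_⟩
  · simp [Proc.step, hI]
  · obtain rfl : u = 0 := by omega
    exact ⟨I, hI, hf, hr⟩

theorem cons {σ σ' σ₁ : Proc} {t : ℕ} {I : Instr} (hI : P[σ.pc]? = some I) (hf : I.Fits s σ)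
    (hr : I.ReadsBelow input.length σ) (hσ : I.next (inputMem input) σ = σ₁)
    (h : Steps P input s t σ₁ σ') : Steps P input s (t + 1) σ σ' := by
  rw [Nat.add_comm]
  subst hσ
  exact (single hI hf hr).trans h

end Steps

/-- The list `code` of instructions is placed at position `o` of the program `P`. -/
def CodeAt (P : Program) (o : ℕ) (code : List Instr) : Prop :=
  ∀ i < code.length, P[o + i]? = code[i]?

theorem CodeAt.append_left {P : Program} {o : ℕ} {c d : List Instr} (h : CodeAt P o (c ++ d)) :
    CodeAt P o c := fun i hi => by
  rw [h i (by simp; omega), List.getElem?_append_left hi]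

theorem CodeAt.append_right {P : Program} {o : ℕ} {c d : List Instr} (h : CodeAt P o (c ++ d)) :
    CodeAt P (o + c.length) d := fun i hi => by
  rw [Nat.add_assoc, h (c.length + i) (by simp; omega),
    List.getElem?_append_right (by omega), Nat.add_sub_cancel_left]

theorem CodeAt.head {P : Program} {o : ℕ} {I : Instr} {c : List Instr} (h : CodeAt P o (I :: c)) :
    P[o]? = some I := by simpa using h 0 (by simp)

theorem CodeAt.tail {P : Program} {o : ℕ} {I : Instr} {c : List Instr} (h : CodeAt P o (I :: c)) :
    CodeAt P (o + 1) c := CodeAt.append_right (c := [I]) h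

theorem codeAt_append (c d e : List Instr) : CodeAt (c ++ (d ++ e)) c.length d := fun i hi => by
  rw [List.getElem?_append_right (by omega), Nat.add_sub_cancel_left, List.getElem?_append_left hi]

/-! ### A structured language with registers and arrays -/

/-- The registers of structured programs. -/
inductive Reg
  | ans | num | pos | left | one | nodes | edges | cnt | src | lab | dst | ptr | top | valSrc
  | valDst | new | tmp | elem | addr | scan | rest | all | res
  deriving DecidableEq

/-- The arrays of structured programs. -/
inductive Arr
  | val | head | next | lab | dst | stack
  deriving DecidableEq

/-- The states of structured programs. -/
structure St where
  reg : Reg → ℕ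
  arr : Arr → ℕ → ℕ

namespace St

def setReg (σ : St) (r : Reg) (v : ℕ) : St := ⟨Function.update σ.reg r v, σ.arr⟩

def setArr (σ : St) (j : Arr) (x v : ℕ) : St :=
  ⟨σ.reg, Function.update σ.arr j (Function.update (σ.arr j) x v)⟩

@[simp] theorem reg_setReg (σ : St) (r : Reg) (v : ℕ) (r' : Reg) :
    (σ.setReg r v).reg r' = if r' = r then v else σ.reg r' := by
  simp [setReg, Function.update_apply]

@[simp] theorem arr_setReg (σ : St) (r : Reg) (v : ℕ) : (σ.setReg r v).arr = σ.arr := rfl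

@[simp] theorem reg_setArr (σ : St) (j : Arr) (x v : ℕ) : (σ.setArr j x v).reg = σ.reg := rfl

@[simp] theorem arr_setArr (σ : St) (j : Arr) (x v : ℕ) (j' : Arr) :
    (σ.setArr j x v).arr j' = if j' = j then Function.update (σ.arr j) x v else σ.arr j' := by
  by_cases h : j' = j
  · subst h; simp [setArr]
  · simp [setArr, h]

/-- All registers and array entries are at most `b`. -/
def BoundedBy (σ : St) (b : ℕ) : Prop := (∀ r, σ.reg r ≤ b) ∧ ∀ j x, σ.arr j x ≤ b

theorem BoundedBy.setReg {σ : St} {b v : ℕ} (h : σ.BoundedBy b) (hv : v ≤ b) (r : Reg) :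
    (σ.setReg r v).BoundedBy b := by
  refine ⟨fun r' => ?_, h.2⟩
  rw [reg_setReg]
  split
  · exact hv
  · exact h.1 r'

theorem BoundedBy.setArr {σ : St} {b v : ℕ} (h : σ.BoundedBy b) (hv : v ≤ b) (j : Arr) (x : ℕ) :
    (σ.setArr j x v).BoundedBy b := by
  refine ⟨h.1, fun j' x' => ?_⟩
  rw [arr_setArr]
  split
  · rw [Function.update_apply]
    split
    · exact hv
    · exact h.2 _ _
  · exact h.2 _ _

end St

/-- Structured programs. -/
inductive Cmd
  | skip
  | set (r : Reg) (k : ℕ)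
  | add (r a b : Reg)
  | sub (r a b : Reg)
  | get (r : Reg) (j : Arr) (x : Reg)
  | put (j : Arr) (x r : Reg)
  | read (r x : Reg)
  | seq (c d : Cmd)
  | ifZero (r : Reg) (c d : Cmd)
  | whilePos (r : Reg) (c : Cmd)

/-- `Exec input b c σ σ' t`: on the given input, the structured program `c` takes the state `σ` to
the state `σ'` in time `t`, without creating numbers larger than `b`. -/
inductive Exec (input : List ℕ) (b : ℕ) : Cmd → St → St → ℕ → Prop
  | skip (σ : St) : Exec input b .skip σ σ 0
  | set (σ : St) (r : Reg) (k : ℕ) (h : k ≤ b) : Exec input b (.set r k) σ (σ.setReg r k) 1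
  | add (σ : St) (r x y : Reg) (h : σ.reg x + σ.reg y ≤ b) :
      Exec input b (.add r x y) σ (σ.setReg r (σ.reg x + σ.reg y)) 1
  | sub (σ : St) (r x y : Reg) : Exec input b (.sub r x y) σ (σ.setReg r (σ.reg x - σ.reg y)) 1
  | get (σ : St) (r : Reg) (j : Arr) (x : Reg) :
      Exec input b (.get r j x) σ (σ.setReg r (σ.arr j (σ.reg x))) 1
  | put (σ : St) (j : Arr) (x r : Reg) :
      Exec input b (.put j x r) σ (σ.setArr j (σ.reg x) (σ.reg r)) 1
  | read (σ : St) (r x : Reg) (h : σ.reg x < input.length) :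
      Exec input b (.read r x) σ (σ.setReg r (inputMem input (σ.reg x))) 1
  | seq {c d : Cmd} {σ σ₁ σ₂ : St} {t u : ℕ} : Exec input b c σ σ₁ t → Exec input b d σ₁ σ₂ u →
      Exec input b (.seq c d) σ σ₂ (t + u)
  | ifZero {r : Reg} {c : Cmd} (d : Cmd) {σ σ' : St} {t : ℕ} : σ.reg r = 0 →
      Exec input b c σ σ' t → Exec input b (.ifZero r c d) σ σ' (t + 1)
  | ifPos {r : Reg} (c : Cmd) {d : Cmd} {σ σ' : St} {t : ℕ} : σ.reg r ≠ 0 →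
      Exec input b d σ σ' t → Exec input b (.ifZero r c d) σ σ' (t + 1)
  | whileZero {r : Reg} (c : Cmd) {σ : St} : σ.reg r = 0 →
      Exec input b (.whilePos r c) σ σ 1
  | whilePos {r : Reg} {c : Cmd} {σ σ₁ σ₂ : St} {t u : ℕ} : σ.reg r ≠ 0 →
      Exec input b c σ σ₁ t → Exec input b (.whilePos r c) σ₁ σ₂ u →
      Exec input b (.whilePos r c) σ σ₂ (t + u + 1)

/-! ### Compilation -/

/-- The cell that holds a register. -/
abbrev Reg.cell (r : Reg) : ℕ := r.ctorIdx

/-- The cell that holds an array entry. -/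
abbrev Arr.cell (j : Arr) (x : ℕ) : ℕ := 32 + j.ctorIdx + 8 * x

theorem Reg.ctorIdx_lt (r : Reg) : r.ctorIdx < 30 := by cases r <;> decide

theorem Arr.ctorIdx_lt (j : Arr) : j.ctorIdx < 8 := by cases j <;> decide

theorem Reg.ctorIdx_inj {r r' : Reg} : r.ctorIdx = r'.ctorIdx ↔ r = r' := by
  constructor
  · intro h; cases r <;> cases r' <;> first | rfl | exact absurd h (by decide)
  · rintro rfl; rfl

theorem Arr.ctorIdx_inj {j j' : Arr} : j.ctorIdx = j'.ctorIdx ↔ j = j' := by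
  constructor
  · intro h; cases j <;> cases j' <;> first | rfl | exact absurd h (by decide)
  · rintro rfl; rfl

/-- Code that puts the address of an array entry into cell `30`. -/
def addrCode (j : Arr) (x : Reg) : List Instr :=
  [.add 30 x.cell x.cell, .add 30 30 30, .add 30 30 30, .const 31 (32 + j.ctorIdx), .add 30 31 30]

/-- Compilation of a structured program, to be placed at position `o`. -/
def Cmd.compile : Cmd → ℕ → List Instr
  | skip, _ => []
  | set r k, _ => [.const r.cell k]
  | add r a b, _ => [.add r.cell a.cell b.cell]
  | sub r a b, _ => [.sub r.cell a.cell b.cell]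
  | get r j x, _ => addrCode j x ++ [.load r.cell 30]
  | put j x r, _ => addrCode j x ++ [.store 30 r.cell]
  | read r x, _ => [.read r.cell x.cell]
  | seq c d, o => c.compile o ++ d.compile (o + (c.compile o).length)
  | ifZero r c d, o =>
      let d' := d.compile (o + 1)
      let c' := c.compile (o + 1 + d'.length + 1)
      .jumpIfZero r.cell (o + 1 + d'.length + 1) ::
        (d' ++ .jump (o + 1 + d'.length + 1 + c'.length) :: c')
  | whilePos r c, o =>
      let c' := c.compile (o + 1)
      .jumpIfZero r.cell (o + 1 + c'.length + 1) :: (c' ++ [.jump o])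

/-- The memory `m` of a processor represents the state `σ`. -/
structure Represents (m : ℕ → ℕ) (σ : St) : Prop where
  reg : ∀ r, m r.cell = σ.reg r
  arr : ∀ j x, m (j.cell x) = σ.arr j x

/-- Registers lie below cell 30 and array entries start at cell 32, so cells 30 and 31 are free for
address computations. -/
theorem Represents.scratch {m : ℕ → ℕ} {σ : St} (h : Represents m σ) {i : ℕ} (v : ℕ)
    (hi : i = 30 ∨ i = 31) : Represents (Function.update m i v) σ := by
  constructor
  · intro r
    have := r.ctorIdx_lt
    rw [Function.update_of_ne (by simp only [Reg.cell]; omega), h.reg]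
  · intro j x
    rw [Function.update_of_ne (by simp only [Arr.cell]; omega), h.arr]

theorem Represents.setReg {m : ℕ → ℕ} {σ : St} (h : Represents m σ) (r : Reg) (v : ℕ) :
    Represents (Function.update m r.cell v) (σ.setReg r v) := by
  constructor
  · intro r'
    simp only [Function.update_apply, Reg.cell, Reg.ctorIdx_inj, St.reg_setReg]
    split
    · rfl
    · exact h.reg r'
  · intro j x
    have := r.ctorIdx_lt
    rw [Function.update_of_ne (by simp only [Arr.cell, Reg.cell]; omega), h.arr, St.arr_setReg]

/-- The arrays are interleaved with stride 8, and there are fewer than 8 of them, so distinct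
entries have distinct cells. This layout keeps memory linear without fixing the lengths of the
arrays in advance. -/
theorem Represents.setArr {m : ℕ → ℕ} {σ : St} (h : Represents m σ) (j : Arr) (x v : ℕ) :
    Represents (Function.update m (j.cell x) v) (σ.setArr j x v) := by
  constructor
  · intro r'
    have := r'.ctorIdx_lt
    rw [Function.update_of_ne (by simp only [Arr.cell, Reg.cell]; omega), h.reg, St.reg_setArr]
  · intro j' x'
    have hj := j.ctorIdx_lt
    have hj' := j'.ctorIdx_lt
    rw [St.arr_setArr]
    by_cases hjj : j' = j
    · subst hjj
      by_cases hx : x' = x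
      · subst hx; simp
      · rw [Function.update_of_ne (by simp only [Arr.cell]; omega), if_pos rfl,
          Function.update_of_ne hx, h.arr]
    · have : j'.ctorIdx ≠ j.ctorIdx := fun hh => hjj (Arr.ctorIdx_inj.1 hh)
      rw [Function.update_of_ne (by simp only [Arr.cell]; omega), if_neg hjj, h.arr]

/-- The machine has no multiplication, so `8 * x` is formed by three doublings. Indices are register
contents, hence at most `b`, and every address stays below `40 + 8 * b`. -/
theorem steps_addrCode {P : Program} {input : List ℕ} {b s o : ℕ} (hs : 40 + 8 * b ≤ s) {m : ℕ → ℕ}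
    {σ : St} (hm : Represents m σ) (hσ : σ.BoundedBy b) (j : Arr) (x : Reg)
    (hP : CodeAt P o (addrCode j x)) :
    ∃ m', Represents m' σ ∧ m' 30 = j.cell (σ.reg x) ∧
      Steps P input s 5 ⟨o, m⟩ ⟨o + 5, m'⟩ := by
  have hj := j.ctorIdx_lt
  have hx := hσ.1 x
  have hxm := hm.reg x
  refine ⟨_, ?_, ?_, Steps.cons hP.head ?_ trivial rfl <| Steps.cons hP.tail.head ?_ trivial rfl <|
    Steps.cons hP.tail.tail.head ?_ trivial rfl <|
    Steps.cons hP.tail.tail.tail.head ?_ trivial rfl <|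
    Steps.cons hP.tail.tail.tail.tail.head ?_ trivial rfl <| Steps.refl _⟩
  · exact ((((hm.scratch _ (.inl rfl)).scratch _ (.inl rfl)).scratch _ (.inl rfl)).scratch _
      (.inr rfl)).scratch _ (.inl rfl)
  all_goals simp [Instr.Fits, Instr.next, hxm, Arr.cell]; try omega

/-- Compilation is correct: a step of the structured program takes at most six machine steps. -/
theorem Exec.steps {P : Program} {input : List ℕ} {b s : ℕ} (hs : 40 + 8 * b ≤ s)
    (hin : ∀ a, inputMem input a ≤ b) {c : Cmd} {σ σ' : St} {t : ℕ} (h : Exec input b c σ σ' t) :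
    ∀ (o : ℕ) (m : ℕ → ℕ), CodeAt P o (c.compile o) → Represents m σ → σ.BoundedBy b →
      ∃ m' u, u ≤ 6 * t ∧ Represents m' σ' ∧ σ'.BoundedBy b ∧
        Steps P input s u ⟨o, m⟩ ⟨o + (c.compile o).length, m'⟩ := by
  induction h with
  | skip σ => exact fun o m _ hm hσ => ⟨m, 0, by simp, hm, hσ, Steps.refl _⟩
  | set σ r k hk =>
    intro o m hP hm hσ
    have := r.ctorIdx_lt
    exact ⟨_, 1, by omega, hm.setReg r k, hσ.setReg hk r,
      Steps.cons hP.head (by simp [Instr.Fits, Reg.cell]; omega) trivial rfl <| Steps.refl _⟩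
  | add σ r x y hk =>
    intro o m hP hm hσ
    have := r.ctorIdx_lt
    refine ⟨_, 1, by omega, hm.setReg r _, hσ.setReg hk r,
      Steps.cons hP.head ?_ trivial ?_ <| Steps.refl _⟩
    · simp only [Instr.Fits, hm.reg]; simp only [Reg.cell]; omega
    · simp [Instr.next, hm.reg, Cmd.compile]
  | sub σ r x y =>
    intro o m hP hm hσ
    have := r.ctorIdx_lt
    refine ⟨_, 1, by omega, hm.setReg r _, hσ.setReg ((Nat.sub_le _ _).trans (hσ.1 x)) r,
      Steps.cons hP.head ?_ trivial ?_ <| Steps.refl _⟩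
    · simp only [Instr.Fits, Reg.cell]; omega
    · simp [Instr.next, hm.reg, Cmd.compile]
  | get σ r j x =>
    intro o m hP hm hσ
    have := r.ctorIdx_lt
    obtain ⟨m', hm', h30, hst⟩ := steps_addrCode (input := input) hs hm hσ j x hP.append_left
    refine ⟨_, 6, by omega, hm'.setReg r _, hσ.setReg (hσ.2 _ _) r,
      hst.trans <| Steps.cons hP.append_right.head ?_ trivial ?_ <| Steps.refl _⟩
    · simp only [Instr.Fits, Reg.cell]; omega
    · simp [Instr.next, h30, hm'.arr, Cmd.compile, addrCode]
  | put σ j x r =>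
    intro o m hP hm hσ
    have := r.ctorIdx_lt
    obtain ⟨m', hm', h30, hst⟩ := steps_addrCode (input := input) hs hm hσ j x hP.append_left
    refine ⟨_, 6, by omega, hm'.setArr j _ _, hσ.setArr (hσ.1 _) j _,
      hst.trans <| Steps.cons hP.append_right.head ?_ trivial ?_ <| Steps.refl _⟩
    · simp only [Instr.Fits]
    · simp [Instr.next, h30, hm'.reg, Cmd.compile, addrCode]
  | read σ r x hk =>
    intro o m hP hm hσ
    have := r.ctorIdx_lt
    refine ⟨_, 1, by omega, hm.setReg r _, hσ.setReg (hin _) r,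
      Steps.cons hP.head ?_ ?_ ?_ <| Steps.refl _⟩
    · simp only [Instr.Fits, Reg.cell]; omega
    · simpa only [Instr.ReadsBelow, hm.reg] using hk
    · simp [Instr.next, hm.reg, Cmd.compile]
  | seq _ _ ih₁ ih₂ =>
    intro o m hP hm hσ
    obtain ⟨m₁, u₁, hu₁, hm₁, hσ₁, h₁⟩ := ih₁ o m hP.append_left hm hσ
    obtain ⟨m₂, u₂, hu₂, hm₂, hσ₂, h₂⟩ := ih₂ _ m₁ hP.append_right hm₁ hσ₁
    refine ⟨m₂, u₁ + u₂, by omega, hm₂, hσ₂, ?_⟩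
    simpa [Cmd.compile, Nat.add_assoc] using h₁.trans h₂
  | @ifZero r c d σ σ' t h0 _ ih =>
    intro o m hP hm hσ
    have hP' := hP.tail.append_right.tail
    obtain ⟨m', u, hu, hm', hσ', h⟩ := ih _ m hP' hm hσ
    refine ⟨m', u + 1, by omega, hm', hσ', Steps.cons hP.head trivial trivial ?_
      (σ₁ := ⟨o + 1 + (d.compile (o + 1)).length + 1, m⟩) ?_⟩
    · simp [Instr.next, hm.reg, h0]
    · convert h using 2
      simp [Cmd.compile]; omega
  | @ifPos r c d σ σ' t h0 _ ih =>
    intro o m hP hm hσ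
    obtain ⟨m', u, hu, hm', hσ', h⟩ := ih _ m hP.tail.append_left hm hσ
    refine ⟨m', u + 1 + 1, by omega, hm', hσ', Steps.cons hP.head trivial trivial ?_ (h.trans ?_)⟩
    · simp [Instr.next, hm.reg, h0]
    · refine Steps.cons hP.tail.append_right.head trivial trivial ?_ (Steps.refl _)
      simp [Instr.next, Cmd.compile]; omega
  | @whileZero r c σ h0 =>
    intro o m hP hm hσ
    refine ⟨m, 1, by omega, hm, hσ, Steps.cons hP.head trivial trivial ?_ (Steps.refl _)⟩
    simp [Instr.next, hm.reg, h0, Cmd.compile]; omega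
  | @whilePos r c σ σ₁ σ₂ t u h0 _ _ ih₁ ih₂ =>
    intro o m hP hm hσ
    obtain ⟨m₁, u₁, hu₁, hm₁, hσ₁, h₁⟩ := ih₁ _ m hP.tail.append_left hm hσ
    obtain ⟨m₂, u₂, hu₂, hm₂, hσ₂, h₂⟩ := ih₂ o m₁ hP hm₁ hσ₁
    refine ⟨m₂, u₁ + (u₂ + 1) + 1, by omega, hm₂, hσ₂,
      Steps.cons hP.head trivial trivial ?_ (h₁.trans ?_)⟩
    · simp [Instr.next, hm.reg, h0]
    · exact Steps.cons hP.tail.append_right.head trivial trivial rfl h₂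

/-! ### Verification of structured programs -/

/-- From the state `σ`, with time credit `k`, the program `c` ends in a state that satisfies `Q`
together with the remaining credit. -/
def Cmd.Wp (input : List ℕ) (b : ℕ) (c : Cmd) (Q : St → ℕ → Prop) (σ : St) (k : ℕ) : Prop :=
  ∃ σ' t k', Exec input b c σ σ' t ∧ k = k' + t ∧ Q σ' k'

namespace Cmd

variable {input : List ℕ} {b : ℕ} {Q : St → ℕ → Prop} {σ : St} {k : ℕ}

theorem wp_skip (h : Q σ k) : skip.Wp input b Q σ k := ⟨σ, 0, k, .skip σ, rfl, h⟩

theorem wp_set {r : Reg} {v : ℕ} (hv : v ≤ b) (h : Q (σ.setReg r v) k) :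
    (set r v).Wp input b Q σ (k + 1) := ⟨_, 1, k, .set σ r v hv, rfl, h⟩

theorem wp_add {r x y : Reg} (hv : σ.reg x + σ.reg y ≤ b)
    (h : Q (σ.setReg r (σ.reg x + σ.reg y)) k) :
    (add r x y).Wp input b Q σ (k + 1) := ⟨_, 1, k, .add σ r x y hv, rfl, h⟩

theorem wp_sub {r x y : Reg} (h : Q (σ.setReg r (σ.reg x - σ.reg y)) k) :
    (sub r x y).Wp input b Q σ (k + 1) := ⟨_, 1, k, .sub σ r x y, rfl, h⟩

theorem wp_get {r x : Reg} {j : Arr} (h : Q (σ.setReg r (σ.arr j (σ.reg x))) k) :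
    (get r j x).Wp input b Q σ (k + 1) := ⟨_, 1, k, .get σ r j x, rfl, h⟩

theorem wp_put {r x : Reg} {j : Arr} (h : Q (σ.setArr j (σ.reg x) (σ.reg r)) k) :
    (put j x r).Wp input b Q σ (k + 1) := ⟨_, 1, k, .put σ j x r, rfl, h⟩

theorem wp_read {r x : Reg} (hx : σ.reg x < input.length)
    (h : Q (σ.setReg r (inputMem input (σ.reg x))) k) :
    (read r x).Wp input b Q σ (k + 1) := ⟨_, 1, k, .read σ r x hx, rfl, h⟩

theorem wp_seq {c d : Cmd} (h : c.Wp input b (d.Wp input b Q) σ k) :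
    (seq c d).Wp input b Q σ k := by
  obtain ⟨σ₁, t, k₁, h₁, rfl, σ₂, u, k₂, h₂, rfl, hQ⟩ := h
  exact ⟨σ₂, t + u, k₂, .seq h₁ h₂, by omega, hQ⟩

theorem wp_ifZero {r : Reg} {c d : Cmd} (h₀ : σ.reg r = 0 → c.Wp input b Q σ k)
    (h₁ : σ.reg r ≠ 0 → d.Wp input b Q σ k) : (ifZero r c d).Wp input b Q σ (k + 1) := by
  by_cases h : σ.reg r = 0
  · obtain ⟨σ', t, k', he, rfl, hQ⟩ := h₀ h
    exact ⟨σ', t + 1, k', .ifZero d h he, by omega, hQ⟩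
  · obtain ⟨σ', t, k', he, rfl, hQ⟩ := h₁ h
    exact ⟨σ', t + 1, k', .ifPos c h he, by omega, hQ⟩

/-- The rule for loops. Since each test of the condition costs a credit, termination is implicit in
the invariant `J`. -/
theorem wp_whilePos {r : Reg} {c : Cmd} {J : St → ℕ → Prop} (h : J σ k)
    (hJ : ∀ σ k, J σ k → ∃ k', k = k' + 1 ∧ (σ.reg r = 0 → Q σ k') ∧
      (σ.reg r ≠ 0 → c.Wp input b J σ k')) : (whilePos r c).Wp input b Q σ k := by
  induction k using Nat.strong_induction_on generalizing σ with
  | _ k ih =>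
    obtain ⟨k', rfl, h₀, h₁⟩ := hJ σ k h
    by_cases hr : σ.reg r = 0
    · exact ⟨σ, 1, k', .whileZero c hr, rfl, h₀ hr⟩
    · obtain ⟨σ₁, t, k₁, he, rfl, hJ₁⟩ := h₁ hr
      obtain ⟨σ₂, u, k₂, he₂, rfl, hQ⟩ := ih k₁ (by omega) hJ₁
      exact ⟨σ₂, _, k₂, .whilePos hr he he₂, by omega, hQ⟩

end Cmd

end RAM

/-! ### Adjacency lists in memory, and reading an instance into its graph. -/

namespace RAM

/-! ### Labelled graphs in memory -/

/-- An edge of a labelled graph: source, label and target. -/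
structure Edge where
  src : ℕ
  lab : ℕ
  dst : ℕ

/-- The edges leaving `x`. -/
def outEdges (E : List Edge) (x : ℕ) : List Edge := E.filter fun e => e.src = x

/-- The number of the first edge in the adjacency list of each node; the edges are numbered from
`1` on, starting at the end of the list. -/
def headOf : List Edge → ℕ → ℕ
  | [] => fun _ => 0
  | e :: E => Function.update (headOf E) e.src (E.length + 1)

/-- The successor of each edge in its adjacency list. -/
def nextOf : List Edge → ℕ → ℕ
  | [] => fun _ => 0
  | e :: E => Function.update (nextOf E) (E.length + 1) (headOf E e.src)

/-- The label of each edge. -/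
def labOf : List Edge → ℕ → ℕ
  | [] => fun _ => 0
  | e :: E => Function.update (labOf E) (E.length + 1) e.lab

/-- The target of each edge. -/
def dstOf : List Edge → ℕ → ℕ
  | [] => fun _ => 0
  | e :: E => Function.update (dstOf E) (E.length + 1) e.dst

/-- The edges in the list `L` are those that one finds by following the list starting at `p`. -/
def Chain (E : List Edge) : ℕ → List Edge → Prop
  | p, [] => p = 0
  | p, e :: L => p ≠ 0 ∧ labOf E p = e.lab ∧ dstOf E p = e.dst ∧ Chain E (nextOf E p) L

theorem headOf_le (E : List Edge) (x : ℕ) : headOf E x ≤ E.length := by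
  induction E with
  | nil => simp [headOf]
  | cons e E ih =>
    simp only [headOf, Function.update_apply, List.length_cons]
    split <;> omega

theorem nextOf_le (E : List Edge) (p : ℕ) : nextOf E p ≤ E.length := by
  induction E with
  | nil => simp [nextOf]
  | cons e E ih =>
    have := headOf_le E e.src
    simp only [nextOf, Function.update_apply, List.length_cons]
    split <;> omega

/-- The new edge gets the fresh number `E.length + 1`, while a chain that starts at an old number
visits only old numbers. -/
theorem Chain.cons {E : List Edge} {p : ℕ} {L : List Edge} (h : Chain E p L) (hp : p ≤ E.length)
    (e : Edge) : Chain (e :: E) p L := by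
  induction L generalizing p with
  | nil => exact h
  | cons e' L ih =>
    obtain ⟨h0, hl, hd, hn⟩ := h
    have hne : p ≠ E.length + 1 := by omega
    refine ⟨h0, ?_, ?_, ?_⟩
    · rw [labOf, Function.update_of_ne hne, hl]
    · rw [dstOf, Function.update_of_ne hne, hd]
    · rw [nextOf, Function.update_of_ne hne]
      exact ih hn (nextOf_le E p)

/-- A new edge is prepended to the adjacency list of its source, whose former head becomes its
successor. -/
theorem chain_headOf (E : List Edge) (x : ℕ) : Chain E (headOf E x) (outEdges E x) := by
  induction E with
  | nil => rfl
  | cons e E ih =>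
    by_cases h : e.src = x
    · subst h
      have ih' := Chain.cons ih (headOf_le E _) e
      simpa [outEdges, Chain, headOf, labOf, dstOf, nextOf] using ih'
    · have ih' := Chain.cons ih (headOf_le E _) e
      simpa [outEdges, h, headOf, Function.update_of_ne (Ne.symm h)] using ih'

/-- The arrays contain the graph with the list `E` of edges. -/
structure GraphAt (σ : St) (E : List Edge) : Prop where
  head : σ.arr .head = headOf E
  next : σ.arr .next = nextOf E
  lab : σ.arr .lab = labOf E
  dst : σ.arr .dst = dstOf E

namespace Cmd

variable {input : List ℕ} {b : ℕ} {Q : St → ℕ → Prop} {σ : St} {k : ℕ}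

/-- Copy the register `a` to `r`. -/
def mov (r a : Reg) : Cmd := seq (set r 0) (sub r a r)

theorem wp_mov {r a : Reg} (hne : a ≠ r) (h : Q ((σ.setReg r 0).setReg r (σ.reg a)) k) :
    (mov r a).Wp input b Q σ (k + 2) := by
  refine wp_seq (wp_set (Nat.zero_le _) (wp_sub ?_))
  simpa [hne] using h

/-- Add the edge given by the registers `src`, `lab`, `dst` to the graph. -/
def addEdge : Cmd :=
  seq (add .edges .edges .one) <| seq (get .tmp .head .src) <| seq (put .next .edges .tmp) <|
  seq (put .lab .edges .lab) <| seq (put .dst .edges .dst) (put .head .src .edges)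

theorem wp_addEdge {E : List Edge} (hE : GraphAt σ E) (h1 : σ.reg .one = 1)
    (he : σ.reg .edges = E.length) (hb : E.length + 1 ≤ b)
    (h : ∀ σ' : St, (∀ r, r ≠ .edges → r ≠ .tmp → σ'.reg r = σ.reg r) →
      σ'.reg .edges = E.length + 1 → GraphAt σ' (⟨σ.reg .src, σ.reg .lab, σ.reg .dst⟩ :: E) →
      Q σ' k) : addEdge.Wp input b Q σ (k + 6) := by
  refine wp_seq (wp_add (by omega) (wp_seq (wp_get (wp_seq (wp_put (wp_seq (wp_put (wp_seq
    (wp_put (wp_put (h _ ?_ ?_ ⟨?_, ?_, ?_, ?_⟩)))))))))))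
  · intro r hr hr'
    simp [hr, hr']
  · simp [h1, he]
  · simp [headOf, hE.head, h1, he]
  · simp [nextOf, hE.next, hE.head, h1, he]
  · simp [labOf, hE.lab, h1, he]
  · simp [dstOf, hE.dst, h1, he]

end Cmd

/-! ### Reading the input -/

/-- The labels of the edges of the graph built from an instance. For the entry `j` of a tuple of
the relation `i`, the edge from the element to the tuple has label `up i j`, and the edge from the
tuple to the element has label `down i j`. All elements have an edge with label `glob` to a common
node. -/
structure Labels where
  up : ℕ → ℕ → ℕ
  down : ℕ → ℕ → ℕ
  glob : ℕ

namespace Labels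

variable (Λ : Labels)

/-- Add the edges of the tuple node `τ` of the relation `i`, for the entries from position `j` on. -/
def tupleEdges (i τ : ℕ) : ℕ → List ℕ → List Edge → List Edge
  | _, [], E => E
  | j, v :: vs, E => tupleEdges i τ (j + 1) vs (⟨τ, Λ.down i j, v⟩ :: ⟨v, Λ.up i j, τ⟩ :: E)

/-- Add the edges of a list of tuples, to be represented by nodes from `τ` on. -/
def tuplesEdges : ℕ → List (ℕ × List ℕ) → List Edge → List Edge
  | _, [], E => E
  | τ, t :: T, E => tuplesEdges (τ + 1) T (Λ.tupleEdges t.1 τ 0 t.2 E)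

/-- Add the edges from the elements below `m` to the node `n`. -/
def globEdges (n : ℕ) : ℕ → List Edge → List Edge
  | 0, E => E
  | m + 1, E => globEdges n m (⟨m, Λ.glob, n⟩ :: E)

/-- The graph of an instance with `n` elements and the list `T` of tuples. -/
def graph (n : ℕ) (T : List (ℕ × List ℕ)) : List Edge :=
  Λ.globEdges n n (Λ.tuplesEdges (n + 1) T [])

theorem length_tupleEdges (i τ j : ℕ) (vs : List ℕ) (E : List Edge) :
    (Λ.tupleEdges i τ j vs E).length = E.length + 2 * vs.length := by
  induction vs generalizing j E with
  | nil => simp [tupleEdges]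
  | cons v vs ih => rw [tupleEdges, ih]; simp; omega

theorem length_tuplesEdges (τ : ℕ) (T : List (ℕ × List ℕ)) (E : List Edge) :
    (Λ.tuplesEdges τ T E).length = E.length + 2 * (T.map fun t => t.2.length).sum := by
  induction T generalizing τ E with
  | nil => simp [tuplesEdges]
  | cons t T ih => rw [tuplesEdges, ih, length_tupleEdges]; simp; omega

theorem length_globEdges (n m : ℕ) (E : List Edge) :
    (Λ.globEdges n m E).length = E.length + m := by
  induction m generalizing E with
  | zero => simp [globEdges]
  | succ m ih => rw [globEdges, ih]; simp; omega

theorem length_graph (n : ℕ) (T : List (ℕ × List ℕ)) :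
    (Λ.graph n T).length = n + 2 * (T.map fun t => t.2.length).sum := by
  rw [graph, length_globEdges, length_tuplesEdges]
  simp; omega

theorem tuplesEdges_append (τ : ℕ) (T T' : List (ℕ × List ℕ)) (E : List Edge) :
    Λ.tuplesEdges τ (T ++ T') E = Λ.tuplesEdges (τ + T.length) T' (Λ.tuplesEdges τ T E) := by
  induction T generalizing τ E with
  | nil => rfl
  | cons t T ih =>
    rw [List.cons_append, tuplesEdges, ih, tuplesEdges, List.length_cons]
    congr 1; omega

theorem mem_tupleEdges {i τ j : ℕ} {vs : List ℕ} {E : List Edge} {e : Edge} :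
    e ∈ Λ.tupleEdges i τ j vs E ↔ e ∈ E ∨ ∃ m v, vs[m]? = some v ∧
      (e = ⟨v, Λ.up i (j + m), τ⟩ ∨ e = ⟨τ, Λ.down i (j + m), v⟩) := by
  induction vs generalizing j E with
  | nil => simp [tupleEdges]
  | cons v vs ih =>
    rw [tupleEdges, ih, List.mem_cons, List.mem_cons]
    constructor
    · rintro ((h | h | h) | ⟨m, w, hw, h⟩)
      · exact .inr ⟨0, v, rfl, .inr h⟩
      · exact .inr ⟨0, v, rfl, .inl h⟩
      · exact .inl h
      · refine .inr ⟨m + 1, w, hw, ?_⟩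
        rwa [Nat.add_right_comm, Nat.add_assoc] at h
    · rintro (h | ⟨m, w, hw, h⟩)
      · exact .inl (.inr (.inr h))
      · cases m with
        | zero =>
          obtain rfl : v = w := by simpa using hw
          tauto
        | succ m =>
          refine .inr ⟨m, w, hw, ?_⟩
          rwa [Nat.add_right_comm, Nat.add_assoc]

theorem mem_tuplesEdges {τ : ℕ} {T : List (ℕ × List ℕ)} {E : List Edge} {e : Edge} :
    e ∈ Λ.tuplesEdges τ T E ↔ e ∈ E ∨ ∃ u t, T[u]? = some t ∧ ∃ j v, t.2[j]? = some v ∧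
      (e = ⟨v, Λ.up t.1 j, τ + u⟩ ∨ e = ⟨τ + u, Λ.down t.1 j, v⟩) := by
  induction T generalizing τ E with
  | nil => simp [tuplesEdges]
  | cons t T ih =>
    rw [tuplesEdges, ih, mem_tupleEdges]
    constructor
    · rintro ((h | ⟨m, v, hv, h⟩) | ⟨u, t', ht, j, v, hv, h⟩)
      · exact .inl h
      · exact .inr ⟨0, t, rfl, m, v, hv, by simpa using h⟩
      · refine .inr ⟨u + 1, t', ht, j, v, hv, ?_⟩
        rwa [Nat.add_right_comm, Nat.add_assoc] at h
    · rintro (h | ⟨u, t', ht, j, v, hv, h⟩)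
      · exact .inl (.inl h)
      · cases u with
        | zero =>
          obtain rfl : t = t' := by simpa using ht
          exact .inl (.inr ⟨j, v, hv, by simpa using h⟩)
        | succ u =>
          refine .inr ⟨u, t', ht, j, v, hv, ?_⟩
          rwa [Nat.add_right_comm, Nat.add_assoc]

theorem mem_globEdges {n m : ℕ} {E : List Edge} {e : Edge} :
    e ∈ Λ.globEdges n m E ↔ e ∈ E ∨ ∃ v < m, e = ⟨v, Λ.glob, n⟩ := by
  induction m generalizing E with
  | zero => simp [globEdges]
  | succ m ih =>
    rw [globEdges, ih, List.mem_cons]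
    constructor
    · rintro ((h | h) | ⟨v, hv, h⟩)
      · exact .inr ⟨m, by omega, h⟩
      · exact .inl h
      · exact .inr ⟨v, by omega, h⟩
    · rintro (h | ⟨v, hv, h⟩)
      · exact .inl (.inr h)
      · by_cases hvm : v = m
        · subst hvm; exact .inl (.inl h)
        · exact .inr ⟨v, by omega, h⟩

theorem mem_graph {n : ℕ} {T : List (ℕ × List ℕ)} {e : Edge} :
    e ∈ Λ.graph n T ↔ (∃ u t, T[u]? = some t ∧ ∃ j v, t.2[j]? = some v ∧
      (e = ⟨v, Λ.up t.1 j, n + 1 + u⟩ ∨ e = ⟨n + 1 + u, Λ.down t.1 j, v⟩)) ∨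
      ∃ v < n, e = ⟨v, Λ.glob, n⟩ := by
  rw [graph, mem_globEdges, mem_tuplesEdges]
  simp

end Labels

/-- `rest` is the part of the input from position `p` on. -/
structure ReadAt (input : List ℕ) (p : ℕ) (rest : List ℕ) : Prop where
  drop : input.drop p = rest
  length : p + rest.length = input.length

theorem ReadAt.cons {input : List ℕ} {p v : ℕ} {rest : List ℕ}
    (h : ReadAt input p (v :: rest)) :
    p < input.length ∧ inputMem input p = v ∧ ReadAt input (p + 1) rest := by
  have hl := h.length
  rw [List.length_cons] at hl
  have hp : p < input.length := by omega
  have hd := h.drop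
  rw [List.drop_eq_getElem_cons hp] at hd
  obtain ⟨h1, h2⟩ := List.cons.inj hd
  exact ⟨hp, by simp [inputMem, List.getD, List.getElem?_eq_getElem hp, h1], h2, by omega⟩

/-- While the input is read: `E` are the edges found so far, `M` is the next free node, `rest` is
the unread part of the input; the registers `ans` and `rest` are not in use. -/
structure ParseInv (input : List ℕ) (n x y : ℕ) (σ : St) (E : List Edge) (M : ℕ)
    (rest : List ℕ) : Prop where
  graph : GraphAt σ E
  one : σ.reg .one = 1
  edges : σ.reg .edges = E.length
  num : σ.reg .num = n
  nodes : σ.reg .nodes = M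
  drop : ReadAt input (σ.reg .pos) rest
  ans : σ.reg .ans = x
  rest : σ.reg .rest = y

namespace Cmd

variable {input : List ℕ} {b : ℕ} {Q : St → ℕ → Prop} {σ : St} {k : ℕ} (Λ : Labels)

/-- Read one entry of a tuple. -/
def readEntry (i j : ℕ) : Cmd :=
  seq (read .src .pos) <| seq (add .pos .pos .one) <| seq (set .lab (Λ.up i j)) <|
  seq (mov .dst .nodes) <| seq addEdge <| seq (mov .dst .src) <| seq (mov .src .nodes) <|
  seq (set .lab (Λ.down i j)) addEdge

/-- The 22 credits are two runs of `addEdge` at 6, three of `mov` at 2, and four single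
instructions. -/
theorem wp_readEntry {n x y i j M v : ℕ} {E : List Edge} {rest : List ℕ}
    (hσ : ParseInv input n x y σ E M (v :: rest)) (hE : E.length + 2 ≤ b)
    (hin : input.length ≤ b) (hu : Λ.up i j ≤ b) (hd : Λ.down i j ≤ b)
    (h : ∀ σ' : St, σ'.reg .cnt = σ.reg .cnt →
      ParseInv input n x y σ' (⟨M, Λ.down i j, v⟩ :: ⟨v, Λ.up i j, M⟩ :: E) M rest → Q σ' k) :
    (readEntry Λ i j).Wp input b Q σ (k + 22) := by
  obtain ⟨hp, hv, hdrop⟩ := hσ.drop.cons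
  have h1 := hσ.one
  have h2 := hσ.edges
  have h3 := hσ.nodes
  have hG := hσ.graph
  refine wp_seq (wp_read hp (wp_seq (wp_add (by simp; omega) (wp_seq (wp_set hu (wp_seq (wp_mov
    (by decide) (wp_seq (wp_addEdge (E := E) ⟨hG.1, hG.2, hG.3, hG.4⟩ (by simpa using h1)
    (by simpa using h2) (by omega) ?_)))))))))
  intro σ₁ hr he hG₁
  have e1 := hr .one (by decide) (by decide)
  have e2 := hr .nodes (by decide) (by decide)
  have e3 := hr .src (by decide) (by decide)
  have e4 := hr .cnt (by decide) (by decide)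
  have e5 := hr .num (by decide) (by decide)
  have e6 := hr .pos (by decide) (by decide)
  have e7 := hr .ans (by decide) (by decide)
  have e8 := hr .rest (by decide) (by decide)
  simp only [St.reg_setReg, reduceCtorEq, if_true, if_false] at e1 e2 e3 e4 e5 e6 e7 e8 hG₁
  refine wp_seq (wp_mov (by decide) (wp_seq (wp_mov (by decide) (wp_seq (wp_set hd (wp_addEdge
    (E := _) ⟨hG₁.1, hG₁.2, hG₁.3, hG₁.4⟩ (by simpa [h1] using e1) (by simpa using he)
    (by simp; omega) ?_))))))
  intro σ₂ hr₂ he₂ hG₂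
  have f1 := hr₂ .one (by decide) (by decide)
  have f2 := hr₂ .nodes (by decide) (by decide)
  have f4 := hr₂ .cnt (by decide) (by decide)
  have f5 := hr₂ .num (by decide) (by decide)
  have f6 := hr₂ .pos (by decide) (by decide)
  have f7 := hr₂ .ans (by decide) (by decide)
  have f8 := hr₂ .rest (by decide) (by decide)
  simp only [St.reg_setReg, reduceCtorEq, if_true, if_false] at f1 f2 f4 f5 f6 f7 f8 hG₂
  refine h σ₂ (by rw [f4, e4]) ⟨?_, ?_, ?_, ?_, ?_, ?_, ?_, ?_⟩
  · rw [e2, e3, h3, hv] at hG₂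
    exact hG₂
  · rw [f1, e1, h1]
  · rw [he₂]; simp
  · rw [f5, e5, hσ.num]
  · rw [f2, e2, h3]
  · rw [f6, e6, h1]
    exact hdrop
  · rw [f7, e7, hσ.ans]
  · rw [f8, e8, hσ.rest]

/-- Read `m` entries of a tuple, from position `j` on. -/
def readEntries (i : ℕ) : ℕ → ℕ → Cmd
  | 0, _ => skip
  | m + 1, j => seq (readEntry Λ i j) (readEntries i m (j + 1))

theorem wp_readEntries {n x y i M K : ℕ} {rest : List ℕ} (vs : List ℕ) {j : ℕ} {E : List Edge}
    (hσ : ParseInv input n x y σ E M (vs ++ rest)) (hE : E.length + 2 * vs.length ≤ b)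
    (hin : input.length ≤ b) (hj : j + vs.length ≤ K)
    (hΛ : ∀ j < K, Λ.up i j ≤ b ∧ Λ.down i j ≤ b)
    (h : ∀ σ' : St, σ'.reg .cnt = σ.reg .cnt →
      ParseInv input n x y σ' (Λ.tupleEdges i M j vs E) M rest → Q σ' k) :
    (readEntries Λ i vs.length j).Wp input b Q σ (k + 22 * vs.length) := by
  induction vs generalizing j E σ with
  | nil => exact wp_skip (h σ rfl hσ)
  | cons v vs ih =>
    rw [List.length_cons] at hE hj
    obtain ⟨hu, hd⟩ := hΛ j (by omega)
    have := wp_readEntry (b := b) (k := k + 22 * vs.length) Λ hσ (by omega) hin hu hd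
      (Q := (readEntries Λ i vs.length (j + 1)).Wp input b Q) (fun σ' hc hσ' =>
        ih hσ' (by simp; omega) (by omega) fun σ'' hc' hσ'' => h σ'' (hc'.trans hc) hσ'')
    exact wp_seq (by rwa [List.length_cons, Nat.mul_succ, ← Nat.add_assoc])

/-- Read the tuples of the relation `i`, of arity `m`. -/
def readRelation (i m : ℕ) : Cmd :=
  seq (read .cnt .pos) <| seq (add .pos .pos .one) <| whilePos .cnt <|
    seq (readEntries Λ i m 0) <| seq (add .nodes .nodes .one) (sub .cnt .cnt .one)

theorem wp_readRelation {n x y i M K m : ℕ} {rest : List ℕ} (ts : List (List ℕ)) {E : List Edge}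
    (hσ : ParseInv input n x y σ E M (ts.length :: (ts.flatten ++ rest)))
    (hts : ∀ t ∈ ts, t.length = m) (hE : E.length + 2 * (ts.length * m) ≤ b)
    (hM : M + ts.length ≤ b) (hin : input.length ≤ b) (hm : m ≤ K)
    (hΛ : ∀ j < K, Λ.up i j ≤ b ∧ Λ.down i j ≤ b)
    (h : ∀ σ' : St, ParseInv input n x y σ' (Λ.tuplesEdges M (ts.map fun t => (i, t)) E)
      (M + ts.length) rest → Q σ' k) :
    (readRelation Λ i m).Wp input b Q σ (k + 3 + ts.length * (22 * m + 3)) := by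
  obtain ⟨hp, hv, hdrop⟩ := hσ.drop.cons
  have h1 := hσ.one
  rw [show k + 3 + ts.length * (22 * m + 3) = k + ts.length * (22 * m + 3) + 1 + 1 + 1 by omega]
  refine wp_seq (wp_read hp (wp_seq (wp_add (by simp; omega) ?_)))
  -- The invariant fixes the final edge list and the final free node: completing the remaining
  -- tuples `ts'` from the current edges must give what completing all of `ts` gives from the start.
  -- The remaining credit is `22 * m + 3` per tuple, and 1 for the last test.
  refine wp_whilePos (J := fun σ k' => ∃ ts' : List (List ℕ), ∃ E' M',
    ParseInv input n x y σ E' M' (ts'.flatten ++ rest) ∧ (∀ t ∈ ts', t.length = m) ∧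
    E'.length + 2 * (ts'.length * m) ≤ b ∧ M' + ts'.length ≤ b ∧ σ.reg .cnt = ts'.length ∧
    Λ.tuplesEdges M' (ts'.map fun t => (i, t)) E' =
      Λ.tuplesEdges M (ts.map fun t => (i, t)) E ∧ M' + ts'.length = M + ts.length ∧
    k' = k + ts'.length * (22 * m + 3) + 1) ?_ ?_
  · refine ⟨ts, E, M, ⟨⟨hσ.graph.1, hσ.graph.2, hσ.graph.3, hσ.graph.4⟩, by simpa using h1,
      by simpa using hσ.edges, by simpa using hσ.num, by simpa using hσ.nodes, ?_,
      by simpa using hσ.ans, by simpa using hσ.rest⟩, hts, hE, hM, ?_, rfl, rfl, rfl⟩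
    · simpa [h1] using hdrop
    · simpa using hv
  · rintro σ k' ⟨ts', E', M', hσ, hts, hE, hM, hc, he, hMM, rfl⟩
    refine ⟨_, rfl, fun h0 => ?_, fun h0 => ?_⟩
    · obtain rfl : ts' = [] := by
        rw [hc] at h0; exact List.length_eq_zero_iff.1 h0
      simp only [List.length_nil, Nat.zero_mul, Nat.add_zero]
      rw [List.length_nil, Nat.add_zero] at hMM
      refine h σ ?_
      rw [← he, ← hMM]
      exact hσ
    · cases ts' with
      | nil => simp [hc] at h0
      | cons t ts' =>
        obtain rfl := hts t (by simp)
        rw [List.flatten_cons, List.append_assoc] at hσ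
        rw [List.length_cons, Nat.add_mul, Nat.one_mul] at hE
        rw [List.length_cons] at hM hMM hc
        have := wp_readEntries (b := b) (j := 0) Λ t hσ (by omega) hin (by omega) hΛ
          (Q := (seq (add .nodes .nodes .one) (sub .cnt .cnt .one)).Wp input b
            (fun σ k' => ∃ ts' : List (List ℕ), ∃ E' M',
    ParseInv input n x y σ E' M' (ts'.flatten ++ rest) ∧ (∀ t' ∈ ts', t'.length = t.length) ∧
    E'.length + 2 * (ts'.length * t.length) ≤ b ∧ M' + ts'.length ≤ b ∧ σ.reg .cnt = ts'.length ∧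
    Λ.tuplesEdges M' (ts'.map fun t => (i, t)) E' =
      Λ.tuplesEdges M (ts.map fun t => (i, t)) E ∧ M' + ts'.length = M + ts.length ∧
    k' = k + ts'.length * (22 * t.length + 3) + 1))
          (k := k + ts'.length * (22 * t.length + 3) + 1 + 1 + 1) (fun σ' hc' hσ' => by
            refine wp_seq (wp_add (by rw [hσ'.nodes, hσ'.one]; omega) (wp_sub ?_))
            refine ⟨ts', _, M' + 1, ⟨⟨hσ'.graph.1, hσ'.graph.2, hσ'.graph.3, hσ'.graph.4⟩, ?_, ?_,
              ?_, ?_, ?_, ?_, ?_⟩, fun t' ht' => hts t' (by simp [ht']), ?_, by omega, ?_, he,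
              by omega, rfl⟩
            · simpa using hσ'.one
            · simpa using hσ'.edges
            · simpa using hσ'.num
            · simp [hσ'.nodes, hσ'.one]
            · simpa using hσ'.drop
            · simpa using hσ'.ans
            · simpa using hσ'.rest
            · rw [Labels.length_tupleEdges]; omega
            · simp [hσ'.one, hc', hc])
        refine wp_seq ?_
        convert this using 1
        rw [List.length_cons, Nat.add_mul, Nat.one_mul]; omega

/-- Read the tuples of a list of relations, given by their numbers and arities. -/
def readRelations : List (ℕ × ℕ) → Cmd
  | [] => skip
  | r :: R => seq (readRelation Λ r.1 r.2) (readRelations R)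

end Cmd

/-- A relation symbol, with its number and arity, and the list of tuples in its relation. -/
structure RelData where
  idx : ℕ
  arity : ℕ
  tuples : List (List ℕ)

namespace RelData

/-- The encoding of a relation in the input. -/
def encode (D : RelData) : List ℕ := D.tuples.length :: D.tuples.flatten

/-- The tuples in the relation, with the number of the relation. -/
def toTuples (D : RelData) : List (ℕ × List ℕ) := D.tuples.map fun t => (D.idx, t)

/-- All tuples have the right length, and the labels are bounded. -/
structure Valid (Λ : Labels) (b : ℕ) (D : RelData) : Prop where
  length : ∀ t ∈ D.tuples, t.length = D.arity
  labels : ∀ j < D.arity, Λ.up D.idx j ≤ b ∧ Λ.down D.idx j ≤ b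

end RelData

/-- The total number of entries of tuples. -/
def entryCount (D : List RelData) : ℕ := (D.map fun d => d.tuples.length * d.arity).sum

theorem sum_length_toTuples (D : List RelData)
    (hD : ∀ d ∈ D, ∀ t ∈ d.tuples, t.length = d.arity) :
    ((D.flatMap RelData.toTuples).map fun t => t.2.length).sum = entryCount D := by
  induction D with
  | nil => rfl
  | cons d D ih =>
    rw [List.flatMap_cons, List.map_append, List.sum_append, ih fun d' hd' => hD d' (by simp [hd'])]
    simp only [RelData.toTuples, List.map_map, entryCount, List.map_cons, List.sum_cons]
    rw [List.map_congr_left (g := fun _ => d.arity)]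
    · simp
    · exact fun t ht => hD d (by simp) t ht

/-- The total number of tuples. -/
def tupleCount (D : List RelData) : ℕ := (D.map fun d => d.tuples.length).sum

namespace Cmd

variable {input : List ℕ} {b : ℕ} {Q : St → ℕ → Prop} {σ : St} {k : ℕ} (Λ : Labels)

theorem wp_readRelations {n x y M : ℕ} {rest : List ℕ} (D : List RelData) {E : List Edge}
    (hσ : ParseInv input n x y σ E M (D.flatMap RelData.encode ++ rest))
    (hD : ∀ d ∈ D, d.Valid Λ b) (hE : E.length + 2 * entryCount D ≤ b)
    (hM : M + tupleCount D ≤ b) (hin : input.length ≤ b)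
    (h : ∀ σ' : St, ParseInv input n x y σ' (Λ.tuplesEdges M (D.flatMap RelData.toTuples) E)
      (M + tupleCount D) rest → Q σ' k) :
    (readRelations Λ (D.map fun d => (d.idx, d.arity))).Wp input b Q σ
      (k + 3 * D.length + 22 * entryCount D + 3 * tupleCount D) := by
  induction D generalizing σ E M with
  | nil => exact wp_skip (h σ hσ)
  | cons d D ih =>
    have hd := hD d (by simp)
    have hc : tupleCount (d :: D) = d.tuples.length + tupleCount D := by simp [tupleCount]
    have hc' : entryCount (d :: D) = d.tuples.length * d.arity + entryCount D := by
      simp [entryCount]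
    rw [hc] at hM h ⊢
    rw [hc'] at hE ⊢
    rw [List.flatMap_cons, List.append_assoc, RelData.encode, List.cons_append] at hσ
    rw [List.map_cons]
    refine wp_seq ?_
    have := wp_readRelation (b := b) (K := d.arity) Λ d.tuples hσ hd.length (by omega) (by omega)
      hin le_rfl hd.labels
      (Q := (readRelations Λ (D.map fun d => (d.idx, d.arity))).Wp input b Q)
      (k := k + 3 * D.length + 22 * entryCount D + 3 * tupleCount D) (fun σ' hσ' => by
        refine ih hσ' (fun d' hd' => hD d' (by simp [hd'])) ?_ (by omega) fun σ'' hσ'' => h σ'' ?_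
        · rw [Labels.length_tuplesEdges]
          have : ((d.tuples.map fun t => (d.idx, t)).map fun t => t.2.length).sum =
              d.tuples.length * d.arity := by
            rw [List.map_map, List.map_congr_left (g := fun _ => d.arity)]
            · simp
            · intro t ht; exact hd.length t ht
          omega
        · rw [List.flatMap_cons, RelData.toTuples, Labels.tuplesEdges_append, List.length_map,
            ← Nat.add_assoc]
          exact hσ'')
    convert this using 1
    rw [List.length_cons, Nat.mul_add]; ring

/-- Add the edges from all elements to the global node. -/
def addGlobEdges : Cmd :=
  seq (mov .cnt .num) <| whilePos .cnt <| seq (sub .cnt .cnt .one) <| seq (mov .src .cnt) <|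
    seq (set .lab Λ.glob) <| seq (mov .dst .num) addEdge

/-- The edges are added from the last element to the first, so the counter itself names the source.
Each round costs 13: the test, a decrement, two copies, a constant and `addEdge`. -/
theorem wp_addGlobEdges {n x y M : ℕ} {rest : List ℕ} {E : List Edge}
    (hσ : ParseInv input n x y σ E M rest) (hE : E.length + n ≤ b) (hg : Λ.glob ≤ b)
    (h : ∀ σ' : St, ParseInv input n x y σ' (Λ.globEdges n n E) M rest → Q σ' k) :
    (addGlobEdges Λ).Wp input b Q σ (k + 13 * n + 3) := by
  refine wp_seq (wp_mov (by decide) ?_)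
  refine wp_whilePos (J := fun σ k' => ∃ m E', ParseInv input n x y σ E' M rest ∧
    E'.length + m ≤ b ∧ σ.reg .cnt = m ∧ Λ.globEdges n m E' = Λ.globEdges n n E ∧
    k' = k + 13 * m + 1) ?_ ?_
  · refine ⟨n, E, ⟨⟨hσ.graph.1, hσ.graph.2, hσ.graph.3, hσ.graph.4⟩, by simpa using hσ.one,
      by simpa using hσ.edges, by simpa using hσ.num, by simpa using hσ.nodes,
      by simpa using hσ.drop, by simpa using hσ.ans, by simpa using hσ.rest⟩, hE, ?_, rfl, rfl⟩
    simpa using hσ.num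
  · rintro σ k' ⟨m, E', hσ, hE, hc, he, rfl⟩
    refine ⟨_, rfl, fun h0 => ?_, fun h0 => ?_⟩
    · obtain rfl : m = 0 := by omega
      refine h σ ?_
      rw [← he]
      exact hσ
    · cases m with
      | zero => omega
      | succ m =>
        refine wp_seq (wp_sub (wp_seq (wp_mov (by decide) (wp_seq (wp_set hg (wp_seq (wp_mov
          (by decide) (wp_addEdge (E := E')
          ⟨hσ.graph.1, hσ.graph.2, hσ.graph.3, hσ.graph.4⟩ (by simpa using hσ.one)
          (by simpa using hσ.edges) (by omega) ?_))))))))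
        intro σ' hr he' hG
        simp only [St.reg_setReg, reduceCtorEq, if_true, if_false, hc, hσ.one, hσ.num,
          Nat.add_sub_cancel] at hG hr
        refine ⟨m, _, ⟨hG, ?_, ?_, ?_, ?_, ?_, ?_, ?_⟩, ?_, ?_, he, rfl⟩
        · rw [hr _ (by decide) (by decide)]; simp [hσ.one]
        · rw [he']; simp
        · rw [hr _ (by decide) (by decide)]; simp [hσ.num]
        · rw [hr _ (by decide) (by decide)]; simp [hσ.nodes]
        · rw [hr _ (by decide) (by decide)]; simp [hσ.drop]
        · rw [hr _ (by decide) (by decide)]; simp [hσ.ans]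
        · rw [hr _ (by decide) (by decide)]; simp [hσ.rest]
        · simp; omega
        · rw [hr _ (by decide) (by decide)]; simp

/-- Read the input and build its graph. -/
def parse (R : List (ℕ × ℕ)) : Cmd :=
  seq (set .one 1) <| seq (set .pos 0) <| seq (read .num .pos) <| seq (set .pos 1) <|
  seq (set .edges 0) <| seq (add .nodes .num .one) <| seq (readRelations Λ R) (addGlobEdges Λ)

theorem wp_parse {n x y : ℕ} (D : List RelData) (hx : σ.reg .ans = x) (hy : σ.reg .rest = y)
    (h0 : ∀ j p, σ.arr j p = 0) (hin : input = n :: D.flatMap RelData.encode)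
    (hD : ∀ d ∈ D, d.Valid Λ b) (hE : n + 2 * entryCount D ≤ b) (hM : n + 1 + tupleCount D ≤ b)
    (hlen : input.length ≤ b) (hg : Λ.glob ≤ b)
    (h : ∀ σ' : St, ParseInv input n x y σ' (Λ.graph n (D.flatMap RelData.toTuples))
      (n + 1 + tupleCount D) [] → Q σ' k) :
    (parse Λ (D.map fun d => (d.idx, d.arity))).Wp input b Q σ
      (k + 9 + 13 * n + 3 * D.length + 22 * entryCount D + 3 * tupleCount D) := by
  have hl : 0 < input.length := by simp [hin]
  have e0 : inputMem input 0 = n := by simp [hin, inputMem]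
  have := wp_readRelations (b := b) (x := x) (y := y) (n := n) (M := n + 1) (rest := []) (E := [])
    (σ := (((((σ.setReg .one 1).setReg .pos 0).setReg .num n).setReg .pos 1).setReg
      .edges 0).setReg .nodes (n + 1)) Λ D ?_ hD (by simp; omega) hM hlen
      (Q := (addGlobEdges Λ).Wp input b Q) (k := k + 13 * n + 3) (fun σ' hσ' => by
        refine wp_addGlobEdges Λ hσ' ?_ hg h
        rw [Labels.length_tuplesEdges]
        have := sum_length_toTuples D fun d hd => (hD d hd).length
        simp; omega)
  · rw [show k + 9 + 13 * n + 3 * D.length + 22 * entryCount D + 3 * tupleCount D =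
      k + 13 * n + 3 + 3 * D.length + 22 * entryCount D + 3 * tupleCount D + 6 by omega]
    refine wp_seq (wp_set (by omega) (wp_seq (wp_set (by omega) (wp_seq (wp_read (by simpa using hl)
      (wp_seq (wp_set (by omega) (wp_seq (wp_set (by omega) (wp_seq (wp_add ?_ (wp_seq ?_))))))))))))
    · simp [e0]; omega
    · simpa [e0] using this
  · constructor
    · constructor <;> simp [headOf, nextOf, labOf, dstOf] <;> funext p <;> simp [h0]
    case drop => exact ⟨by simp [hin], by simp [hin]; omega⟩
    all_goals simp [hx, hy]

end Cmd

end RAM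

/-! ### Worklist propagation in linear time. -/

namespace RAM

/-! ### Finite functions -/

theorem St.setReg_setReg (σ : St) (r : Reg) (v w : ℕ) :
    (σ.setReg r v).setReg r w = σ.setReg r w := by simp [setReg]

theorem St.setReg_self (σ : St) (r : Reg) : σ.setReg r (σ.reg r) = σ := by simp [setReg]

namespace Cmd

variable {input : List ℕ} {b : ℕ} {Q : St → ℕ → Prop} {σ : St} {k : ℕ}

/-- Execute the program `c i`, where `i < m` is the content of the register `r`. -/
def switch (r : Reg) : ℕ → (ℕ → Cmd) → Cmd
  | 0, _ => skip
  | m + 1, c => ifZero r (c 0) (seq (sub r r .one) (switch r m fun i => c (i + 1)))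

/-- A case distinction is made by decrementing `r` to zero, at two credits per decrement. The worst
case is charged, so the selected branch must cope with any larger credit `k'`. -/
theorem wp_switch {r : Reg} (hr : r ≠ .one) {m i : ℕ} {c : ℕ → Cmd} (h1 : σ.reg .one = 1)
    (hi : σ.reg r = i) (him : i < m)
    (h : ∀ k', k ≤ k' → (c i).Wp input b Q (σ.setReg r 0) k') :
    (switch r m c).Wp input b Q σ (k + 2 * m) := by
  induction m generalizing σ i c with
  | zero => omega
  | succ m ih =>
    rw [Nat.mul_succ, ← Nat.add_assoc]
    refine wp_ifZero (fun h0 => ?_) fun h0 => ?_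
    · obtain rfl : i = 0 := by omega
      have := St.setReg_self σ r
      rw [h0] at this
      rw [this] at h
      exact h _ (by omega)
    · cases i with
      | zero => omega
      | succ i =>
        refine wp_seq (wp_sub (ih (i := i) ?_ ?_ (by omega) ?_))
        · simpa [hr.symm] using h1
        · simp [hi, h1]
        · simpa only [St.setReg_setReg] using h

/-- Put `f l x y` into `r`, where `l < p`, `x < m` and `y < m` are the contents of three
registers. -/
def apply₃ (p m : ℕ) (f : ℕ → ℕ → ℕ → ℕ) (r rl rx ry : Reg) : Cmd :=
  seq (mov .tmp rl) <| switch .tmp p fun l => seq (mov .tmp rx) <| switch .tmp m fun x =>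
    seq (mov .tmp ry) <| switch .tmp m fun y => set r (f l x y)

/-- The table of `f` is hard-wired as three nested case distinctions. Since `p` and `m` do not
depend on the input, an evaluation takes constant time. -/
theorem wp_apply₃ {p m : ℕ} {f : ℕ → ℕ → ℕ → ℕ} {r rl rx ry : Reg}
    (hl : rl ≠ .tmp) (hx : rx ≠ .tmp) (hy : ry ≠ .tmp) (h1 : σ.reg .one = 1)
    (hlp : σ.reg rl < p) (hxm : σ.reg rx < m) (hym : σ.reg ry < m)
    (hf : f (σ.reg rl) (σ.reg rx) (σ.reg ry) ≤ b)
    (h : ∀ k', k ≤ k' →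
      Q ((σ.setReg .tmp 0).setReg r (f (σ.reg rl) (σ.reg rx) (σ.reg ry))) k') :
    (apply₃ p m f r rl rx ry).Wp input b Q σ (k + 2 * p + 4 * m + 7) := by
  rw [show k + 2 * p + 4 * m + 7 = k + 1 + 2 * m + 2 + 2 * m + 2 + 2 * p + 2 by omega]
  refine wp_seq (wp_mov hl (wp_switch (by decide) (i := σ.reg rl) (by simpa using h1) (by simp) hlp
    fun k₁ hk₁ => ?_))
  simp only [St.setReg_setReg]
  obtain ⟨k₁, rfl⟩ := Nat.exists_eq_add_of_le' hk₁
  refine wp_seq (?_ : Wp _ _ _ _ _ (k₁ + (k + 1 + 2 * m + 2 + 2 * m + 2)))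
  rw [show k₁ + (k + 1 + 2 * m + 2 + 2 * m + 2) = k₁ + (k + 1 + 2 * m + 2) + 2 * m + 2 by omega]
  refine wp_mov hx (wp_switch (by decide) (i := σ.reg rx) (by simpa using h1) (by simp [hx]) hxm
    fun k₂ hk₂ => ?_)
  simp only [St.setReg_setReg]
  obtain ⟨k₂, rfl⟩ := Nat.exists_eq_add_of_le' hk₂
  refine wp_seq (?_ : Wp _ _ _ _ _ (k₂ + (k₁ + (k + 1 + 2 * m + 2))))
  rw [show k₂ + (k₁ + (k + 1 + 2 * m + 2)) = k₂ + k₁ + (k + 1) + 2 * m + 2 by omega]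
  · refine wp_mov hy (wp_switch (by decide) (i := σ.reg ry) (by simpa using h1) (by simp [hy]) hym
      fun k₃ hk₃ => ?_)
    simp only [St.setReg_setReg]
    obtain ⟨k₃, rfl⟩ := Nat.exists_eq_add_of_le' hk₃
    exact wp_set hf (h (k₃ + (k₂ + k₁ + k)) (by omega))

end Cmd

/-! ### Propagation along the edges of a graph -/

/-- The registers that change during propagation. -/
def Reg.scratch : Reg → Bool
  | .cnt | .src | .lab | .dst | .ptr | .top | .valSrc | .valDst | .new | .tmp | .res => true
  | _ => false

/-- The contents of the registers that do not change during propagation. -/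
def St.saved (σ : St) (r : Reg) : ℕ := if r.scratch then 0 else σ.reg r

@[simp] theorem St.saved_setReg {σ : St} {r : Reg} {v : ℕ} :
    (σ.setReg r v).saved = if r.scratch then σ.saved else Function.update σ.saved r v := by
  funext r'
  by_cases hr : r' = r
  · subst hr; cases h : r'.scratch <;> simp [saved, h]
  · cases h : r.scratch <;> simp [saved, hr]

@[simp] theorem St.saved_setArr {σ : St} {j : Arr} {x v : ℕ} :
    (σ.setArr j x v).saved = σ.saved := rfl

theorem St.reg_eq_of_saved {σ σ' : St} (h : σ.saved = σ'.saved) (r : Reg)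
    (hr : r.scratch = false) : σ.reg r = σ'.reg r := by
  simpa [saved, hr] using congrFun h r

/-- The values that can be obtained from `w₀` by updates along the edges. -/
inductive Reach (f : ℕ → ℕ → ℕ → ℕ) (E : List Edge) (w₀ : ℕ → ℕ) : (ℕ → ℕ) → Prop
  | refl : Reach f E w₀ w₀
  | step {w : ℕ → ℕ} {e : Edge} : Reach f E w₀ w → e ∈ E →
      Reach f E w₀ (Function.update w e.dst (f e.lab (w e.src) (w e.dst)))

/-- Properties of the update function that make propagation work: values only decrease, and an edge
that has no effect never has an effect later unless the value of its source changes. -/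
structure Contracting (f : ℕ → ℕ → ℕ → ℕ) : Prop where
  le : ∀ l x y, f l x y ≤ y
  stable : ∀ l x y l' x', f l x y = y → f l x (f l' x' y) = f l' x' y
  idem : ∀ l x y, f l x (f l x y) = f l x y

/-- The array `a` starts with the entries of `S`, the head of the list coming last. -/
def StackAt (a : ℕ → ℕ) : List ℕ → Prop
  | [] => True
  | x :: S => a S.length = x ∧ StackAt a S

theorem StackAt.update {a : ℕ → ℕ} {S : List ℕ} {p : ℕ} (h : StackAt a S) (hp : S.length ≤ p)
    (v : ℕ) : StackAt (Function.update a p v) S := by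
  induction S with
  | nil => trivial
  | cons x S ih =>
    rw [List.length_cons] at hp
    exact ⟨by rw [Function.update_of_ne (by omega)]; exact h.1, ih h.2 (by omega)⟩

/-- The time that is paid for when `x` is put on the stack, where `A` is the time for an edge. -/
def weight (A : ℕ) (E : List Edge) (x : ℕ) : ℕ := A * (outEdges E x).length + 5

/-- The time needed until the stack is empty. -/
def potential (A : ℕ) (E : List Edge) (N : ℕ) (S : List ℕ) (w : ℕ → ℕ) : ℕ :=
  (S.map (weight A E)).sum + ∑ x ∈ Finset.range N, w x * weight A E x

/-- The effect of one update on a weighted sum, with both corrections added so that no truncated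
subtraction occurs. -/
theorem sum_range_update_mul {N d : ℕ} (hd : d < N) (w c : ℕ → ℕ) (v : ℕ) :
    ∑ x ∈ Finset.range N, Function.update w d v x * c x + w d * c d =
      ∑ x ∈ Finset.range N, w x * c x + v * c d := by
  have hd' := Finset.mem_range.2 hd
  rw [← Finset.add_sum_erase _ _ hd', ← Finset.add_sum_erase _ (fun x => w x * c x) hd',
    Finset.sum_congr rfl (g := fun x => w x * c x)]
  · simp; ring
  · intro x hx
    rw [Function.update_of_ne (Finset.ne_of_mem_erase hx)]

/-- The value of `d` drops by at least one, which releases one copy of `weight A E d`; this pays for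
the new stack entry `d`. -/
theorem potential_push {A N d v : ℕ} {E : List Edge} {S : List ℕ} {w : ℕ → ℕ} (hd : d < N)
    (hv : v < w d) :
    potential A E N (d :: S) (Function.update w d v) ≤ potential A E N S w := by
  have h := sum_range_update_mul hd w (weight A E) v
  have : (v + 1) * weight A E d ≤ w d * weight A E d := Nat.mul_le_mul_right _ hv
  rw [potential, potential, List.map_cons, List.sum_cons]
  rw [Nat.add_mul, Nat.one_mul] at this
  omega

theorem sum_outEdges_le (E : List Edge) (N : ℕ) :
    ∑ x ∈ Finset.range N, (outEdges E x).length ≤ E.length := by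
  induction E with
  | nil => simp [outEdges]
  | cons e E ih =>
    have : ∀ x, (outEdges (e :: E) x).length = (if e.src = x then 1 else 0) +
        (outEdges E x).length := by
      intro x
      by_cases h : e.src = x <;> simp [outEdges, h]; omega
    simp only [this, Finset.sum_add_distrib, Finset.sum_ite_eq, List.length_cons]
    split <;> omega

theorem sum_weight_le (A : ℕ) (E : List Edge) (N : ℕ) :
    ∑ x ∈ Finset.range N, weight A E x ≤ A * E.length + 5 * N := by
  simp only [weight, Finset.sum_add_distrib, ← Finset.mul_sum, Finset.sum_const, Finset.card_range]
  have := Nat.mul_le_mul_left A (sum_outEdges_le E N)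
  simp; omega

/-- The state during propagation: `S` is the stack, and the edges satisfying `X` may still have an
effect. -/
structure PropInv (f : ℕ → ℕ → ℕ → ℕ) (E : List Edge) (N m b : ℕ) (w₀ : ℕ → ℕ) (σ₀ σ : St)
    (S : List ℕ) (X : Edge → Prop) : Prop where
  graph : GraphAt σ E
  saved : σ.saved = σ₀.saved
  reach : Reach f E w₀ (σ.arr .val)
  lt : ∀ x < N, σ.arr .val x < m
  top : σ.reg .top = S.length
  stack : StackAt (σ.arr .stack) S
  mem : ∀ x ∈ S, x < N
  space : S.length + ∑ x ∈ Finset.range N, σ.arr .val x ≤ b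
  fix : ∀ e ∈ E, e.src ∈ S ∨
    f e.lab (σ.arr .val e.src) (σ.arr .val e.dst) = σ.arr .val e.dst ∨ X e

namespace Cmd

variable {input : List ℕ} {b : ℕ} {Q : St → ℕ → Prop} {σ : St} {k : ℕ}

/-- Update the value of the target of the edge `ptr`, and go to the next edge with the same
source. -/
def updateEdge (p m : ℕ) (f : ℕ → ℕ → ℕ → ℕ) : Cmd :=
  seq (get .lab .lab .ptr) <| seq (get .dst .dst .ptr) <| seq (get .valSrc .val .src) <|
  seq (get .valDst .val .dst) <| seq (apply₃ p m f .new .lab .valSrc .valDst) <|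
  seq (sub .tmp .valDst .new) <| seq
    (ifZero .tmp skip
      (seq (put .val .dst .new) <| seq (put .stack .top .dst) (add .top .top .one))) <|
  get .ptr .next .ptr

/-- If the value of the target drops, the target is pushed, at no cost in potential by
`potential_push`. The edges leaving it are then accounted for by the stack, the current edge is
settled by `Contracting.idem`, and other settled edges into the same target remain settled by
`Contracting.stable`. -/
theorem wp_updateEdge {p m : ℕ} {f : ℕ → ℕ → ℕ → ℕ} (hf : Contracting f) {E : List Edge} {N A : ℕ}
    {w₀ : ℕ → ℕ} {σ₀ : St} {S : List ℕ} {e : Edge} {L : List Edge} (hmb : m ≤ b)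
    (h1 : σ₀.reg .one = 1) (hE : ∀ e ∈ E, e.src < N ∧ e.dst < N ∧ e.lab < p)
    (hσ : PropInv f E N m b w₀ σ₀ σ S (· ∈ e :: L)) (he : e ∈ E) (hsrc : σ.reg .src = e.src)
    (hc : Chain E (σ.reg .ptr) (e :: L))
    (h : ∀ σ' S' k', PropInv f E N m b w₀ σ₀ σ' S' (· ∈ L) → σ'.reg .src = e.src →
      Chain E (σ'.reg .ptr) L → k + potential A E N S' (σ'.arr .val) ≤ k' → Q σ' k') :
    (updateEdge p m f).Wp input b Q σ
      (k + potential A E N S (σ.arr .val) + 2 * p + 4 * m + 17) := by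
  obtain ⟨hp, hl, hd, hn⟩ := hc
  obtain ⟨hsN, hdN, hlp⟩ := hE e he
  have h1' : σ.reg .one = 1 := by rw [St.reg_eq_of_saved hσ.saved _ rfl, h1]
  have hG := hσ.graph
  have hle := hf.le e.lab (σ.arr .val e.src) (σ.arr .val e.dst)
  have hid := hf.idem e.lab (σ.arr .val e.src) (σ.arr .val e.dst)
  have hd' := hσ.lt _ hdN
  have hs' := hσ.lt _ hsN
  have hdS : σ.arr .val e.dst ≤ ∑ x ∈ Finset.range N, σ.arr .val x :=
    Finset.single_le_sum (f := fun x => σ.arr .val x) (fun _ _ => Nat.zero_le _)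
      (Finset.mem_range.2 hdN)
  have hl' : σ.arr .lab (σ.reg .ptr) = e.lab := by rw [hG.lab, hl]
  have hd'' : σ.arr .dst (σ.reg .ptr) = e.dst := by rw [hG.dst, hd]
  rw [show k + potential A E N S (σ.arr .val) + 2 * p + 4 * m + 17 =
    k + potential A E N S (σ.arr .val) + 6 + 2 * p + 4 * m + 7 + 4 by omega]
  refine wp_seq (wp_get (wp_seq (wp_get (wp_seq (wp_get (wp_seq (wp_get (wp_seq (wp_apply₃
    (by decide) (by decide) (by decide) (by simpa using h1') (by simpa [hl'] using hlp)
    (by simpa [hsrc] using hs') (by simpa [hd''] using hd') (by simp [hl', hsrc, hd'']; omega)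
    fun k' hk' => ?_)))))))))
  obtain ⟨k', rfl⟩ := Nat.exists_eq_add_of_le' hk'
  refine wp_seq (?_ : Wp _ _ _ _ _ (k' + (k + potential A E N S (σ.arr .val)) + 5 + 1))
  refine wp_sub (wp_seq (wp_ifZero (fun h0 => wp_skip ?_) fun h0 => ?_))
  · refine (?_ : Wp _ _ _ _ _ (k' + (k + potential A E N S (σ.arr .val)) + 3 + 1))
    simp only [St.reg_setReg, reduceCtorEq, if_true, if_false, St.arr_setReg, hl', hsrc, hd''] at h0 ⊢
    refine wp_get (h _ S _ ⟨⟨hG.1, hG.2, hG.3, hG.4⟩, ?_, hσ.reach, hσ.lt, ?_, hσ.stack, hσ.mem,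
      hσ.space, ?_⟩ ?_ ?_ ?_)
    · simp [Reg.scratch, hσ.saved]
    · simpa using hσ.top
    · intro e' he'
      rcases hσ.fix e' he' with h' | h' | h'
      · exact .inl h'
      · exact .inr (.inl h')
      · rcases List.mem_cons.1 h' with rfl | h'
        · exact .inr (.inl (by simp only [St.arr_setReg]; omega))
        · exact .inr (.inr h')
    · simpa using hsrc
    · simpa [hG.next] using hn
    · simp only [St.arr_setReg]; omega
  · refine (?_ : Wp _ _ _ _ _ (k' + (k + potential A E N S (σ.arr .val)) + 1 + 1 + 1 + 1))
    simp only [St.reg_setReg, reduceCtorEq, if_true, if_false, St.arr_setReg, hl', hsrc, hd''] at h0 ⊢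
    have hlt : f e.lab (σ.arr .val e.src) (σ.arr .val e.dst) < σ.arr .val e.dst := by omega
    have hsum := sum_range_update_mul hdN (σ.arr .val) (fun _ => 1)
      (f e.lab (σ.arr .val e.src) (σ.arr .val e.dst))
    simp only [Nat.mul_one] at hsum
    have hpot := potential_push (A := A) (E := E) (S := S) hdN hlt
    -- A push lengthens the stack by one but lowers the sum of the values by at least one. Hence the
    -- invariant `space` survives and bounds the stack pointer, although a node may be on the stack
    -- several times.
    have hspace := hσ.space
    refine wp_seq (wp_put (wp_seq (wp_put (wp_add (by simp [h1', hσ.top]; omega) (wp_get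
      (h _ (e.dst :: S) _ ⟨⟨?_, ?_, ?_, ?_⟩, ?_, ?_, ?_, ?_, ?_, ?_, ?_, ?_⟩ ?_ ?_ ?_))))))
    · simpa using hG.1
    · simpa using hG.2
    · simpa using hG.3
    · simpa using hG.4
    · simp [Reg.scratch, hσ.saved]
    · simpa using hσ.reach.step he
    · intro x hx
      have := hσ.lt x hx
      simp [Function.update_apply]
      split
      · omega
      · exact this
    · simp [h1', hσ.top]
    · simp only [St.arr_setReg, St.arr_setArr, St.reg_setReg, St.reg_setArr, reduceCtorEq, if_true,
        if_false, hσ.top]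
      exact ⟨Function.update_self _ _ _, hσ.stack.update le_rfl _⟩
    · intro x hx
      rcases List.mem_cons.1 hx with rfl | hx
      · exact hdN
      · exact hσ.mem x hx
    · simp only [St.arr_setReg, St.arr_setArr, St.reg_setReg, St.reg_setArr, reduceCtorEq, if_true,
        if_false, List.length_cons]
      omega
    · intro e' he'
      simp only [St.arr_setReg, St.arr_setArr, St.reg_setReg, St.reg_setArr, reduceCtorEq, if_true,
        if_false]
      -- Only the value of `e.dst` has changed. An edge leaving `e.dst` has its source on the stack
      -- now; this covers loops as well.
      by_cases hs : e'.src = e.dst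
      · exact .inl (by simp [hs])
      · rw [Function.update_of_ne hs, Function.update_apply]
        rcases hσ.fix e' he' with h' | h' | h'
        · exact .inl (List.mem_cons_of_mem _ h')
        · refine .inr (.inl ?_)
          split
          · rename_i hdd
            rw [hdd] at h'
            exact hf.stable _ _ _ _ _ h'
          · exact h'
        · rcases List.mem_cons.1 h' with rfl | h'
          · exact .inr (.inl (by simpa using hid))
          · exact .inr (.inr h')
    · simpa using hsrc
    · simpa [hG.next] using hn
    · simp only [St.arr_setReg, St.arr_setArr, St.reg_setReg, St.reg_setArr, reduceCtorEq, if_true,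
        if_false]
      omega

/-- Update values along edges until the stack is empty. -/
def propagate (p m : ℕ) (f : ℕ → ℕ → ℕ → ℕ) : Cmd :=
  whilePos .top <| seq (sub .top .top .one) <| seq (get .src .stack .top) <|
    seq (get .ptr .head .src) <| whilePos .ptr (updateEdge p m f)

/-- Popping `x` releases `weight A E x`: `A` credits for each edge leaving `x`, and 5 for the outer
test, the decrement of `top`, two loads and the last inner test. Everything else is paid by falling
values. -/
theorem wp_propagate {p m : ℕ} {f : ℕ → ℕ → ℕ → ℕ} (hf : Contracting f) {E : List Edge} {N : ℕ}
    {w₀ : ℕ → ℕ} {σ₀ : St} {S : List ℕ} (hmb : m ≤ b) (h1 : σ₀.reg .one = 1)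
    (hE : ∀ e ∈ E, e.src < N ∧ e.dst < N ∧ e.lab < p)
    (hσ : PropInv f E N m b w₀ σ₀ σ S fun _ => False)
    (h : ∀ σ' k', PropInv f E N m b w₀ σ₀ σ' [] (fun _ => False) → k ≤ k' → Q σ' k') :
    (propagate p m f).Wp input b Q σ
      (k + potential (2 * p + 4 * m + 18) E N S (σ.arr .val) + 1) := by
  -- The 17 extra credits of `updateEdge`, plus one for the test of the inner loop.
  set A := 2 * p + 4 * m + 18 with hA
  refine wp_whilePos (J := fun σ k' => ∃ S, PropInv f E N m b w₀ σ₀ σ S (fun _ => False) ∧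
    k + potential A E N S (σ.arr .val) + 1 ≤ k') ⟨S, hσ, le_rfl⟩ ?_
  rintro σ k' ⟨S, hσ, hk'⟩
  refine ⟨k' - 1, by omega, fun h0 => ?_, fun h0 => ?_⟩
  · obtain rfl : S = [] := List.length_eq_zero_iff.1 (by rw [← hσ.top, h0])
    exact h σ _ hσ (by omega)
  · cases S with
    | nil => exact absurd hσ.top h0
    | cons x S =>
      have hpot : potential A E N (x :: S) (σ.arr .val) =
          A * (outEdges E x).length + 5 + potential A E N S (σ.arr .val) := by
        rw [potential, potential, List.map_cons, List.sum_cons, weight, Nat.add_assoc]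
      have h1' : σ.reg .one = 1 := by rw [St.reg_eq_of_saved hσ.saved _ rfl, h1]
      have htop : σ.reg .top - 1 = S.length := by rw [hσ.top]; simp
      obtain ⟨k₁, hk₁⟩ : ∃ k₁, k' - 1 = k₁ + 3 := ⟨k' - 4, by omega⟩
      rw [hk₁]
      refine wp_seq (wp_sub (wp_seq (wp_get (wp_seq (wp_get ?_)))))
      -- In the inner loop, the edges that may still have an effect although their source has been
      -- popped are those in the rest `L` of the adjacency list of `x`. The last summand 2 reserves
      -- the final tests of both loops.
      refine wp_whilePos (J := fun σ k' => ∃ S L, PropInv f E N m b w₀ σ₀ σ S (· ∈ L) ∧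
        σ.reg .src = x ∧ Chain E (σ.reg .ptr) L ∧ (∀ e ∈ L, e ∈ E ∧ e.src = x) ∧
        k + potential A E N S (σ.arr .val) + A * L.length + 2 ≤ k') ?_ ?_
      · refine ⟨S, outEdges E x, ⟨⟨hσ.graph.1, hσ.graph.2, hσ.graph.3, hσ.graph.4⟩, ?_, hσ.reach,
          hσ.lt, ?_, hσ.stack.2, fun y hy => hσ.mem y (List.mem_cons_of_mem _ hy), ?_, ?_⟩, ?_, ?_,
          ?_, ?_⟩
        · simp [Reg.scratch, hσ.saved]
        · simpa [h1'] using htop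
        · have := hσ.space
          rw [List.length_cons] at this
          simp only [St.arr_setReg]
          omega
        · intro e he
          simp only [St.arr_setReg]
          rcases hσ.fix e he with h' | h' | h'
          · rcases List.mem_cons.1 h' with h' | h'
            · exact .inr (.inr (by simp [outEdges, he, h']))
            · exact .inl h'
          · exact .inr (.inl h')
          · exact h'.elim
        · simp [h1', htop, hσ.stack.1]
        · simpa [h1', htop, hσ.stack.1, hσ.graph.head] using chain_headOf E x
        · intro e he
          simpa [outEdges] using he
        · simp only [St.arr_setReg]; omega
      · rintro σ' k' ⟨S', L, hσ', hsrc, hch, hL, hk'⟩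
        refine ⟨k' - 1, by omega, fun h0 => ?_, fun h0 => ?_⟩
        · cases L with
          | nil =>
            refine ⟨S', ⟨hσ'.graph, hσ'.saved, hσ'.reach, hσ'.lt, hσ'.top, hσ'.stack, hσ'.mem,
              hσ'.space, fun e he => ?_⟩, by rw [List.length_nil] at hk'; omega⟩
            simpa using hσ'.fix e he
          | cons e L => exact absurd h0 hch.1
        · cases L with
          | nil => exact absurd hch h0
          | cons e L =>
            obtain ⟨he, hex⟩ := hL e (by simp)
            rw [List.length_cons, Nat.mul_succ] at hk'
            obtain ⟨k₂, hk₂⟩ : ∃ k₂, k' - 1 = k₂ + potential A E N S' (σ'.arr .val) + 2 * p +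
                4 * m + 17 ∧ k + A * L.length + 2 ≤ k₂ :=
              ⟨k' - 1 - potential A E N S' (σ'.arr .val) - 2 * p - 4 * m - 17, by omega⟩
            rw [hk₂.1]
            refine wp_updateEdge hf hmb h1 hE hσ' he (hsrc.trans hex.symm) hch ?_
            intro σ'' S'' k'' hσ'' hsrc' hch' hk''
            exact ⟨S'', L, hσ'', hsrc'.trans hex, hch', fun e' he' => hL e' (by simp [he']),
              by omega⟩

/-- Give the value `v` to all nodes and put them on the stack. -/
def initValues (v : ℕ) : Cmd :=
  seq (set .top 0) <| seq (mov .cnt .nodes) <| whilePos .cnt <| seq (set .new v) <|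
    seq (put .val .top .new) <| seq (put .stack .top .top) <| seq (add .top .top .one)
      (sub .cnt .cnt .one)

theorem wp_initValues {v N : ℕ} {E : List Edge} (hG : GraphAt σ E) (h1 : σ.reg .one = 1)
    (hN : σ.reg .nodes = N) (hv : v ≤ b) (hNb : N ≤ b)
    (h : ∀ σ' : St, GraphAt σ' E → σ'.saved = σ.saved → (∀ x < N, σ'.arr .val x = v) →
      σ'.reg .top = N → StackAt (σ'.arr .stack) (List.range N).reverse → Q σ' k) :
    (initValues v).Wp input b Q σ (k + 6 * N + 4) := by
  refine wp_seq (wp_set (by omega) (wp_seq (wp_mov (by decide) ?_)))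
  refine wp_whilePos (J := fun σ' k' => ∃ i j, GraphAt σ' E ∧ σ'.saved = σ.saved ∧
    (∀ x < i, σ'.arr .val x = v) ∧ σ'.reg .top = i ∧
    StackAt (σ'.arr .stack) (List.range i).reverse ∧ σ'.reg .cnt = j ∧ i + j = N ∧
    k' = k + 6 * j + 1) ?_ ?_
  · refine ⟨0, N, ⟨hG.1, hG.2, hG.3, hG.4⟩, by simp [Reg.scratch], by simp, by simp, ?_, ?_,
      by simp, rfl⟩
    · simp [StackAt]
    · simp [hN]
  · rintro σ' k' ⟨i, j, hG', hs, hval, htop, hst, hc, hij, rfl⟩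
    refine ⟨_, rfl, fun h0 => ?_, fun h0 => ?_⟩
    · obtain rfl : j = 0 := by omega
      obtain rfl : i = N := by omega
      exact h σ' hG' hs hval htop hst
    · cases j with
      | zero => omega
      | succ j =>
        have h1' : σ'.reg .one = 1 := by rw [St.reg_eq_of_saved hs _ rfl, h1]
        refine wp_seq (wp_set hv (wp_seq (wp_put (wp_seq (wp_put (wp_seq (wp_add ?_ (wp_sub
          ⟨i + 1, j, ⟨?_, ?_, ?_, ?_⟩, ?_, ?_, ?_, ?_, ?_, by omega, rfl⟩))))))))
        · simp [h1', htop]; omega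
        · simpa using hG'.1
        · simpa using hG'.2
        · simpa using hG'.3
        · simpa using hG'.4
        · simp [Reg.scratch, hs]
        · intro x hx
          simp only [St.arr_setReg, St.arr_setArr, St.reg_setReg, reduceCtorEq, if_true, if_false,
            htop, Function.update_apply]
          split
          · rfl
          · exact hval x (by omega)
        · simp [h1', htop]
        · rw [List.range_succ, List.reverse_append]
          refine ⟨?_, ?_⟩
          · simp [htop]
          · simpa [htop] using hst.update (p := i) (by simp) i
        · simp [h1', hc]

end Cmd

/-- The data of an arc consistency algorithm: the number of edge labels, the number of values, the
update function, the initial values, and the values of the global node that are accepted. -/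
structure ArcData where
  labels : ℕ
  values : ℕ
  update : ℕ → ℕ → ℕ → ℕ
  init : ℕ
  peek : ℕ
  accept : ℕ → ℕ

/-- The conditions on the data under which the algorithm works. -/
structure ArcData.Valid (D : ArcData) : Prop where
  contracting : Contracting D.update
  init_lt : D.init < D.values
  peek_lt : D.peek < D.values
  accept_le : ∀ v, D.accept v ≤ 1

/-- The number `z` is a correct result of the algorithm, started with `a`: the value of the node `n`
is accepted after exhaustive propagation along the edges. -/
def ArcData.Result (D : ArcData) (E : List Edge) (N n a z : ℕ) : Prop :=
  ∃ w₀ w : ℕ → ℕ, (∀ x < N, w₀ x = if x = a then D.peek else D.init) ∧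
    Reach D.update E w₀ w ∧ (∀ x < N, w x < D.values) ∧
    (∀ e ∈ E, D.update e.lab (w e.src) (w e.dst) = w e.dst) ∧ z = D.accept (w n)

/-- The time that the algorithm takes per edge. -/
def ArcData.edgeTime (D : ArcData) : ℕ := 2 * D.labels + 4 * D.values + 18

/-- The time that the algorithm takes on a graph with `q` edges and `N` nodes. -/
def ArcData.time (D : ArcData) (q N : ℕ) : ℕ :=
  (D.values + 1) * (D.edgeTime * q + 5 * N) + 6 * N + 2 * D.values + 11

namespace Cmd

variable {input : List ℕ} {b : ℕ} {Q : St → ℕ → Prop} {σ : St} {k : ℕ}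

/-- The arc consistency algorithm, started with the element in the register `elem`. -/
def arcConsistency (D : ArcData) : Cmd :=
  seq (initValues D.init) <| seq (set .new D.peek) <| seq (put .val .elem .new) <|
  seq (propagate D.labels D.values D.update) <| seq (get .tmp .val .num) <|
  switch .tmp D.values fun v => set .res (D.accept v)

/-- Every node starts on the stack, so the fixpoint condition holds trivially at first. The output
is only claimed to come from some exhaustive propagation; the order of the updates is irrelevant for
what follows. -/
theorem wp_arcConsistency {D : ArcData} (hD : D.Valid) {E : List Edge} {N n a : ℕ}
    (hG : GraphAt σ E) (h1 : σ.reg .one = 1) (hN : σ.reg .nodes = N) (hn : σ.reg .num = n)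
    (hnN : n < N) (ha : σ.reg .elem = a)
    (hE : ∀ e ∈ E, e.src < N ∧ e.dst < N ∧ e.lab < D.labels)
    (hb : N * (D.values + 1) ≤ b) (hb' : D.values ≤ b) (hb1 : 1 ≤ b)
    (h : ∀ σ' k', GraphAt σ' E → σ'.saved = σ.saved → D.Result E N n a (σ'.reg .res) → k ≤ k' →
      Q σ' k') : (arcConsistency D).Wp input b Q σ (k + D.time E.length N) := by
  obtain ⟨m, hm⟩ : ∃ m, m = D.values := ⟨_, rfl⟩
  set A := D.edgeTime with hA
  have hi := hD.init_lt
  have hp := hD.peek_lt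
  rw [← hm] at hb hb' hi hp
  have hNb : N ≤ b := le_trans (Nat.le_mul_of_pos_right N (Nat.succ_pos m)) hb
  have htime : k + D.time E.length N = k + 4 + 2 * m + (m + 1) * (A * E.length + 5 * N) + 1 + 1 + 1
      + 6 * N + 4 := by
    rw [ArcData.time, ← hm, ← hA]; omega
  rw [htime]
  refine wp_seq (wp_initValues hG h1 hN (by omega) hNb fun σ₁ hG₁ hs₁ hv₁ ht₁ hst₁ => ?_)
  have hel := St.reg_eq_of_saved hs₁ .elem rfl
  refine wp_seq (wp_set (by omega) (wp_seq (wp_put (wp_seq ?_))))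
  set σ₂ := (σ₁.setReg .new D.peek).setArr .val ((σ₁.setReg .new D.peek).reg .elem)
    ((σ₁.setReg .new D.peek).reg .new) with hσ₂
  have hw : ∀ x < N, σ₂.arr .val x = if x = a then D.peek else D.init := by
    intro x hx
    simp only [hσ₂, St.arr_setArr, St.arr_setReg, St.reg_setReg, reduceCtorEq, if_true, if_false,
      Function.update_apply, hv₁ x hx, hel, ha]
  have hlt : ∀ x < N, σ₂.arr .val x < m := by
    intro x hx
    rw [hw x hx]
    split
    · exact hp
    · exact hi
  -- Each node is on the stack once, and its value is below `m`, so the initial potential is at most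
  -- `m + 1` times the total weight.
  have hpot : potential A E N (List.range N).reverse (σ₂.arr .val) ≤
      (m + 1) * (A * E.length + 5 * N) := by
    have e1 : ((List.range N).reverse.map (weight A E)).sum =
        ∑ x ∈ Finset.range N, weight A E x := by
      rw [List.map_reverse, List.sum_reverse]; rfl
    have e2 : ∑ x ∈ Finset.range N, σ₂.arr .val x * weight A E x ≤
        m * ∑ x ∈ Finset.range N, weight A E x := by
      rw [Finset.mul_sum]
      exact Finset.sum_le_sum fun x hx =>
        Nat.mul_le_mul_right _ (hlt x (Finset.mem_range.1 hx)).le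
    have e3 := Nat.mul_le_mul_left (m + 1) (sum_weight_le A E N)
    rw [potential, e1]
    refine le_trans ?_ e3
    rw [Nat.add_mul m 1 (∑ x ∈ Finset.range N, weight A E x)]
    omega
  -- Together with the `N` initial stack entries this explains the requirement `N * (D.values + 1) ≤
  -- b`.
  have hsum : ∑ x ∈ Finset.range N, σ₂.arr .val x ≤ N * m := by
    refine (Finset.sum_le_sum fun x hx => (hlt x (Finset.mem_range.1 hx)).le).trans ?_
    simp
  have hs₂ : σ₂.saved = σ.saved := by simp [hσ₂, Reg.scratch, hs₁]
  obtain ⟨k₁, hk₁, hk₁'⟩ : ∃ k₁, k + 4 + 2 * m + (m + 1) * (A * E.length + 5 * N) + 1 =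
      k₁ + potential A E N (List.range N).reverse (σ₂.arr .val) + 1 ∧ k + 4 + 2 * m ≤ k₁ :=
    ⟨k + 4 + 2 * m + (m + 1) * (A * E.length + 5 * N) -
      potential A E N (List.range N).reverse (σ₂.arr .val), by omega, by omega⟩
  rw [hk₁]
  refine wp_propagate hD.contracting (hm ▸ hb') (h1 : σ.reg .one = 1) hE (w₀ := σ₂.arr .val) ?_ ?_
  · refine ⟨⟨?_, ?_, ?_, ?_⟩, hs₂, .refl, hm ▸ hlt, ?_, ?_, ?_, ?_, ?_⟩
    · simpa [hσ₂] using hG₁.1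
    · simpa [hσ₂] using hG₁.2
    · simpa [hσ₂] using hG₁.3
    · simpa [hσ₂] using hG₁.4
    · simpa [hσ₂] using ht₁
    · simpa [hσ₂] using hst₁
    · intro x hx
      simpa using hx
    · rw [Nat.mul_succ] at hb
      simp only [List.length_reverse, List.length_range]
      omega
    · intro e he
      exact .inl (by simpa using (hE e he).1)
  · intro σ₃ k₃ hσ₃ hk₃
    have e1 : σ₃.reg .one = 1 := by rw [St.reg_eq_of_saved hσ₃.saved _ rfl, h1]
    have e2 : σ₃.reg .num = n := by rw [St.reg_eq_of_saved hσ₃.saved _ rfl, hn]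
    obtain ⟨k₄, rfl⟩ := Nat.exists_eq_add_of_le' (hk₁'.trans hk₃)
    refine wp_seq (?_ : Wp _ _ _ _ _ (k₄ + (k + 4 + 2 * m)))
    rw [show k₄ + (k + 4 + 2 * m) = k₄ + k + 3 + 2 * m + 1 by omega, hm]
    refine wp_get (wp_switch (by decide) (i := σ₃.arr .val n) (by simpa using e1) (by simp [e2])
      (hσ₃.lt n hnN) fun k₅ hk₅ => ?_)
    obtain ⟨k₆, rfl⟩ := Nat.exists_eq_add_of_le' hk₅
    refine (?_ : Wp _ _ _ _ _ (k₆ + (k₄ + k + 2) + 1))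
    refine wp_set ((hD.accept_le _).trans hb1) (h _ _ ⟨hσ₃.graph.1, hσ₃.graph.2, hσ₃.graph.3,
      hσ₃.graph.4⟩ ?_ ⟨σ₂.arr .val, σ₃.arr .val, hw, hσ₃.reach, hσ₃.lt, fun e he => ?_, ?_⟩
      (by omega))
    · simp [Reg.scratch, hσ₃.saved]
    · simpa using hσ₃.fix e he
    · simp

end Cmd

end RAM

/-! ### Sequential and parallel runs, and the exchange of results between processors. -/

namespace RAM

/-! ### Runs of the whole machine -/

section Config

variable {P : Program} {p s : ℕ} {input : List ℕ}

/-- The next instruction, if any, respects the space bound `s`. -/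
def Proc.Fits (P : Program) (s : ℕ) (σ : Proc) : Prop := ∀ I, P[σ.pc]? = some I → I.Fits s σ

theorem Proc.Safe.fits {n : ℕ} {σ : Proc} (h : σ.Safe P n s) : σ.Fits P s := by
  obtain ⟨I, hI, hf, -⟩ := h
  intro I' hI'
  obtain rfl : I = I' := Option.some.inj (hI.symm.trans hI')
  exact hf

theorem Proc.Safe.globalWrite_eq_none {n : ℕ} {σ : Proc} (h : σ.Safe P n s) :
    σ.globalWrite P = none := by
  obtain ⟨I, hI, -, hr⟩ := h
  rw [Proc.globalWrite, hI]
  cases I <;> first | rfl | exact hr.elim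

/-- A safe step sees only the input cells. Hence a processor that is still computing does not notice
what others publish behind the input. -/
theorem Proc.Safe.step_congr {n : ℕ} {σ : Proc} (h : σ.Safe P n s) {G G' : ℕ → ℕ}
    (hG : ∀ a < n, G a = G' a) : σ.step P G = σ.step P G' := by
  obtain ⟨I, hI, -, hr⟩ := h
  rw [Proc.step, Proc.step, hI]
  cases I <;> try rfl
  simp only [Instr.next, hG _ hr]

theorem Proc.Halted.fits {σ : Proc} (h : σ.Halted P) : σ.Fits P s := by
  intro I hI
  rw [h] at hI
  cases hI

theorem Proc.Halted.step_eq {σ : Proc} (h : σ.Halted P) (G : ℕ → ℕ) : σ.step P G = σ := by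
  rw [Proc.step, h]

theorem Proc.Halted.globalWrite_eq_none {σ : Proc} (h : σ.Halted P) :
    σ.globalWrite P = none := by rw [Proc.globalWrite, h]; rfl

theorem Config.step_glob_of_none {C : Config p} {a : ℕ}
    (h : ∀ i v, (C.proc i).globalWrite P ≠ some (a, v)) : (C.step P).glob a = C.glob a := by
  have : ((List.finRange p).findSome? fun i =>
      ((C.proc i).globalWrite P).bind fun w => if w.1 = a then some w.2 else none) = none := by
    rw [List.findSome?_eq_none_iff]
    intro i _
    rcases hw : (C.proc i).globalWrite P with _ | ⟨a', v⟩
    · rfl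
    · have hne : a' ≠ a := by rintro rfl; exact h i v hw
      simp [hne]
  simp only [Config.step, this, Option.getD_none]

/-- With exclusive writes there is at most one writer for the cell, so the priority rule in
`Config.step` plays no role. -/
theorem Config.step_glob_of_some {C : Config p} (hC : C.ExclusiveWrite P) {i : Fin p} {a v : ℕ}
    (h : (C.proc i).globalWrite P = some (a, v)) : (C.step P).glob a = v := by
  rcases hf : (List.finRange p).findSome? fun i =>
      ((C.proc i).globalWrite P).bind fun w => if w.1 = a then some w.2 else none with _ | u
  · rw [List.findSome?_eq_none_iff] at hf
    have := hf i (List.mem_finRange i)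
    simp [h] at this
  · have hu := hf
    obtain ⟨j, -, hj⟩ := List.exists_of_findSome?_eq_some hf
    rcases hw : (C.proc j).globalWrite P with _ | ⟨a', v'⟩
    · simp [hw] at hj
    · by_cases ha : a' = a
      · subst ha
        obtain rfl := hC i j a' v v' h hw
        obtain rfl : v = v' := by simpa [hw] using h.symm
        simp only [Config.step, hu, Option.getD_some]
        simpa [hw] using hj.symm
      · simp [hw, ha] at hj

theorem Config.step_boundedBy {C : Config p} (h : C.BoundedBy s)
    (hf : ∀ i, (C.proc i).Fits P s) : (C.step P).BoundedBy s := by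
  constructor
  · intro a
    rcases hw : (List.finRange p).findSome? fun i =>
      ((C.proc i).globalWrite P).bind fun w => if w.1 = a then some w.2 else none with _ | u
    · simp only [Config.step, hw, Option.getD_none]
      exact h.1 a
    · simp only [Config.step, hw, Option.getD_some]
      obtain ⟨j, -, hj⟩ := List.exists_of_findSome?_eq_some hw
      rw [Proc.globalWrite] at hj
      rcases hI : P[(C.proc j).pc]? with _ | I
      · simp [hI] at hj
      · cases I <;> simp [hI, Instr.globalWrite] at hj
        have h1 := (h.2 j ‹_›)
        obtain ⟨h2, rfl⟩ := hj
        refine ⟨(h.2 j _).1, fun hlt => ?_⟩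
        subst h2
        exact absurd (h.2 j _).1 (not_le.2 hlt)
  · intro i
    rcases hI : P[(C.proc i).pc]? with _ | I
    · simp only [Config.step, Proc.step, hI]
      exact h.2 i
    · simp only [Config.step, Proc.step, hI]
      exact Instr.next_boundedBy (fun a => (h.1 a).1) (h.2 i) (hf i I hI)

theorem run_succ (t : ℕ) : run P p input (t + 1) = (run P p input t).step P := by
  rw [run, run, Function.iterate_succ_apply']

theorem run_boundedBy (hp : p ≤ s + 1) (hin : ∀ a, inputMem input a ≤ s)
    (hlen : input.length ≤ s + 1) (hf : ∀ t i, ((run P p input t).proc i).Fits P s) (t : ℕ) :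
    (run P p input t).BoundedBy s := by
  induction t with
  | zero =>
    refine ⟨fun a => ⟨hin a, fun ha => ?_⟩, fun i a => ?_⟩
    · exact List.getD_eq_default _ _ (by omega)
    · have := i.2
      simp only [run, Function.iterate_zero, id, Config.init]
      split
      · exact ⟨by omega, by omega⟩
      · exact ⟨by omega, by omega⟩
  | succ t ih =>
    rw [run_succ]
    exact Config.step_boundedBy ih (hf t)

/-- The initial state of a processor. -/
def Proc.init (i : ℕ) : Proc := ⟨0, fun a => if a = 0 then i else 0⟩

/-- A single processor that only reads the input. -/
theorem answers_of_steps {t T : ℕ} {σ : Proc} {Q : Prop}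
    (h : Steps P input s t (Proc.init 0) σ) (ht : t ≤ T) (hσ : σ.Halted P)
    (hin : ∀ a, inputMem input a ≤ s) (hlen : input.length ≤ s + 1)
    (hQ : Q → σ.mem 0 = 1) (hQ' : ¬ Q → σ.mem 0 = 0) : Answers P 1 input T s Q := by
  have hstep : ∀ u, t ≤ u → (Proc.step P (inputMem input))^[u] (Proc.init 0) = σ := by
    intro u hu
    obtain ⟨v, rfl⟩ := Nat.exists_eq_add_of_le' hu
    rw [Function.iterate_add_apply, h.1]
    exact Function.iterate_fixed (hσ.step_eq _) v
  have hw : ∀ u, ((Proc.step P (inputMem input))^[u] (Proc.init 0)).globalWrite P = none := by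
    intro u
    by_cases hu : u < t
    · exact (h.2 u hu).globalWrite_eq_none
    · rw [hstep u (by omega)]
      exact hσ.globalWrite_eq_none
  have hrun : ∀ u, (∀ i, (run P 1 input u).proc i =
      (Proc.step P (inputMem input))^[u] (Proc.init 0)) ∧
      (run P 1 input u).glob = inputMem input := by
    intro u
    induction u with
    | zero =>
      refine ⟨fun i => ?_, rfl⟩
      obtain rfl : i = 0 := Subsingleton.elim _ _
      rfl
    | succ u ih =>
      rw [run_succ, Function.iterate_succ_apply']
      refine ⟨fun i => ?_, ?_⟩
      · simp only [Config.step, ih.1, ih.2]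
      · funext a
        rw [Config.step_glob_of_none, ih.2]
        intro i v
        rw [ih.1, hw]
        simp
  refine ⟨fun i => ?_, ⟨0, rfl, ?_, ?_⟩, fun t i j _ _ _ _ _ => Subsingleton.elim _ _, ?_⟩
  · rw [(hrun T).1, hstep T ht]
    exact hσ
  · rw [(hrun T).1, hstep T ht]
    exact hQ
  · rw [(hrun T).1, hstep T ht]
    exact hQ'
  · refine run_boundedBy (by omega) hin hlen fun u i => ?_
    rw [(hrun u).1]
    by_cases hu : u < t
    · exact (h.2 u hu).fits
    · rw [hstep u (by omega)]
      exact hσ.fits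

end Config

/-! ### Combining the results of all processors -/

/-- Code, to be placed at position `e`, with which a processor publishes its result, waits for the
results of the other processors, and combines them. If `rest` is not zero, then its own result, the
content of `res`, is written to the global cell `addr`. The results, `1` for yes and `2` for no, are
expected in the `cnt` many global cells starting from `scan`. -/
def combineCode (e : ℕ) : List Instr :=
  [.jumpIfZero 20 (e + 2), .write 18 22, .jumpIfZero 7 (e + 10), .read 16 19,
    .jumpIfZero 16 (e + 3), .sub 16 16 4, .sub 0 0 16, .add 19 19 4, .sub 7 7 4, .jump (e + 2)]

/-- The memory of the processor `i` before the results are combined. -/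
structure ReadyToCombine (l n : ℕ) (result : ℕ → ℕ) (i : ℕ) (m : ℕ → ℕ) : Prop where
  rest : m 20 = n - i
  addr : i < n → m 18 = l + i
  res : i < n → m 22 = result i
  scan : m 19 = l
  cnt : m 7 = n
  one : m 4 = 1
  ans : m 0 = 1

section Combine

variable {P : Program} {p s e n : ℕ} {input : List ℕ} {result t : ℕ → ℕ} {M : ℕ → ℕ → ℕ}

open Classical in
/-- The state of the machine at time `u`, if each processor `i` is ready to combine the results at
time `t i`, with local memory `M i`. -/
structure CombineInv (P : Program) (p e n : ℕ) (input : List ℕ) (result t : ℕ → ℕ)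
    (M : ℕ → ℕ → ℕ) (u : ℕ) : Prop where
  glob : ∀ a, (run P p input u).glob a =
    if input.length ≤ a ∧ a < input.length + n ∧ t (a - input.length) + 2 ≤ u then
      result (a - input.length) else inputMem input a
  before : ∀ i : Fin p, u ≤ t i →
    (run P p input u).proc i = (Proc.step P (inputMem input))^[u] (Proc.init i)
  write : ∀ i : Fin p, u = t i + 1 →
    (run P p input u).proc i = ⟨if n - i = 0 then e + 2 else e + 1, M i⟩
  after : ∀ i : Fin p, t i + 2 ≤ u → e + 2 ≤ ((run P p input u).proc i).pc

theorem cases_combineCode (hP : CodeAt P e (combineCode e)) (hlen : P.length = e + 10) {c : ℕ}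
    (hc : e + 2 ≤ c) : P[c]? = none ∨
      c = e + 2 ∧ P[c]? = some (.jumpIfZero 7 (e + 10)) ∨
      c = e + 3 ∧ P[c]? = some (.read 16 19) ∨ c = e + 4 ∧ P[c]? = some (.jumpIfZero 16 (e + 3)) ∨
      c = e + 5 ∧ P[c]? = some (.sub 16 16 4) ∨ c = e + 6 ∧ P[c]? = some (.sub 0 0 16) ∨
      c = e + 7 ∧ P[c]? = some (.add 19 19 4) ∨ c = e + 8 ∧ P[c]? = some (.sub 7 7 4) ∨
      c = e + 9 ∧ P[c]? = some (.jump (e + 2)) := by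
  by_cases h : e + 10 ≤ c
  · exact .inl (by simp [hlen, h])
  · obtain ⟨d, hd⟩ : ∃ d, c = e + d := ⟨c - e, by omega⟩
    subst hd
    have h8 : d < 10 := by omega
    have := hP d (by simpa [combineCode] using h8)
    rw [this]
    have h2 : 2 ≤ d := by omega
    interval_cases d <;> simp [combineCode]

/-- The only write of `combineCode` is at `e + 1`, and every later jump leads to `e + 2` or beyond.
A processor that has passed it never writes again. -/
theorem after_step (hP : CodeAt P e (combineCode e)) (hlen : P.length = e + 10) {σ : Proc}
    (hσ : e + 2 ≤ σ.pc) (G : ℕ → ℕ) : e + 2 ≤ (σ.step P G).pc ∧ σ.globalWrite P = none := by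
  rcases cases_combineCode hP hlen hσ with h | h | h | h | h | h | h | h | h
  · exact ⟨by rw [Proc.Halted.step_eq h]; exact hσ, Proc.Halted.globalWrite_eq_none h⟩
  all_goals
    refine ⟨?_, by rw [Proc.globalWrite, h.2]; rfl⟩
    rw [Proc.step, h.2]
    simp only [Instr.next]
    try split
    all_goals omega

/-- Safe steps do not write, nor do the steps after publication. This leaves a single write, at time
`t i + 1`, into a cell that belongs to the processor `i` alone. -/
theorem CombineInv.globalWrite {u : ℕ} (h : CombineInv P p e n input result t M u)
    (hP : CodeAt P e (combineCode e)) (hlen : P.length = e + 10)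
    (hst : ∀ i < p, Steps P input s (t i) (Proc.init i) ⟨e, M i⟩)
    (hM : ∀ i < p, ReadyToCombine input.length n result i (M i)) (i : Fin p) :
    ((run P p input u).proc i).globalWrite P =
      if u = t i + 1 ∧ (i : ℕ) < n then some (input.length + i, result i) else none := by
  have hPe : P[e]? = some (.jumpIfZero 20 (e + 2)) := hP.head
  have hPe1 : P[e + 1]? = some (.write 18 22) := hP.tail.head
  have hPe2 : P[e + 2]? = some (.jumpIfZero 7 (e + 10)) := hP.tail.tail.head
  rcases lt_trichotomy u (t i) with hu | hu | hu
  · rw [if_neg (by omega), h.before i hu.le]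
    exact ((hst i i.2).2 u hu).globalWrite_eq_none
  · rw [if_neg (by omega), h.before i hu.le, hu, (hst i i.2).1, Proc.globalWrite, hPe]
    rfl
  · rcases (Nat.succ_le_iff.2 hu).eq_or_lt with hu | hu
    · rw [h.write i (by omega)]
      by_cases hi : (i : ℕ) < n
      · rw [if_neg (by omega), if_pos ⟨by omega, hi⟩, Proc.globalWrite, hPe1]
        simp [Instr.globalWrite, (hM i i.2).addr hi, (hM i i.2).res hi]
      · rw [if_pos (by omega), if_neg (by omega), Proc.globalWrite, hPe2]
        rfl
    · rw [if_neg (by omega)]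
      exact (after_step hP hlen (h.after i (by omega)) (inputMem input)).2

theorem CombineInv.exclusiveWrite {u : ℕ} (h : CombineInv P p e n input result t M u)
    (hP : CodeAt P e (combineCode e)) (hlen : P.length = e + 10)
    (hst : ∀ i < p, Steps P input s (t i) (Proc.init i) ⟨e, M i⟩)
    (hM : ∀ i < p, ReadyToCombine input.length n result i (M i)) :
    (run P p input u).ExclusiveWrite P := by
  intro i j a v w hi hj
  rw [h.globalWrite hP hlen hst hM] at hi hj
  split at hi <;> split at hj <;> simp at hi hj
  exact Fin.ext (by omega)

/-- The processors reach the code at different times `t i`. Until then each evolves as if it were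
alone, since all writes of the others go to cells from `input.length` on, which it does not read. -/
theorem combineInv (hP : CodeAt P e (combineCode e)) (hlen : P.length = e + 10) (hn : n ≤ p)
    (hst : ∀ i < p, Steps P input s (t i) (Proc.init i) ⟨e, M i⟩)
    (hM : ∀ i < p, ReadyToCombine input.length n result i (M i)) (u : ℕ) :
    CombineInv P p e n input result t M u := by
  induction u with
  | zero =>
    exact ⟨fun a => by rw [if_neg (by omega)]; rfl, fun i _ => rfl, fun i hi => by omega,
      fun i hi => by omega⟩
  | succ u ih =>
    have hw := ih.globalWrite hP hlen hst hM
    have hPe : P[e]? = some (.jumpIfZero 20 (e + 2)) := hP.head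
    have hPe1 : P[e + 1]? = some (.write 18 22) := hP.tail.head
    have hPe2 : P[e + 2]? = some (.jumpIfZero 7 (e + 10)) := hP.tail.tail.head
    have hproc : ∀ i, (run P p input (u + 1)).proc i =
        ((run P p input u).proc i).step P (run P p input u).glob := fun i => by
      rw [run_succ, Config.step]
    constructor
    · intro a
      rw [run_succ]
      by_cases ha : input.length ≤ a ∧ a < input.length + n ∧ u = t (a - input.length) + 1
      · rw [if_pos (by omega)]
        have hlt : a - input.length < p := by omega
        refine Config.step_glob_of_some (ih.exclusiveWrite hP hlen hst hM)
          (i := ⟨a - input.length, hlt⟩) ?_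
        rw [hw, if_pos ⟨ha.2.2, by simp only; omega⟩]
        simp only [Option.some.injEq, Prod.mk.injEq, and_true]
        omega
      · rw [Config.step_glob_of_none, ih.glob]
        · congr 1
          refine propext ⟨fun h => ⟨h.1, h.2.1, by omega⟩, fun h => ⟨h.1, h.2.1, by omega⟩⟩
        · intro i v
          rw [hw]
          split
          · rename_i hu
            simp only [ne_eq, Option.some.injEq, Prod.mk.injEq, not_and]
            rintro rfl
            exact absurd ⟨by omega, by omega, by simpa using hu.1⟩ ha
          · simp
    · intro i hi
      rw [hproc, ih.before i (by omega), Function.iterate_succ_apply']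
      refine ((hst i i.2).2 u (by omega)).step_congr fun a ha => ?_
      rw [ih.glob, if_neg (by omega)]
    · intro i hi
      obtain rfl : u = t i := by omega
      rw [hproc, ih.before i le_rfl, (hst i i.2).1, Proc.step, hPe]
      simp [Instr.next, (hM i i.2).rest]
    · intro i hi
      rw [hproc]
      rcases (show t i + 1 ≤ u by omega).eq_or_lt with hu | hu
      · rw [ih.write i hu.symm]
        split
        · exact (after_step hP hlen (by simp) _).1
        · rw [Proc.step, hPe1]
          simp [Instr.next]
      · exact (after_step hP hlen (ih.after i (by omega)) _).1

open Classical in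
/-- The results below `j` have been combined. -/
structure Combining (l n : ℕ) (result : ℕ → ℕ) (j : ℕ) (m : ℕ → ℕ) : Prop where
  scan : m 19 = l + j
  cnt : m 7 = n - j
  one : m 4 = 1
  ans : m 0 = if ∀ j' < j, result j' = 1 then 1 else 0

/-- A processor whose states are given by `σ`, while the global memory is given by `G`, waits for
the result `j`. -/
theorem wait_result {σ : ℕ → Proc} {G : ℕ → ℕ → ℕ} (hσ : ∀ u, σ (u + 1) = (σ u).step P (G u))
    (hP : CodeAt P e (combineCode e)) {l T j v : ℕ} (hs : 16 ≤ s)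
    (hG : ∀ u, G u (l + j) = v ∨ G u (l + j) = 0 ∧ u < T) (hv : v ≠ 0)
    (d : ℕ) : ∀ (u : ℕ) (m : ℕ → ℕ), T - u ≤ d → σ u = ⟨e + 3, m⟩ → m 19 = l + j →
      ∃ u' m', u ≤ u' ∧ u' ≤ max u (T + 1) + 2 ∧ σ u' = ⟨e + 5, m'⟩ ∧ m' 16 = v ∧
        (∀ a ≠ 16, m' a = m a) ∧ ∀ w, u ≤ w → w < u' → (σ w).Fits P s := by
  have h3 : P[e + 3]? = some (.read 16 19) := hP.tail.tail.tail.head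
  have h4 : P[e + 4]? = some (.jumpIfZero 16 (e + 3)) := hP.tail.tail.tail.tail.head
  -- Induction on the time left until `T`. A poll takes two steps, and it fails only before time
  -- `T`, so a failure shortens that time.
  induction d using Nat.strong_induction_on with
  | _ d ih =>
    intro u m hd hu hm
    have hfit1 : (σ u).Fits P s := by
      intro I hI
      rw [hu, h3] at hI
      obtain rfl := Option.some.inj hI
      exact hs
    have hu1 : σ (u + 1) = ⟨e + 4, Function.update m 16 (G u (l + j))⟩ := by
      rw [hσ, hu, Proc.step, h3]
      simp [Instr.next, hm]
    have hfit2 : (σ (u + 1)).Fits P s := by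
      intro I hI
      rw [hu1, h4] at hI
      obtain rfl := Option.some.inj hI
      trivial
    have hu2 : σ (u + 2) = ⟨if G u (l + j) = 0 then e + 3 else e + 5,
        Function.update m 16 (G u (l + j))⟩ := by
      rw [hσ (u + 1), hu1, Proc.step, h4]
      simp [Instr.next]
    rcases hG u with hGu | ⟨hGu, hlt⟩
    · refine ⟨u + 2, _, by omega, by omega, by rw [hu2, if_neg (by rw [hGu]; exact hv)],
        by simp [hGu], fun a ha => Function.update_of_ne ha _ _, fun w hw hw' => ?_⟩
      obtain rfl | rfl : w = u ∨ w = u + 1 := by omega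
      · exact hfit1
      · exact hfit2
    · rw [if_pos hGu] at hu2
      obtain ⟨u', m', hle, hle', hu', hv', hm', hf⟩ := ih (d - 1) (by omega) (u + 2) _ (by omega) hu2
        (by simp [hm])
      refine ⟨u', m', by omega, by omega, hu', hv', fun a ha => ?_, fun w hw hw' => ?_⟩
      · rw [hm' a ha, Function.update_of_ne ha]
      · by_cases h0 : w = u
        · subst h0; exact hfit1
        · by_cases h1 : w = u + 1
          · subst h1; exact hfit2
          · exact hf w (by omega) hw'

-- Waiting happens only until all results are present, so it contributes `max u T` once, while each
-- of the `d` remaining results adds a constant. The answer is lowered by `result j - 1`, which is 0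
-- or 1; truncation keeps it at 0 after the first negative result.
open Classical in
theorem combine_results {σ : ℕ → Proc} {G : ℕ → ℕ → ℕ}
    (hσ : ∀ u, σ (u + 1) = (σ u).step P (G u)) (hP : CodeAt P e (combineCode e))
    {l T : ℕ} (hs : 20 ≤ s) (hl : l + n ≤ s)
    (hG : ∀ u, ∀ j < n, G u (l + j) = result j ∨ G u (l + j) = 0 ∧ u < T)
    (hr : ∀ j < n, result j = 1 ∨ result j = 2) (d : ℕ) :
    ∀ (u j : ℕ) (m : ℕ → ℕ), n - j = d → j ≤ n → σ u = ⟨e + 2, m⟩ →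
      Combining l n result j m →
      ∃ u' m', u' ≤ max u T + 9 * d + 1 ∧ σ u' = ⟨e + 10, m'⟩ ∧
        (m' 0 = if ∀ j' < n, result j' = 1 then 1 else 0) ∧
        ∀ w, u ≤ w → w < u' → (σ w).Fits P s := by
  have h2 : P[e + 2]? = some (.jumpIfZero 7 (e + 10)) := hP.tail.tail.head
  have h5 : P[e + 5]? = some (.sub 16 16 4) := hP.tail.tail.tail.tail.tail.head
  have h6 : P[e + 6]? = some (.sub 0 0 16) := hP.tail.tail.tail.tail.tail.tail.head
  have h7 : P[e + 7]? = some (.add 19 19 4) := hP.tail.tail.tail.tail.tail.tail.tail.head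
  have h8 : P[e + 8]? = some (.sub 7 7 4) := hP.tail.tail.tail.tail.tail.tail.tail.tail.head
  have h9 : P[e + 9]? = some (.jump (e + 2)) := hP.tail.tail.tail.tail.tail.tail.tail.tail.tail.head
  have fits : ∀ {w c : ℕ} {m : ℕ → ℕ} {I : Instr}, σ w = ⟨c, m⟩ → P[c]? = some I →
      I.Fits s ⟨c, m⟩ → (σ w).Fits P s := by
    intro w c m I hw hc hf I' hI'
    rw [hw] at hI' ⊢
    obtain rfl := Option.some.inj (hc.symm.trans hI')
    exact hf
  induction d with
  | zero =>
    intro u j m hd hj hu hm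
    obtain rfl : j = n := by omega
    refine ⟨u + 1, m, by omega, ?_, hm.ans, fun w hw hw' => ?_⟩
    · rw [hσ, hu, Proc.step, h2]
      simp [Instr.next, hm.cnt]
    · obtain rfl : w = u := by omega
      exact fits hu h2 trivial
  | succ d ih =>
    intro u j m hd hj hu hm
    have hu1 : σ (u + 1) = ⟨e + 3, m⟩ := by
      rw [hσ, hu, Proc.step, h2]
      have : n - j ≠ 0 := by omega
      simp [Instr.next, hm.cnt, this]
    have hjn : j < n := by omega
    have hv := hr j hjn
    obtain ⟨v, m', hle, hle', hv', h16, hm', hf⟩ := wait_result (s := s) hσ hP (by omega)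
      (fun u => hG u j hjn) (by omega) _ (u + 1) m le_rfl hu1 hm.scan
    have e1 : σ (v + 1) = ⟨e + 6, Function.update m' 16 (result j - 1)⟩ := by
      rw [hσ, hv', Proc.step, h5]
      simp [Instr.next, hm' 4 (by decide), hm.one, h16]
    have e2 : σ (v + 2) = ⟨e + 7, Function.update (Function.update m' 16 (result j - 1)) 0
        (m 0 - (result j - 1))⟩ := by
      rw [hσ (v + 1), e1, Proc.step, h6]
      simp [Instr.next, hm' 0 (by decide)]
    have e3 : σ (v + 3) = ⟨e + 8, Function.update (Function.update (Function.update m' 16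
        (result j - 1)) 0 (m 0 - (result j - 1))) 19 (l + j + 1)⟩ := by
      rw [hσ (v + 2), e2, Proc.step, h7]
      simp [Instr.next, hm' 19 (by decide), hm' 4 (by decide), hm.one, hm.scan]
    have e4 : σ (v + 4) = ⟨e + 9, Function.update (Function.update (Function.update
        (Function.update m' 16 (result j - 1)) 0 (m 0 - (result j - 1))) 19 (l + j + 1)) 7
        (n - (j + 1))⟩ := by
      rw [hσ (v + 3), e3, Proc.step, h8]
      simp [Instr.next, hm' 7 (by decide), hm' 4 (by decide), hm.one, hm.cnt, Nat.sub_sub]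
    have e5 := hσ (v + 4)
    rw [e4, Proc.step, h9] at e5
    obtain ⟨u', m'', hle'', hu', hans, hf'⟩ := ih (v + 5) (j + 1) _ (by omega) (by omega) e5 (by
      constructor
      · simp; omega
      · simp
      · simp [hm' 4 (by decide), hm.one]
      · simp only [ne_eq, not_false_eq_true, Function.update_of_ne, Function.update_self,
          OfNat.zero_ne_ofNat, hm.ans]
        by_cases hall : ∀ j' < j, result j' = 1
        · rw [if_pos hall]
          rcases hv with hv | hv
          · rw [if_pos, hv]
            intro j' hj'
            rcases (Nat.lt_succ_iff.1 hj').eq_or_lt with rfl | hlt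
            · exact hv
            · exact hall j' hlt
          · rw [if_neg, hv]
            intro hall'
            have := hall' j (by omega)
            omega
        · rw [if_neg hall, if_neg]
          · omega
          · exact fun hall' => hall fun j' hj' => hall' j' (by omega))
    refine ⟨u', m'', by omega, hu', hans, fun w hw hw' => ?_⟩
    by_cases c0 : w = u
    · subst c0; exact fits hu h2 trivial
    by_cases c1 : w < v
    · exact hf w (by omega) c1
    by_cases c2 : v + 5 ≤ w
    · exact hf' w c2 hw'
    obtain rfl | rfl | rfl | rfl | rfl : w = v ∨ w = v + 1 ∨ w = v + 2 ∨ w = v + 3 ∨ w = v + 4 := by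
      omega
    · exact fits hv' h5 (by simp [Instr.Fits]; omega)
    · exact fits e1 h6 (by simp [Instr.Fits])
    · refine fits e2 h7 ?_
      simp [Instr.Fits, hm' 19 (by decide), hm' 4 (by decide), hm.one, hm.scan]
      omega
    · exact fits e3 h8 (by simp [Instr.Fits]; omega)
    · exact fits e4 h9 trivial

/-- If each of at least `n` processors computes a result, then all results can be combined. -/
theorem answers_of_combine (hP : CodeAt P e (combineCode e)) (hlen : P.length = e + 10)
    (hn : n ≤ p) (hp : 0 < p) {T : ℕ}
    (hst : ∀ i < p, Steps P input s (t i) (Proc.init i) ⟨e, M i⟩) (ht : ∀ i < p, t i ≤ T)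
    (hM : ∀ i < p, ReadyToCombine input.length n result i (M i))
    (hr : ∀ j < n, result j = 1 ∨ result j = 2) (hs : 20 ≤ s) (hps : p ≤ s + 1)
    (hl : input.length + n ≤ s) (hin : ∀ a, inputMem input a ≤ s) {T' : ℕ}
    (hT' : T + 9 * n + 3 ≤ T') : Answers P p input T' s (∀ j < n, result j = 1) := by
  classical
  have hinv := combineInv hP hlen hn hst hM
  have hPe : P[e]? = some (.jumpIfZero 20 (e + 2)) := hP.head
  have hPe1 : P[e + 1]? = some (.write 18 22) := hP.tail.head
  have hPe2 : P[e + 2]? = some (.jumpIfZero 7 (e + 10)) := hP.tail.tail.head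
  have hnone : P[e + 10]? = none := by simp [hlen]
  have hproc : ∀ u i, (run P p input (u + 1)).proc i =
      ((run P p input u).proc i).step P (run P p input u).glob := fun u i => by
    rw [run_succ, Config.step]
  -- Cells behind the input are 0 initially, and results are 1 or 2, so 0 reliably signals that a
  -- result is still missing.
  have hG : ∀ u, ∀ j < n, (run P p input u).glob (input.length + j) = result j ∨
      (run P p input u).glob (input.length + j) = 0 ∧ u < T + 2 := by
    intro u j hj
    have htj := ht j (by omega)
    rw [(hinv u).glob, Nat.add_sub_cancel_left]
    by_cases h : t j + 2 ≤ u
    · exact .inl (by rw [if_pos ⟨by omega, by omega, h⟩])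
    · refine .inr ⟨?_, by omega⟩
      rw [if_neg (by omega)]
      exact List.getD_eq_default _ _ (by omega)
  have hstart : ∀ i : Fin p, ∃ u ≤ T + 2, (run P p input u).proc i = ⟨e + 2, M i⟩ ∧
      ∀ w < u, ((run P p input w).proc i).Fits P s := by
    intro i
    have hti := ht i i.2
    have hbefore : ∀ w < t i + 1, ((run P p input w).proc i).Fits P s := by
      intro w hw
      rcases (Nat.lt_succ_iff.1 hw).eq_or_lt with rfl | hlt
      · rw [(hinv _).before i le_rfl, (hst i i.2).1]
        intro I hI
        obtain rfl := Option.some.inj (hPe.symm.trans hI)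
        trivial
      · rw [(hinv _).before i hlt.le]
        exact ((hst i i.2).2 w hlt).fits
    have hw := (hinv _).write i rfl
    -- Surplus processors, with index at least `n`, skip the write and only take part in reading.
    by_cases h0 : n - (i : ℕ) = 0
    · rw [if_pos h0] at hw
      exact ⟨t i + 1, by omega, hw, hbefore⟩
    · rw [if_neg h0] at hw
      refine ⟨t i + 2, by omega, ?_, fun w hlt => ?_⟩
      · rw [hproc, hw, Proc.step, hPe1]
        rfl
      · rcases (Nat.lt_succ_iff.1 hlt).eq_or_lt with rfl | hlt
        · rw [hw]
          intro I hI
          obtain rfl := Option.some.inj (hPe1.symm.trans hI)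
          trivial
        · exact hbefore w hlt
  have hfinal : ∀ i : Fin p, ∃ u m, u ≤ T' ∧ (run P p input u).proc i = ⟨e + 10, m⟩ ∧
      (m 0 = if ∀ j < n, result j = 1 then 1 else 0) ∧
      ∀ w < u, ((run P p input w).proc i).Fits P s := by
    intro i
    obtain ⟨u, hu, hui, hfit⟩ := hstart i
    have hMi := hM i i.2
    obtain ⟨u', m, hu', hpc, hans, hfit'⟩ := combine_results (s := s)
      (σ := fun u => (run P p input u).proc i)
      (fun u => hproc u i) hP hs hl hG hr n u 0 (M i) (by omega) (by omega) hui
      ⟨hMi.scan, hMi.cnt, hMi.one, by simpa using hMi.ans⟩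
    refine ⟨u', m, by omega, hpc, hans, fun w hw => ?_⟩
    by_cases h : w < u
    · exact hfit w h
    · exact hfit' w (by omega) hw
  have hhalt : ∀ (i : Fin p) (u v : ℕ) (m : ℕ → ℕ), (run P p input u).proc i = ⟨e + 10, m⟩ →
      u ≤ v → (run P p input v).proc i = ⟨e + 10, m⟩ := by
    intro i u v m hu huv
    induction v, huv using Nat.le_induction with
    | base => exact hu
    | succ v _ ih =>
      rw [hproc, ih]
      exact Proc.Halted.step_eq (σ := ⟨e + 10, m⟩) hnone _
  refine ⟨fun i => ?_, ⟨⟨0, hp⟩, rfl, ?_⟩, fun u => (hinv u).exclusiveWrite hP hlen hst hM, ?_⟩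
  · obtain ⟨u, m, hu, hpc, -, -⟩ := hfinal i
    rw [hhalt i u T' m hpc hu]
    exact hnone
  · obtain ⟨u, m, hu, hpc, hans, -⟩ := hfinal ⟨0, hp⟩
    rw [hhalt _ u T' m hpc hu]
    exact ⟨fun h => hans.trans (if_pos h), fun h => hans.trans (if_neg h)⟩
  · refine run_boundedBy hps hin (by omega) fun w i => ?_
    obtain ⟨u, m, -, hpc, -, hfit⟩ := hfinal i
    by_cases h : w < u
    · exact hfit w h
    · rw [hhalt i u w m hpc (by omega)]
      exact Proc.Halted.fits (σ := ⟨e + 10, m⟩) hnone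

end Combine

end RAM

/-! ### Closure properties of primitive positive definability -/

namespace IsPrimitivePositive

variable {L : Language} {α β : Type} {n : ℕ}

theorem relabel {φ : L.BoundedFormula α n} (h : IsPrimitivePositive φ) {m : ℕ}
    (g : α → β ⊕ Fin m) : IsPrimitivePositive (φ.relabel g) := by
  induction h with
  | rel R ts => exact .rel R _
  | inf _ _ ih₁ ih₂ => exact .inf ih₁ ih₂
  | @ex n φ _ ih =>
    rw [Language.BoundedFormula.relabel_ex]
    exact .ex ih

theorem exs {φ : L.BoundedFormula α n} (h : IsPrimitivePositive φ) :
    IsPrimitivePositive φ.exs := by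
  induction n with
  | zero => exact h
  | succ n ih => exact ih (.ex h)

end IsPrimitivePositive

/-! ### Finite families of sets closed under the steps of arc consistency. -/

section Families

variable {L : Language} {B : Type*} [L.Structure B]

/-- The projection to the `j`th entry of the tuples in a relation whose entries are in the given
sets. -/
def relProj {k : ℕ} (R : L.Relations k) (j : Fin k) (S : Fin k → Set B) : Set B :=
  {y | ∃ x : Fin k → B, Language.Structure.RelMap R x ∧ (∀ i, x i ∈ S i) ∧ x j = y}

theorem relProj_subset {k : ℕ} (R : L.Relations k) (j : Fin k) (S : Fin k → Set B) :
    relProj R j S ⊆ S j := by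
  rintro y ⟨x, -, hS, rfl⟩
  exact hS j

/-- The elements related to `b` by a binary relation. -/
def slice (S : Set (Fin 2 → B)) (b : B) : Set B := {y | ![b, y] ∈ S}

/-- A finite family of subsets of `B`, containing `{b}`, in which arc consistency can be
computed. -/
structure ArcFamily (L : Language) {B : Type*} [L.Structure B] (b : B) where
  sets : Set (Set B)
  finite : sets.Finite
  univ_mem : Set.univ ∈ sets
  empty_mem : ∅ ∈ sets
  singleton_mem : {b} ∈ sets
  inter_mem : ∀ {X Y : Set B}, X ∈ sets → Y ∈ sets → X ∩ Y ∈ sets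
  relProj_mem : ∀ {k : ℕ} (R : L.Relations k) (j : Fin k) (S : Fin k → Set B),
    (∀ i, S i ∈ sets) → relProj R j S ∈ sets

theorem PPDefinable.inter {S T : Set (Fin 2 → B)} (hS : PPDefinable L S) (hT : PPDefinable L T) :
    PPDefinable L (S ∩ T) := by
  obtain ⟨φ, hφ, rfl⟩ := hS
  obtain ⟨ψ, hψ, rfl⟩ := hT
  refine ⟨φ ⊓ ψ, .inf hφ hψ, ?_⟩
  ext x
  simp [Language.Formula.Realize]

/-- Conjunctions of a primitive positive formula with relabelled binary ones. -/
theorem exists_conj {k : ℕ} {χ : L.BoundedFormula (Fin 2) k} (hχ : IsPrimitivePositive χ)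
    (φ : Fin k → Option (L.Formula (Fin 2))) (hφ : ∀ j, ∀ ψ ∈ φ j, IsPrimitivePositive ψ)
    (g : Fin k → Fin 2 → Fin 2 ⊕ Fin k) (l : List (Fin k)) :
    ∃ θ : L.BoundedFormula (Fin 2) k, IsPrimitivePositive θ ∧ ∀ (v : Fin 2 → B) (xs : Fin k → B),
      θ.Realize v xs ↔ χ.Realize v xs ∧
        ∀ j ∈ l, ∀ ψ ∈ φ j, ψ.Realize fun i => Sum.elim v xs (g j i) := by
  induction l with
  | nil => exact ⟨χ, hχ, by simp⟩
  | cons j l ih =>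
    obtain ⟨θ, hθ, hr⟩ := ih
    cases hj : φ j with
    | none => exact ⟨θ, hθ, fun v xs => by simp [hr, hj]⟩
    | some ψ =>
      refine ⟨θ ⊓ Language.BoundedFormula.relabel (g j) ψ,
        .inf hθ ((hφ j ψ (by simp [hj])).relabel _), fun v xs => ?_⟩
      have : (Language.BoundedFormula.relabel (g j) ψ).Realize v xs ↔
          ψ.Realize fun i => Sum.elim v xs (g j i) := by
        have := Language.BoundedFormula.realize_relabel (φ := ψ) (g := g j) (v := v) (xs := xs)
        simp only [Nat.add_zero, Fin.castAdd_zero, Fin.cast_refl, Function.comp_id] at this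
        rw [this, Language.Formula.Realize]
        refine iff_of_eq ?_
        congr 1
        exact Subsingleton.elim _ _
      rw [Language.BoundedFormula.realize_inf, hr, this]
      simp only [List.forall_mem_cons, hj, Option.mem_def, Option.some.injEq, forall_eq']
      tauto

/-- The projection is defined by `∃ x, R(…) ∧ ⋀ φᵢ(b, xᵢ)`, with free variable `0` for `b` and `1`
for the projected entry. Equality is not available, so entries confined to `{b}` are replaced by the
variable `0` inside `R`. The entry `j` is already the variable `1`, which is why `S j = {b}` is
excluded. -/
theorem relProj_slice {b : B} {k : ℕ} (R : L.Relations k) (j : Fin k) (S : Fin k → Set B)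
    (hj : S j = Set.univ ∨ ∃ T, PPDefinable L T ∧ S j = slice T b)
    (hS : ∀ i, S i = {b} ∨ S i = Set.univ ∨ ∃ T, PPDefinable L T ∧ S i = slice T b) :
    ∃ T, PPDefinable L T ∧ relProj R j S = slice T b := by
  classical
  -- A uniform description of the three kinds of sets: the flag `c` marks `{b}`, and the optional
  -- formula is absent for `{b}` and for the full set, neither of which need be a slice of a
  -- definable relation.
  have hS' : ∀ i, ∃ (c : Bool) (φ : Option (L.Formula (Fin 2))), (i = j → c = false) ∧
      (∀ ψ ∈ φ, IsPrimitivePositive ψ) ∧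
      ∀ y, y ∈ S i ↔ (c = true → y = b) ∧ ∀ ψ ∈ φ, ψ.Realize ![b, y] := by
    intro i
    have huniv : ∀ i, S i = Set.univ → ∃ (c : Bool) (φ : Option (L.Formula (Fin 2))),
        (i = j → c = false) ∧ (∀ ψ ∈ φ, IsPrimitivePositive ψ) ∧
        ∀ y, y ∈ S i ↔ (c = true → y = b) ∧ ∀ ψ ∈ φ, ψ.Realize ![b, y] := fun i h =>
      ⟨false, none, by simp, by simp, by simp [h]⟩
    have hslice : ∀ i, (∃ T, PPDefinable L T ∧ S i = slice T b) →
        ∃ (c : Bool) (φ : Option (L.Formula (Fin 2))), (i = j → c = false) ∧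
        (∀ ψ ∈ φ, IsPrimitivePositive ψ) ∧
        ∀ y, y ∈ S i ↔ (c = true → y = b) ∧ ∀ ψ ∈ φ, ψ.Realize ![b, y] := by
      rintro i ⟨T, ⟨φ, hφ, rfl⟩, h⟩
      exact ⟨false, some φ, by simp, by simpa using hφ, by simp [h, slice]⟩
    by_cases hij : i = j
    · subst hij
      exact hj.elim (huniv i) (hslice i)
    · rcases hS i with h | h | h
      · exact ⟨true, none, fun h => absurd h hij, by simp, by simp [h]⟩
      · exact huniv i h
      · exact hslice i h
  choose c φ hcj hφ hmem using hS'
  -- the variable that stands for the `i`th entry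
  let pos : Fin k → Fin 2 ⊕ Fin k := fun i =>
    if i = j then .inl 1 else if c i = true then .inl 0 else .inr i
  -- All `k` bound variables are quantified, although those for the entry `j` and for entries in
  -- `{b}` do not occur. This is harmless, since the tuple `x` itself supplies values for them.
  obtain ⟨θ, hθ, hr⟩ := exists_conj (B := B)
    (IsPrimitivePositive.rel R fun i => Language.Term.var (pos i)) φ hφ
    (fun i => ![.inl 0, pos i]) (List.finRange k)
  have hrel : ∀ (v : Fin 2 → B) (xs : Fin k → B),
      (Language.BoundedFormula.rel R fun i => Language.Term.var (pos i)).Realize v xs ↔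
        Language.Structure.RelMap R fun i => Sum.elim v xs (pos i) := fun v xs => Iff.rfl
  refine ⟨{x | Language.Formula.Realize θ.exs x}, ⟨θ.exs, hθ.exs, rfl⟩, ?_⟩
  ext y
  simp only [slice, relProj, Set.mem_ofPred_eq, Language.BoundedFormula.realize_exs, hr, hrel,
    List.mem_finRange, true_imp_iff]
  constructor
  · rintro ⟨x, hR, hx, rfl⟩
    have hpos : ∀ i, Sum.elim ![b, x j] x (pos i) = x i := by
      intro i
      by_cases hij : i = j
      · simp [pos, hij]
      · by_cases hc : c i = true
        · simp [pos, hij, hc, ((hmem i _).1 (hx i)).1 hc]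
        · simp [pos, hij, hc]
    refine ⟨x, by simpa only [hpos] using hR, fun i ψ hψ => ?_⟩
    convert ((hmem i _).1 (hx i)).2 ψ hψ using 1
    funext z
    fin_cases z
    · rfl
    · exact hpos i
  · rintro ⟨xs, hR, hψ⟩
    refine ⟨_, hR, fun i => (hmem i _).2 ⟨fun hc => ?_, fun ψ hψ' => ?_⟩, by simp [pos]⟩
    · have hij : i ≠ j := fun h => by simp [hcj i h] at hc
      simp [pos, hij, hc]
    · convert hψ i ψ hψ' using 1
      funext z
      fin_cases z <;> rfl

/-- If there are only finitely many primitive positive definable binary relations, then arc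
consistency starting from `{b}` can be computed in a finite family of sets. -/
theorem nonempty_arcFamily (hpp : {S : Set (Fin 2 → B) | PPDefinable L S}.Finite) (b : B) :
    Nonempty (ArcFamily L b) := by
  have hsub : ∀ X : Set B, X ⊆ {b} → X = ∅ ∨ X = {b} := fun X hX => Set.subset_singleton_iff_eq.1 hX
  -- The three extra sets are adjoined because formulas without equality need not define them.
  refine ⟨⟨{∅, {b}, Set.univ} ∪ (fun S => slice S b) '' {S | PPDefinable L S},
    (Set.toFinite _).union (hpp.image _), by simp, by simp, by simp, ?_, ?_⟩⟩
  · have hb : ∀ X, X ⊆ {b} → X ∈ ({∅, {b}, Set.univ} : Set (Set B)) ∪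
        (fun S => slice S b) '' {S | PPDefinable L S} := fun X hX => by
      rcases hsub X hX with rfl | rfl <;> simp
    rintro X Y ((rfl | rfl | rfl) | ⟨S, hS, rfl⟩) hY
    · exact hb _ (by simp)
    · exact hb _ (by simp)
    · simpa using hY
    · rcases hY with (rfl | rfl | rfl) | ⟨T, hT, rfl⟩
      · exact hb _ (by simp)
      · exact hb _ (by simp)
      · simpa using .inr ⟨S, hS, rfl⟩
      · exact .inr ⟨S ∩ T, PPDefinable.inter hS hT, rfl⟩
  · intro k R j S hS
    -- An empty constraint empties the projection. Otherwise only the kinds of sets treated by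
    -- `relProj_slice` remain.
    by_cases hempty : ∃ i, S i = ∅
    · obtain ⟨i, hi⟩ := hempty
      have : relProj R j S = ∅ := by
        ext y
        simp only [relProj, Set.mem_ofPred_eq, Set.mem_empty_iff_false, iff_false]
        rintro ⟨x, -, hx, -⟩
        have := hx i
        simp [hi] at this
      simp [this]
    · push Not at hempty
      have hS' : ∀ i, S i = {b} ∨ S i = Set.univ ∨ ∃ T, PPDefinable L T ∧ S i = slice T b := by
        intro i
        rcases hS i with (h | h | h) | ⟨T, hT, h⟩
        · exact absurd h (hempty i).ne_empty
        · exact .inl h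
        · exact .inr (.inl h)
        · exact .inr (.inr ⟨T, hT, h.symm⟩)
      -- If `S j = {b}`, the projection is a subset of `{b}`, so no formula is needed.
      rcases hS' j with h | h
      · have := relProj_subset R j S
        rw [h] at this
        rcases hsub _ this with h' | h' <;> simp [h']
      · obtain ⟨T, hT, h'⟩ := relProj_slice R j S h hS'
        exact .inr ⟨T, hT, h'.symm⟩

namespace ArcFamily

variable {b : B} (F : ArcFamily L b)

instance : Finite F.sets := F.finite

noncomputable instance : SemilatticeInf F.sets :=
  Subtype.semilatticeInf fun _ _ hx hy => F.inter_mem hx hy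

theorem le_iff (x y : F.sets) : x ≤ y ↔ (x : Set B) ⊆ y := Iff.rfl

end ArcFamily

end Families

/-! ### Numbering finite semilattices -/

/-- A linear extension turns descent in the semilattice into descent of natural numbers, which is
what the potential argument counts. -/
theorem exists_numbering (V : Type*) [PartialOrder V] [Finite V] [Nonempty V] :
    ∃ (m : ℕ) (enc : V → ℕ) (dec : ℕ → V), (∀ v, enc v < m) ∧ (∀ v, dec (enc v) = v) ∧
      (∀ y < m, enc (dec y) = y) ∧ Monotone enc := by
  classical
  obtain ⟨m, o, ho⟩ : ∃ m, ∃ o : V ≃ Fin m, Monotone o := by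
    let hV : Fintype (LinearExtension V) := @Fintype.ofFinite _ ‹Finite V›
    let o := (Fintype.orderIsoFinOfCardEq (LinearExtension V) rfl).symm
    exact ⟨_, o.toEquiv, fun v v' h => o.monotone (toLinearExtension.monotone h)⟩
  refine ⟨m, fun v => o v, fun y => if h : y < m then o.symm ⟨y, h⟩ else Classical.arbitrary V,
    fun v => (o v).2, fun v => ?_, fun y hy => ?_, ho⟩
  · simp
  · simp [hy]

namespace RAM

/-- The update is the meet of `y` with a bound that depends on the source only. Meets decrease and
are idempotent, and a value below the bound stays below it under further meets. -/
theorem contracting_of_inf {V : Type*} [SemilatticeInf V] {m : ℕ} {enc : V → ℕ} {dec : ℕ → V}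
    (hlt : ∀ v, enc v < m) (hdec : ∀ v, dec (enc v) = v) (henc : ∀ y < m, enc (dec y) = y)
    (hmono : Monotone enc) (g : ℕ → V → V) :
    Contracting fun l x y => enc (dec y ⊓ g l (dec x)) := by
  refine ⟨fun l x y => ?_, fun l x y l' x' h => ?_, fun l x y => ?_⟩
  · by_cases hy : y < m
    · exact (hmono inf_le_left).trans (henc y hy).le
    · exact (hlt _).le.trans (not_lt.1 hy)
  · have h' := congrArg dec h
    simp only [hdec, inf_eq_left] at h' ⊢
    rw [inf_eq_left.2 (inf_le_left.trans h')]
  · simp only [hdec]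
    rw [inf_assoc, inf_idem]

end RAM

/-! ### Correctness of peeking at all orbit representatives simultaneously. -/

namespace RAM

/-! ### Arc consistency for several start values at the same time -/

section ArcConsistency

variable {L : Language} {r : ℕ} (e : Fin r ≃ Σ k, L.Relations k) {B : Type*}

/-- Labels of edges: from an element to a tuple if `true`, from a tuple to an element if `false`,
with the relation and the position in the tuple; `none` for edges to the global node. -/
abbrev ArcLabel (r K : ℕ) : Type := Option (Bool × Fin r × Fin (K + 1))

variable {K : ℕ}

/-- The numbers of the labels of edges. -/
def labelsOf (enc : ArcLabel r K → ℕ) : Labels where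
  up i j := if h : i < r ∧ j < K + 1 then enc (some (true, ⟨i, h.1⟩, ⟨j, h.2⟩)) else 0
  down i j := if h : i < r ∧ j < K + 1 then enc (some (false, ⟨i, h.1⟩, ⟨j, h.2⟩)) else 0
  glob := enc none

/-- The relations of a finite structure, as lists of tuples of numbers. -/
def relData (A : FiniteInstance L) : List RelData :=
  (List.finRange r).map fun ρ : Fin r =>
    ⟨(ρ : ℕ), (e ρ).1, (A.tuples (e ρ).2).map fun t => List.ofFn fun j => (t j : ℕ)⟩

/-- All tuples of a finite structure, with the numbers of their relations. -/
def allTuples (A : FiniteInstance L) : List (ℕ × List ℕ) := (relData e A).flatMap RelData.toTuples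

theorem mem_allTuples {A : FiniteInstance L} {q : ℕ × List ℕ} :
    q ∈ allTuples e A ↔
      ∃ ρ : Fin r, ∃ t ∈ A.tuples (e ρ).2, q = ((ρ : ℕ), List.ofFn fun j => (t j : ℕ)) := by
  simp only [allTuples, relData, List.mem_flatMap, List.mem_map, List.mem_finRange, true_and,
    RelData.toTuples]
  constructor
  · rintro ⟨_, ⟨ρ, rfl⟩, _, ht', rfl⟩
    obtain ⟨t, ht, rfl⟩ := List.mem_map.1 ht'
    exact ⟨ρ, t, ht, rfl⟩
  · rintro ⟨ρ, t, ht, rfl⟩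
    exact ⟨_, ⟨ρ, rfl⟩, _, List.mem_map.2 ⟨t, ht, rfl⟩, rfl⟩

variable {e} {A : FiniteInstance L} {enc : ArcLabel r K → ℕ} {dec : ℕ → ArcLabel r K}

theorem labelsOf_up (hK : ∀ ρ, (e ρ).1 ≤ K + 1) (ρ : Fin r) (j : Fin (e ρ).1) :
    (labelsOf enc).up ρ j = enc (some (true, ρ, Fin.castLE (hK ρ) j)) := by
  exact dif_pos (⟨ρ.2, j.2.trans_le (hK ρ)⟩ : (ρ : ℕ) < r ∧ (j : ℕ) < K + 1)

theorem labelsOf_down (hK : ∀ ρ, (e ρ).1 ≤ K + 1) (ρ : Fin r) (j : Fin (e ρ).1) :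
    (labelsOf enc).down ρ j = enc (some (false, ρ, Fin.castLE (hK ρ) j)) := by
  exact dif_pos (⟨ρ.2, j.2.trans_le (hK ρ)⟩ : (ρ : ℕ) < r ∧ (j : ℕ) < K + 1)

/-- The edges of the graph of a finite structure. -/
theorem mem_graph_allTuples (hK : ∀ ρ, (e ρ).1 ≤ K + 1) {d : Edge} :
    d ∈ (labelsOf enc).graph A.card (allTuples e A) ↔
      (∃ u ρ, ∃ t ∈ A.tuples (e ρ).2,
        (allTuples e A)[u]? = some ((ρ : ℕ), List.ofFn fun j => (t j : ℕ)) ∧ ∃ j,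
        (d = ⟨t j, enc (some (true, ρ, Fin.castLE (hK ρ) j)), A.card + 1 + u⟩ ∨
          d = ⟨A.card + 1 + u, enc (some (false, ρ, Fin.castLE (hK ρ) j)), t j⟩)) ∨
      ∃ v < A.card, d = ⟨v, enc none, A.card⟩ := by
  rw [Labels.mem_graph]
  refine or_congr ⟨?_, ?_⟩ Iff.rfl
  · rintro ⟨u, q, hq, j, v, hv, hd⟩
    obtain ⟨ρ, t, ht, rfl⟩ := (mem_allTuples e).1 (List.mem_of_getElem? hq)
    obtain ⟨hj, rfl⟩ := List.getElem?_eq_some_iff.1 hv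
    have hj' : j < (e ρ).1 := by simpa using hj
    refine ⟨u, ρ, t, ht, hq, ⟨j, hj'⟩, ?_⟩
    rw [← labelsOf_up (enc := enc) hK ρ ⟨j, hj'⟩, ← labelsOf_down (enc := enc) hK ρ ⟨j, hj'⟩]
    simpa using hd
  · rintro ⟨u, ρ, t, ht, hq, j, hd⟩
    rw [← labelsOf_up (enc := enc) hK ρ j, ← labelsOf_down (enc := enc) hK ρ j] at hd
    exact ⟨u, _, hq, j, t j, by simp, hd⟩

open Classical in
/-- The elements that the value of each node must contain, if `f` is a homomorphism. -/
noncomputable def lowerBound (e : Fin r ≃ Σ k, L.Relations k) (A : FiniteInstance L) (f : ℕ → B)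
    (x : ℕ) (c : Fin (K + 1)) : Set B :=
  if x < A.card then if c = 0 then {f x} else ∅
  else if x = A.card then if c = 0 then Set.univ else ∅
  else {y | ∃ q v, (allTuples e A)[x - (A.card + 1)]? = some q ∧ q.2[(c : ℕ)]? = some v ∧ y = f v}

theorem lowerBound_elem {f : ℕ → B} {v : ℕ} (hv : v < A.card) (c : Fin (K + 1)) :
    lowerBound e A f v c = if c = 0 then {f v} else ∅ := by
  rw [lowerBound, if_pos hv]

theorem lowerBound_glob {f : ℕ → B} (c : Fin (K + 1)) :
    lowerBound e A f A.card c = if c = 0 then Set.univ else ∅ := by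
  rw [lowerBound, if_neg (lt_irrefl _), if_pos rfl]

theorem mem_lowerBound_tuple {f : ℕ → B} {u : ℕ} {q : ℕ × List ℕ}
    (hu : (allTuples e A)[u]? = some q) (c : Fin (K + 1)) (y : B) :
    y ∈ lowerBound e A f (A.card + 1 + u) c ↔ ∃ v, q.2[(c : ℕ)]? = some v ∧ y = f v := by
  rw [lowerBound, if_neg (by omega), if_neg (by omega), Nat.add_sub_cancel_left]
  simp [hu]

variable [L.Structure B] {I : Type*} {rep : I → B} (F : ∀ i, ArcFamily L (rep i))

/-- The values of nodes: for each start value, a family of sets. For an element, only the first set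
is relevant. For a tuple, these are the sets that are known to contain its entries. -/
abbrev Views (K : ℕ) : Type _ := ∀ i : I, Fin (K + 1) → (F i).sets

/-- The full set. -/
def fullSet (i : I) : (F i).sets := ⟨Set.univ, (F i).univ_mem⟩

open Classical in
/-- The upper bound on the value of the target of an edge that follows from the value of its
source. -/
noncomputable def edgeBound (e : Fin r ≃ Σ k, L.Relations k)
    (hK : ∀ ρ, (e ρ).1 ≤ K + 1) : ArcLabel r K → Views F K → Views F K
  | none, x => fun i _ =>
      if ((x i 0 : (F i).sets) : Set B) = ∅ then ⟨∅, (F i).empty_mem⟩ else fullSet F i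
  | some (true, _, j), x => fun i c => if c = j then x i 0 else fullSet F i
  | some (false, ρ, j), x => fun i c =>
      if h : (j : ℕ) < (e ρ).1 ∧ c = 0 then
        ⟨relProj (e ρ).2 ⟨j, h.1⟩ fun c' => x i (Fin.castLE (hK ρ) c'),
          (F i).relProj_mem _ _ _ fun c' => (x i (Fin.castLE (hK ρ) c')).2⟩
      else fullSet F i

open Classical in
/-- The initial value of the element at which the algorithm starts. -/
noncomputable def peekView : Views F K := fun i c =>
  if c = 0 then ⟨{rep i}, (F i).singleton_mem⟩ else fullSet F i

/-- The values after exhaustive propagation give a homomorphism to the power structure. -/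
theorem exists_hom_powerStructure [L.IsRelational] [IsEmpty (L.Relations 0)]
    (hK : ∀ ρ, (e ρ).1 ≤ K + 1)
    (hdec : ∀ l, dec (enc l) = l) {W : ℕ → Views F K}
    (hW : ∀ d ∈ (labelsOf enc).graph A.card (allTuples e A),
      W d.dst ≤ edgeBound F e hK (dec d.lab) (W d.src)) (a : Fin A.card)
    (ha : W a ≤ peekView F) {i : I} (hi : ((W A.card i 0 : (F i).sets) : Set B) ≠ ∅) :
    ∃ h : A.Carrier →[L] NonemptySubset B, ∃ b, (h a).1 = {b} := by
  -- An empty set at any element would reach the global node through the edge labelled `none` and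
  -- contradict `hi`.
  have hne : ∀ v : Fin A.card, ((W v i 0 : (F i).sets) : Set B).Nonempty := by
    intro v
    by_contra hv
    rw [Set.not_nonempty_iff_eq_empty] at hv
    have := hW ⟨v, enc none, A.card⟩ ((mem_graph_allTuples hK).2 (.inr ⟨v, v.2, rfl⟩)) i 0
    simp only [hdec, edgeBound, hv, if_true] at this
    exact hi (Set.subset_eq_empty this rfl)
  have hrel : ∀ ρ, ∀ t : Fin (e ρ).1 → A.Carrier, t ∈ A.tuples (e ρ).2 →
      ∃ S : Set (Fin (e ρ).1 → B), S.Nonempty ∧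
        (∀ x ∈ S, Language.Structure.RelMap (e ρ).2 x) ∧
        ∀ j, ((W (t j) i 0 : (F i).sets) : Set B) = (fun x => x j) '' S := by
    intro ρ t ht
    obtain ⟨u, hu⟩ := List.mem_iff_getElem?.1 ((mem_allTuples e).2 ⟨ρ, t, ht, rfl⟩)
    -- The tuples of the relation that are compatible with the sets stored at the tuple node. The
    -- downward edge gives that the set of `t j` is contained in the projection of `S`, and the
    -- upward edge gives the reverse inclusion.
    let S : Set (Fin (e ρ).1 → B) := {x | Language.Structure.RelMap (e ρ).2 x ∧
      ∀ j, x j ∈ ((W (A.card + 1 + u) i (Fin.castLE (hK ρ) j) : (F i).sets) : Set B)}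
    have hS : ∀ j, ((W (t j) i 0 : (F i).sets) : Set B) = (fun x => x j) '' S := by
      intro j
      have h1 := hW _ ((mem_graph_allTuples (enc := enc) hK).2
        (.inl ⟨u, ρ, t, ht, hu, j, .inr rfl⟩)) i 0
      have h2 := hW _ ((mem_graph_allTuples (enc := enc) hK).2
        (.inl ⟨u, ρ, t, ht, hu, j, .inl rfl⟩)) i (Fin.castLE (hK ρ) j)
      simp only [hdec, edgeBound, Fin.val_castLE, Fin.is_lt, and_self, dif_pos, if_true,
        ArcFamily.le_iff] at h1 h2
      refine Set.Subset.antisymm (fun y hy => ?_) ?_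
      · obtain ⟨x, hR, hx, hxy⟩ := h1 hy
        exact ⟨x, ⟨hR, hx⟩, hxy⟩
      · rintro _ ⟨x, ⟨-, hx⟩, rfl⟩
        exact h2 (hx j)
    refine ⟨S, ?_, fun x hx => hx.1, hS⟩
    -- Nonemptiness of `S` is inferred from the nonempty set at one of the entries, so an entry must
    -- exist; this is where symbols of arity 0 are excluded.
    have hpos : 0 < (e ρ).1 := by
      rcases Nat.eq_zero_or_pos (e ρ).1 with h0 | h0
      · have := (e ρ).2
        rw [h0] at this
        exact isEmptyElim this
      · exact h0
    have := hne (t ⟨0, hpos⟩)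
    rw [hS] at this
    exact Set.image_nonempty.1 this
  have hrel' : ∀ q : Σ k, L.Relations k, ∀ t : Fin q.1 → A.Carrier, t ∈ A.tuples q.2 →
      ∃ S : Set (Fin q.1 → B), S.Nonempty ∧ (∀ x ∈ S, Language.Structure.RelMap q.2 x) ∧
        ∀ j, ((W (t j) i 0 : (F i).sets) : Set B) = (fun x => x j) '' S := by
    intro q
    obtain ⟨ρ, rfl⟩ := e.surjective q
    exact hrel ρ
  refine ⟨⟨fun v => ⟨(W v i 0 : (F i).sets), hne v⟩, fun f => isEmptyElim f,
    fun {k} R t ht => hrel' ⟨k, R⟩ t ht⟩, rep i, ?_⟩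
  have := ha i 0
  simp only [peekView, if_true, ArcFamily.le_iff] at this
  exact (Set.subset_singleton_iff_eq.1 this).resolve_left (hne a).ne_empty

/-- Soundness of an update: along a downward edge the tuple `f ∘ t` itself witnesses membership in
the projection, along an upward edge the value `f (t j)` is passed on, and an edge to the global
node has no effect because the set of its source contains the value of `f`. -/
theorem lowerBound_edge (hK : ∀ ρ, (e ρ).1 ≤ K + 1) (hdec : ∀ l, dec (enc l) = l) {f : ℕ → B}
    (hf : ∀ ρ, ∀ t ∈ A.tuples (e ρ).2, Language.Structure.RelMap (e ρ).2 fun j => f (t j)) {d : Edge}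
    (hd : d ∈ (labelsOf enc).graph A.card (allTuples e A)) {x : Views F K} {i : I}
    (hx : ∀ c, lowerBound e A f d.src c ⊆ (x i c : (F i).sets)) (c : Fin (K + 1)) :
    lowerBound e A f d.dst c ⊆ (edgeBound F e hK (dec d.lab) x i c : (F i).sets) := by
  rcases (mem_graph_allTuples hK).1 hd with ⟨u, ρ, t, ht, hu, j, rfl | rfl⟩ | ⟨v, hv, rfl⟩
  · have hx0 := hx 0
    rw [lowerBound_elem (t j).2, if_pos rfl, Set.singleton_subset_iff] at hx0
    simp only [hdec, edgeBound]
    intro y hy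
    obtain ⟨v, hv, rfl⟩ := (mem_lowerBound_tuple hu c y).1 hy
    split
    · rename_i hc
      subst hc
      obtain rfl : (t j : ℕ) = v := by simpa using hv
      exact hx0
    · trivial
  · rw [lowerBound_elem (t j).2]
    by_cases hc : c = 0
    · rw [if_pos hc, Set.singleton_subset_iff]
      simp only [hdec, edgeBound, Fin.val_castLE, Fin.is_lt, true_and, dif_pos hc]
      exact ⟨fun j => f (t j), hf ρ t ht, fun j' => hx _ ((mem_lowerBound_tuple hu _ _).2
        ⟨t j', by simp, rfl⟩), rfl⟩
    · rw [if_neg hc]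
      exact Set.empty_subset _
  · have hx0 := hx 0
    rw [lowerBound_elem hv, if_pos rfl, Set.singleton_subset_iff] at hx0
    simp only [hdec, edgeBound]
    rw [if_neg (Set.nonempty_iff_ne_empty.1 ⟨_, hx0⟩)]
    exact Set.subset_univ _

end ArcConsistency
-- Induction over updates, stated in the semilattice instead of its numbering, for properties that
-- may depend on the node. It serves for the upper bound at the peeked element and for the lower
-- bounds given by a homomorphism.
theorem Reach.inv {V : Type*} [SemilatticeInf V] {enc : V → ℕ} {dec : ℕ → V}
    (hdec : ∀ v, dec (enc v) = v) {g : ℕ → V → V} {E : List Edge} {w₀ w : ℕ → ℕ}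
    (h : Reach (fun l x y => enc (dec y ⊓ g l (dec x))) E w₀ w) {p : ℕ → V → Prop}
    (h₀ : ∀ x, p x (dec (w₀ x)))
    (hp : ∀ d ∈ E, ∀ x y, p d.src x → p d.dst y → p d.dst (y ⊓ g d.lab x)) (x : ℕ) :
    p x (dec (w x)) := by
  induction h generalizing x with
  | refl => exact h₀ x
  | @step w d _ hd ih =>
    by_cases hx : x = d.dst
    · subst hx
      rw [Function.update_self, hdec]
      exact hp d hd _ _ (ih _) (ih _)
    · rw [Function.update_of_ne hx]
      exact ih x

/-- Peek arc consistency can be computed by propagation in the graph of a finite structure. -/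
theorem exists_arcData {L : Language} [L.IsRelational] [IsEmpty (L.Relations 0)] {r : ℕ}
    (e : Fin r ≃ Σ k, L.Relations k) (B : Type*) [L.Structure B]
    (horb : Finite (Quotient (orbitSetoid L B)))
    (hpp : {S : Set (Fin 2 → B) | PPDefinable L S}.Finite) :
    ∃ (D : ArcData) (Λ : Labels), D.Valid ∧ Λ.glob < D.labels ∧
      (∀ ρ : Fin r, ∀ j < (e ρ).1, Λ.up ρ j < D.labels ∧ Λ.down ρ j < D.labels) ∧
      ∀ (A : FiniteInstance L) (a : Fin A.card) (z : ℕ),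
        D.Result (Λ.graph A.card (allTuples e A)) (A.card + 1 + (allTuples e A).length) A.card a z →
        z ≤ 1 ∧ (z = 1 → ∃ h : A.Carrier →[L] NonemptySubset B, ∃ b, (h a).1 = {b}) ∧
          (Nonempty (A.Carrier →[L] B) → z = 1) := by
  classical
  let I := Quotient (orbitSetoid L B)
  let rep : I → B := Quotient.out
  let F : ∀ i, ArcFamily L (rep i) := fun i => (nonempty_arcFamily hpp (rep i)).some
  -- The sum of all arities bounds each of them; the additional coordinate makes sure that `0 : Fin
  -- (K + 1)` exists.
  obtain ⟨K, hK⟩ : ∃ K, ∀ ρ, (e ρ).1 ≤ K + 1 := by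
    refine ⟨∑ ρ, (e ρ).1, fun ρ => ?_⟩
    have := Finset.single_le_sum (f := fun ρ => (e ρ).1) (fun _ _ => Nat.zero_le _)
      (Finset.mem_univ ρ)
    exact le_trans this (Nat.le_succ _)
  have : Nonempty (Views F K) := ⟨fun i _ => fullSet F i⟩
  -- `Views F K` is finite because there are finitely many orbits and each family is finite; the
  -- number of values is thus independent of the instance.
  obtain ⟨m, enc, dec, hlt, hdec, henc, hmono⟩ := exists_numbering (Views F K)
  obtain ⟨p, ⟨o⟩⟩ := Finite.exists_equiv_fin (ArcLabel r K)
  let encL : ArcLabel r K → ℕ := fun l => o l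
  let decL : ℕ → ArcLabel r K := fun l => if h : l < p then o.symm ⟨l, h⟩ else none
  have hdecL : ∀ l, decL (encL l) = l := fun l => by simp [decL, encL]
  let g : ℕ → Views F K → Views F K := fun l => edgeBound F e hK (decL l)
  let D : ArcData :=
    { labels := p
      values := m
      update := fun l x y => enc (dec y ⊓ g l (dec x))
      init := enc fun i _ => fullSet F i
      peek := enc (peekView F)
      accept := fun v => if ∃ i, ((dec v i 0 : (F i).sets) : Set B) ≠ ∅ then 1 else 0 }
  refine ⟨D, labelsOf encL, ⟨contracting_of_inf hlt hdec henc hmono g, hlt _, hlt _, fun v => ?_⟩,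
    (o none).2, fun ρ j hj => ?_, fun A a z hz => ?_⟩
  · simp only [D]
    split <;> simp
  · have h1 := labelsOf_up (enc := encL) hK ρ ⟨j, hj⟩
    have h2 := labelsOf_down (enc := encL) hK ρ ⟨j, hj⟩
    simp only at h1 h2
    rw [h1, h2]
    exact ⟨(o _).2, (o _).2⟩
  · obtain ⟨w₀, w, hw₀, hreach, hwlt, hfix, rfl⟩ := hz
    set N := A.card + 1 + (allTuples e A).length with hN
    have hdst : ∀ d ∈ (labelsOf encL).graph A.card (allTuples e A), d.dst < N := by
      intro d hd
      rcases (mem_graph_allTuples hK).1 hd with ⟨u, ρ, t, ht, hu, j, rfl | rfl⟩ | ⟨v, hv, rfl⟩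
      · have := (List.getElem?_eq_some_iff.1 hu).1
        simp only; omega
      · have := (t j).2
        simp only; omega
      · simp only; omega
    have ha := a.2
    refine ⟨?_, fun hacc => ?_, ?_⟩
    · simp only [D]
      split <;> simp
    · obtain ⟨i, hi⟩ : ∃ i, ((dec (w A.card) i 0 : (F i).sets) : Set B) ≠ ∅ := by
        by_contra hne
        simp only [D, if_neg hne] at hacc
        omega
      refine exists_hom_powerStructure F hK hdecL (W := fun x => dec (w x)) (fun d hd => ?_) a ?_ hi
      · have := congrArg dec (hfix d hd)
        simp only [D, hdec, inf_eq_left] at this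
        exact this
      -- The value of `a` starts at `peekView` and can only decrease.
      · refine Reach.inv (p := fun x v => x = a → v ≤ peekView F) hdec hreach (fun x hx => ?_)
          (fun d _ x y _ hy h => inf_le_left.trans (hy h)) a rfl
        subst hx
        rw [hw₀ a (by omega), if_pos rfl, hdec]
    · rintro ⟨f₀⟩
      let i : I := Quotient.mk _ (f₀ a)
      -- The automorphism that takes `f₀ a` to the representative of its orbit makes the composed
      -- homomorphism compatible with the peek `{rep i}` at `a`.
      obtain ⟨φ, hφ⟩ : ∃ φ : B ≃[L] B, φ (f₀ a) = rep i :=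
        (orbitSetoid L B).symm (Quotient.exact (Quotient.out_eq i))
      let f : ℕ → B := fun v => if h : v < A.card then φ (f₀ ⟨v, h⟩) else rep i
      have hfv : ∀ v : Fin A.card, f v = φ (f₀ v) := fun v => by simp [f]
      have hf : ∀ ρ, ∀ t ∈ A.tuples (e ρ).2,
          Language.Structure.RelMap (e ρ).2 fun j => f (t j) := by
        intro ρ t ht
        have h1 : Language.Structure.RelMap (e ρ).2 (f₀ ∘ t) := f₀.map_rel (e ρ).2 t ht
        have h2 := (φ.map_rel (e ρ).2 (f₀ ∘ t)).2 h1
        convert h2 using 1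
        funext j
        exact hfv (t j)
      -- In the coordinate `i`, no update removes a value of `f`. At the global node the lower bound
      -- is the full set, so this coordinate is accepted.
      have hall : ∀ x, x < N → ∀ c, lowerBound e A f x c ⊆ (dec (w x) i c : (F i).sets) := by
        refine Reach.inv (p := fun x v => x < N →
          ∀ c, lowerBound e A f x c ⊆ (v i c : (F i).sets)) hdec hreach (fun x hx c => ?_)
          fun d hd x y hx hy hlt c => ?_
        · rw [hw₀ x hx]
          split
          · rename_i hxa
            subst hxa
            rw [hdec]
            rw [lowerBound_elem ha]
            simp only [peekView]
            split
            · rw [hfv, hφ]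
            · exact Set.empty_subset _
          · rw [hdec]
            exact Set.subset_univ _
        · have hsrc : d.src < N := by
            rcases (mem_graph_allTuples hK).1 hd with ⟨u, ρ, t, ht, hu, j, rfl | rfl⟩ | ⟨v, hv, rfl⟩
            · have := (t j).2
              simp only; omega
            · have := (List.getElem?_eq_some_iff.1 hu).1
              simp only; omega
            · simp only; omega
          exact Set.subset_inter (hy hlt c)
            (lowerBound_edge F hK hdecL hf hd (hx hsrc) c)
      have hglob := hall A.card (by omega) 0
      rw [lowerBound_glob, if_pos rfl] at hglob
      simp only [D]
      exact if_pos ⟨i, Set.nonempty_iff_ne_empty.1 ⟨rep i, hglob trivial⟩⟩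

end RAM

/-! ### Sizes of instances, and the programs that peek at all elements or at one. -/

namespace RAM

/-! ### The size of the input -/

section Size

variable {L : Language} {r : ℕ} (e : Fin r ≃ Σ k, L.Relations k) (A : FiniteInstance L)

theorem encode_eq : A.encode e = A.card :: (relData e A).flatMap RelData.encode := by
  rw [FiniteInstance.encode, relData, List.flatMap_map]
  congr 2
  funext ρ
  simp [RelData.encode, List.flatMap_def]

theorem map_relData : ((relData e A).map fun d => (d.idx, d.arity)) =
    (List.finRange r).map fun ρ : Fin r => ((ρ : ℕ), (e ρ).1) := by
  simp [relData, Function.comp_def]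

theorem length_relData : (relData e A).length = r := by simp [relData]

theorem size_eq : A.size e = A.card + entryCount (relData e A) := by
  simp only [FiniteInstance.size, entryCount, relData, List.map_map, Function.comp_def,
    List.length_map, Fin.sum_univ_def, Nat.mul_comm]

/-- Each tuple has at least one entry. Without this, tuples would need nodes and time that the size
of the instance does not account for. -/
theorem tupleCount_le [IsEmpty (L.Relations 0)] :
    tupleCount (relData e A) ≤ entryCount (relData e A) := by
  rw [tupleCount, entryCount, relData, List.map_map, List.map_map]
  refine List.sum_le_sum fun ρ _ => ?_
  simp only [Function.comp_apply]
  refine Nat.le_mul_of_pos_right _ (Nat.pos_of_ne_zero fun h0 => ?_)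
  have := (e ρ).2
  rw [h0] at this
  exact isEmptyElim this

theorem length_allTuples : (allTuples e A).length = tupleCount (relData e A) := by
  simp [allTuples, tupleCount, List.length_flatMap, RelData.toTuples]

theorem sum_length_allTuples :
    ((allTuples e A).map fun t => t.2.length).sum = entryCount (relData e A) := by
  refine sum_length_toTuples _ fun d hd t ht => ?_
  obtain ⟨ρ, -, rfl⟩ := List.mem_map.1 hd
  obtain ⟨t, -, rfl⟩ := List.mem_map.1 ht
  simp

theorem length_encode : (A.encode e).length = 1 + r + entryCount (relData e A) := by
  have : ∀ D : List RelData, (∀ d ∈ D, ∀ t ∈ d.tuples, t.length = d.arity) →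
      (D.flatMap RelData.encode).length = D.length + entryCount D := by
    intro D hD
    induction D with
    | nil => rfl
    | cons d D ih =>
      rw [List.flatMap_cons, List.length_append, ih fun d' hd' => hD d' (by simp [hd'])]
      simp only [RelData.encode, List.length_cons, List.length_flatten, entryCount, List.map_cons,
        List.sum_cons]
      rw [List.map_congr_left (g := fun _ => d.arity)]
      · simp; omega
      · exact fun t ht => hD d (by simp) t ht
  rw [encode_eq, List.length_cons, this, length_relData]
  · omega
  · intro d hd t ht
    obtain ⟨ρ, -, rfl⟩ := List.mem_map.1 hd
    obtain ⟨t, -, rfl⟩ := List.mem_map.1 ht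
    simp

theorem inputMem_encode_le [IsEmpty (L.Relations 0)] (a : ℕ) :
    inputMem (A.encode e) a ≤ A.size e := by
  have hmem : ∀ x ∈ A.encode e, x ≤ A.size e := by
    intro x hx
    rw [encode_eq, List.mem_cons, List.mem_flatMap] at hx
    have hs := size_eq e A
    rcases hx with rfl | ⟨d, hd, hx⟩
    · omega
    · rcases List.mem_cons.1 hx with rfl | hx
      · have h1 : d.tuples.length ≤ tupleCount (relData e A) :=
          List.single_le_sum (by simp) _ (List.mem_map_of_mem hd)
        have := tupleCount_le e A
        omega
      · obtain ⟨t, ht, hx⟩ := List.mem_flatten.1 hx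
        obtain ⟨ρ, -, rfl⟩ := List.mem_map.1 hd
        obtain ⟨t, -, rfl⟩ := List.mem_map.1 ht
        obtain ⟨j, rfl⟩ := (List.mem_ofFn' _ _).1 hx
        have := (t j).2
        simp only
        omega
  rw [inputMem, List.getD_eq_getElem?_getD]
  rcases h : (A.encode e)[a]? with _ | x
  · simp
  · exact hmem x (List.mem_of_getElem? h)

theorem graph_lt {D : ArcData} {Λ : Labels} (hg : Λ.glob < D.labels)
    (hΛ : ∀ ρ : Fin r, ∀ j < (e ρ).1, Λ.up ρ j < D.labels ∧ Λ.down ρ j < D.labels) {d : Edge}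
    (hd : d ∈ Λ.graph A.card (allTuples e A)) :
    d.src < A.card + 1 + (allTuples e A).length ∧ d.dst < A.card + 1 + (allTuples e A).length ∧
      d.lab < D.labels := by
  rcases Λ.mem_graph.1 hd with ⟨u, q, hu, j, v, hv, hd⟩ | ⟨v, hv, rfl⟩
  · have hul := (List.getElem?_eq_some_iff.1 hu).1
    obtain ⟨ρ, t, ht, rfl⟩ := (mem_allTuples e).1 (List.mem_of_getElem? hu)
    obtain ⟨hj, rfl⟩ := List.getElem?_eq_some_iff.1 hv
    have hj' : j < (e ρ).1 := by simpa using hj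
    have := (t ⟨j, hj'⟩).2
    have h := hΛ ρ j hj'
    rcases hd with rfl | rfl
    · refine ⟨?_, ?_, h.1⟩ <;> simp <;> omega
    · refine ⟨?_, ?_, h.2⟩ <;> simp <;> omega
  · exact ⟨by simp only; omega, by simp only; omega, hg⟩

end Size

theorem ArcData.Valid.result_le {D : ArcData} (hD : D.Valid) {E : List Edge} {N n a z : ℕ}
    (h : D.Result E N n a z) : z ≤ 1 := by
  obtain ⟨_, _, -, -, -, -, rfl⟩ := h
  exact hD.accept_le _

namespace Cmd

variable {input : List ℕ} {b : ℕ} {Q : St → ℕ → Prop} {σ : St} {k : ℕ}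

/-- Run the arc consistency algorithm for all elements. -/
def testAll (D : ArcData) : Cmd :=
  seq (set .all 1) <| seq (set .elem 0) <| seq (mov .left .num) <| seq
    (whilePos .left <| seq (arcConsistency D) <| seq (ifZero .res (set .all 0) skip) <|
      seq (add .elem .elem .one) (sub .left .left .one)) <|
  mov .ans .all

/-- Each peek restores the invariant: it leaves the graph and the registers outside `Reg.scratch`
unchanged and resets the values. The same memory is reused, and only the time is multiplied by `n`.
-/
theorem wp_testAll {D : ArcData} (hD : D.Valid) {E : List Edge} {N n : ℕ}
    (hG : GraphAt σ E) (h1 : σ.reg .one = 1) (hN : σ.reg .nodes = N) (hn : σ.reg .num = n)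
    (hnN : n < N) (hE : ∀ e ∈ E, e.src < N ∧ e.dst < N ∧ e.lab < D.labels)
    (hb : N * (D.values + 1) ≤ b) (hb' : D.values ≤ b) (hb1 : 1 ≤ b)
    (h : ∀ σ' k', (σ'.reg .ans = 1 ∧ ∀ a < n, D.Result E N n a 1) ∨
      (σ'.reg .ans = 0 ∧ ∃ a < n, D.Result E N n a 0) → Q σ' k') :
    (testAll D).Wp input b Q σ (k + n * (D.time E.length N + 5) + 7) := by
  rw [show k + n * (D.time E.length N + 5) + 7 =
    k + n * (D.time E.length N + 5) + 3 + 2 + 1 + 1 by omega]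
  refine wp_seq (wp_set hb1 (wp_seq (wp_set (by omega) (wp_seq (wp_mov (by decide) (wp_seq ?_))))))
  -- `D.Result` is a relation, so the flag `all` is paired with actual results: one for each element
  -- seen so far if it is 1, a negative one if it is 0.
  refine wp_whilePos (J := fun σ k' => ∃ i j, GraphAt σ E ∧ σ.reg .one = 1 ∧ σ.reg .nodes = N ∧
    σ.reg .num = n ∧ σ.reg .elem = i ∧ σ.reg .left = j ∧ i + j = n ∧
    ((σ.reg .all = 1 ∧ ∀ a < i, D.Result E N n a 1) ∨
      (σ.reg .all = 0 ∧ ∃ a < i, D.Result E N n a 0)) ∧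
    k + j * (D.time E.length N + 5) + 3 ≤ k') ?_ ?_
  · exact ⟨0, n, ⟨hG.1, hG.2, hG.3, hG.4⟩, by simpa using h1, by simpa using hN, by simpa using hn,
      by simp, by simpa using hn, by omega, .inl ⟨by simp, by simp⟩, le_rfl⟩
  · rintro σ k' ⟨i, j, hG, h1, hN, hn, hi, hj, hij, hall, hk'⟩
    refine ⟨k' - 1, by omega, fun h0 => ?_, fun h0 => ?_⟩
    · obtain rfl : j = 0 := by omega
      obtain rfl : i = n := by omega
      rw [show k' - 1 = k' - 3 + 2 by omega]
      refine wp_mov (by decide) (h _ _ ?_)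
      simpa using hall
    · cases j with
      | zero => omega
      | succ j =>
        rw [Nat.add_mul, Nat.one_mul] at hk'
        obtain ⟨k₁, hk₁, hk₁'⟩ : ∃ k₁, k' - 1 = k₁ + D.time E.length N ∧
            k + j * (D.time E.length N + 5) + 7 ≤ k₁ :=
          ⟨k' - 1 - D.time E.length N, by omega, by omega⟩
        rw [hk₁]
        refine wp_seq (wp_arcConsistency hD hG h1 hN hn hnN hi hE hb hb' hb1 ?_)
        intro σ' k₂ hG' hs hres hk₂
        have f1 : σ'.reg .one = 1 := by rw [St.reg_eq_of_saved hs _ rfl, h1]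
        have f2 : σ'.reg .nodes = N := by rw [St.reg_eq_of_saved hs _ rfl, hN]
        have f3 : σ'.reg .num = n := by rw [St.reg_eq_of_saved hs _ rfl, hn]
        have f4 : σ'.reg .elem = i := by rw [St.reg_eq_of_saved hs _ rfl, hi]
        have f5 : σ'.reg .left = j + 1 := by rw [St.reg_eq_of_saved hs _ rfl, hj]
        have f6 : σ'.reg .all = σ.reg .all := St.reg_eq_of_saved hs _ rfl
        have hibound : i + 1 ≤ b := by
          have : N ≤ N * (D.values + 1) := Nat.le_mul_of_pos_right N (Nat.succ_pos _)
          omega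
        obtain ⟨k₃, rfl⟩ : ∃ k₃, k₂ = k₃ + 4 := ⟨k₂ - 4, by omega⟩
        refine wp_seq (wp_ifZero (fun hz => ?_) fun hz => ?_)
        · refine (?_ : Wp _ _ _ _ _ (k₃ + 2 + 1))
          refine wp_set (by omega) (wp_seq (wp_add (by simp [f1, f4]; omega) (wp_sub ⟨i + 1, j,
            ⟨hG'.1, hG'.2, hG'.3, hG'.4⟩, by simp [f1], by simp [f2], by simp [f3],
            by simp [f1, f4], by simp [f1, f5], by omega, .inr ⟨by simp, i, by omega, ?_⟩,
            by omega⟩)))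
          rwa [hz] at hres
        · rw [show k₃ + 3 = k₃ + 1 + 1 + 1 by omega]
          refine wp_skip (wp_seq (wp_add (by simp [f1, f4]; omega) (wp_sub ⟨i + 1, j,
            ⟨hG'.1, hG'.2, hG'.3, hG'.4⟩, by simp [f1], by simp [f2], by simp [f3],
            by simp [f1, f4], by simp [f1, f5], by omega, ?_, by omega⟩)))
          have hle := hD.result_le hres
          have hz1 : σ'.reg .res = 1 := by omega
          rw [hz1] at hres
          simp only [St.reg_setReg, reduceCtorEq, if_false, f6]
          refine hall.imp (fun hh => ⟨hh.1, fun a ha => ?_⟩) fun hh => ⟨hh.1, ?_⟩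
          · rcases (Nat.lt_succ_iff.1 ha).eq_or_lt with rfl | hlt
            · exact hres
            · exact hh.2 a hlt
          · obtain ⟨a, ha, hr⟩ := hh.2
            exact ⟨a, by omega, hr⟩

/-- Run the arc consistency algorithm for the element `ans`, unless the register `rest` is zero, and
prepare to combine the result with others. -/
def testOne (D : ArcData) : Cmd :=
  seq (mov .elem .ans) <| seq (ifZero .rest skip (arcConsistency D)) <|
  seq (add .addr .pos .elem) <| seq (mov .scan .pos) <| seq (mov .cnt .num) <| seq (set .tmp 2) <|
  seq (sub .res .tmp .res) (set .ans 1)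

/-- The result is stored as `2 - z`, that is 1 for yes and 2 for no, which leaves 0 for a result
that is not yet there. After parsing, `pos` is the length of the input and hence the address of the
first result cell. -/
theorem wp_testOne {D : ArcData} (hD : D.Valid) {E : List Edge} {N n i l : ℕ}
    (hG : GraphAt σ E) (h1 : σ.reg .one = 1) (hN : σ.reg .nodes = N) (hn : σ.reg .num = n)
    (hi : σ.reg .ans = i) (hl : σ.reg .pos = l) (hnN : n < N)
    (hE : ∀ e ∈ E, e.src < N ∧ e.dst < N ∧ e.lab < D.labels)
    (hb : N * (D.values + 1) ≤ b) (hb' : D.values ≤ b) (hb2 : 2 ≤ b) (hlb : l + i ≤ b)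
    (h : ∀ σ' k', σ'.reg .one = 1 → σ'.reg .rest = σ.reg .rest → σ'.reg .addr = l + i →
      σ'.reg .scan = l → σ'.reg .cnt = n → σ'.reg .ans = 1 →
      (σ.reg .rest ≠ 0 → ∃ z, D.Result E N n i z ∧ σ'.reg .res = 2 - z) → Q σ' k') :
    (testOne D).Wp input b Q σ (k + D.time E.length N + 11) := by
  -- The tail of the program is common to processors with and without an element; both branches
  -- leave the saved registers equal.
  have key : ∀ (σ' : St) (k : ℕ), σ'.saved = (σ.setReg .elem i).saved →
      (σ.reg .rest ≠ 0 → D.Result E N n i (σ'.reg .res)) →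
      (seq (add .addr .pos .elem) <| seq (mov .scan .pos) <| seq (mov .cnt .num) <|
        seq (set .tmp 2) <| seq (sub .res .tmp .res) (set .ans 1)).Wp input b Q σ' (k + 8) := by
    intro σ' k hs hr
    have f1 : σ'.reg .one = 1 := by rw [St.reg_eq_of_saved hs _ rfl]; simpa using h1
    have f2 : σ'.reg .pos = l := by rw [St.reg_eq_of_saved hs _ rfl]; simpa using hl
    have f3 : σ'.reg .num = n := by rw [St.reg_eq_of_saved hs _ rfl]; simpa using hn
    have f4 : σ'.reg .elem = i := by rw [St.reg_eq_of_saved hs _ rfl]; simp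
    have f5 : σ'.reg .rest = σ.reg .rest := by rw [St.reg_eq_of_saved hs _ rfl]; simp
    refine wp_seq (wp_add (by omega) (wp_seq (wp_mov (by decide) (wp_seq (wp_mov (by decide) (wp_seq
      (wp_set hb2 (wp_seq (wp_sub (wp_set (by omega) (h _ k ?_ ?_ ?_ ?_ ?_ ?_ ?_)))))))))))
    · simp [f1]
    · simp [f5]
    · simp [f2, f4]
    · simp [f2]
    · simp [f3]
    · simp
    · exact fun h0 => ⟨_, hr h0, by simp⟩
  refine wp_seq (?_ : Wp _ _ _ _ _ (k + D.time E.length N + 9 + 2))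
  refine wp_mov (by decide) ?_
  rw [hi]
  refine wp_seq (?_ : Wp _ _ _ _ _ (k + D.time E.length N + 8 + 1))
  have hself : (σ.setReg .elem 0).setReg .elem i = σ.setReg .elem i := St.setReg_setReg _ _ _ _
  rw [hself]
  refine wp_ifZero (fun h0 => wp_skip (key _ _ rfl fun h0' => ?_)) fun h0 => ?_
  · simp only [St.reg_setReg, reduceCtorEq, if_false] at h0
    exact absurd h0 h0'
  · rw [show k + D.time E.length N + 8 = k + 8 + D.time E.length N by omega]
    refine wp_arcConsistency hD ⟨hG.1, hG.2, hG.3, hG.4⟩ (by simpa using h1) (by simpa using hN)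
      (by simpa using hn) hnN (a := i) (by simp) hE hb hb' (by omega) ?_
    intro σ' k' hG' hs hr hk'
    obtain ⟨k', rfl⟩ := Nat.exists_eq_add_of_le' hk'
    exact key σ' (k' + k) hs fun _ => hr

end Cmd

end RAM

/-! ### Assembly of the sequential and the parallel algorithm. -/

namespace RAM

section Main

variable {L : Language} {r : ℕ} {e : Fin r ≃ Σ k, L.Relations k} {D : ArcData} {Λ : Labels}

/-- The numbers and arities of all relation symbols. -/
def arities (e : Fin r ≃ Σ k, L.Relations k) : List (ℕ × ℕ) :=
  (List.finRange r).map fun ρ : Fin r => ((ρ : ℕ), (e ρ).1)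

/-- The factor by which the numbers in use exceed the size of the instance. -/
def spaceFactor (D : ArcData) (r : ℕ) : ℕ := D.labels + D.values + r + 10

/-- The factor by which the time of the arc consistency algorithm exceeds the size of the
instance. -/
def timeFactor (D : ArcData) : ℕ := (D.values + 1) * (2 * D.edgeTime + 5) + 2 * D.values + 17

theorem ArcData.time_le (D : ArcData) {q N s : ℕ} (hq : q ≤ 2 * s) (hN : N ≤ s) (hs : 1 ≤ s) :
    D.time q N ≤ timeFactor D * s := by
  have h1 : D.edgeTime * q ≤ 2 * D.edgeTime * s := by
    calc D.edgeTime * q ≤ D.edgeTime * (2 * s) := Nat.mul_le_mul_left _ hq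
      _ = 2 * D.edgeTime * s := by ring
  have h2 : (D.values + 1) * (D.edgeTime * q + 5 * N) ≤
      (D.values + 1) * ((2 * D.edgeTime + 5) * s) := by
    refine Nat.mul_le_mul_left _ ?_
    rw [Nat.add_mul]
    omega
  have h3 : 2 * D.values + 11 ≤ (2 * D.values + 11) * s := Nat.le_mul_of_pos_right _ hs
  have h4 : timeFactor D * s = (D.values + 1) * ((2 * D.edgeTime + 5) * s) +
      (2 * D.values + 11) * s + 6 * s := by
    rw [timeFactor]; ring
  rw [ArcData.time, h4]
  omega

/-- The numerical facts that are used to verify the programs on an instance. -/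
theorem instance_bounds [IsEmpty (L.Relations 0)] (A : FiniteInstance L) :
    A.card + entryCount (relData e A) + 1 = A.size e + 1 ∧
    tupleCount (relData e A) ≤ entryCount (relData e A) ∧
    (A.encode e).length ≤ (r + 1) * (A.size e + 1) ∧
    (Λ.graph A.card (allTuples e A)).length ≤ 2 * (A.size e + 1) ∧
    A.card + 1 + (allTuples e A).length ≤ A.size e + 1 := by
  have h1 := size_eq e A
  have h2 := tupleCount_le e A
  have h3 := length_encode e A
  have h4 := Λ.length_graph A.card (allTuples e A)
  rw [sum_length_allTuples] at h4
  have h5 := length_allTuples e A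
  refine ⟨by omega, h2, ?_, by omega, by omega⟩
  have h6 : r ≤ r * (A.size e + 1) := Nat.le_mul_of_pos_right _ (Nat.succ_pos _)
  rw [Nat.add_mul]
  omega

theorem spaceFactor_mul (s : ℕ) :
    spaceFactor D r * s = D.labels * s + D.values * s + r * s + 10 * s := by
  rw [spaceFactor]; ring

theorem wp_parse_instance [IsEmpty (L.Relations 0)] (hg : Λ.glob < D.labels)
    (hΛ : ∀ ρ : Fin r, ∀ j < (e ρ).1, Λ.up ρ j < D.labels ∧ Λ.down ρ j < D.labels)
    (A : FiniteInstance L) {σ : St} {x y k : ℕ} {Q : St → ℕ → Prop} (hx : σ.reg .ans = x)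
    (hy : σ.reg .rest = y) (h0 : ∀ j p, σ.arr j p = 0)
    (h : ∀ σ' k', ParseInv (A.encode e) A.card x y σ' (Λ.graph A.card (allTuples e A))
      (A.card + 1 + (allTuples e A).length) [] → k ≤ k' → Q σ' k') :
    (Cmd.parse Λ (arities e)).Wp (A.encode e) (spaceFactor D r * (A.size e + 1)) Q σ
      (k + (3 * r + 50) * (A.size e + 1)) := by
  obtain ⟨h1, h2, h3, -, h5⟩ := instance_bounds (Λ := Λ) (e := e) A
  have h6 := length_allTuples e A
  have hsf := spaceFactor_mul (D := D) (r := r) (A.size e + 1)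
  have h7 : r ≤ r * (A.size e + 1) := Nat.le_mul_of_pos_right _ (Nat.succ_pos _)
  have h8 : D.labels ≤ D.labels * (A.size e + 1) := Nat.le_mul_of_pos_right _ (Nat.succ_pos _)
  have hlen := length_relData e A
  have h9 : (3 * r + 50) * (A.size e + 1) = 3 * (r * (A.size e + 1)) + 50 * (A.size e + 1) := by ring
  have h10 : (r + 1) * (A.size e + 1) = r * (A.size e + 1) + (A.size e + 1) := by ring
  obtain ⟨k₁, hk₁, hk₁'⟩ : ∃ k₁, k + (3 * r + 50) * (A.size e + 1) = k₁ + 9 + 13 * A.card +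
      3 * (relData e A).length + 22 * entryCount (relData e A) + 3 * tupleCount (relData e A) ∧
      k ≤ k₁ :=
    ⟨k + (3 * r + 50) * (A.size e + 1) - 9 - 13 * A.card - 3 * (relData e A).length -
      22 * entryCount (relData e A) - 3 * tupleCount (relData e A), by omega, by omega⟩
  rw [hk₁, arities, ← map_relData]
  refine Cmd.wp_parse Λ (relData e A) hx hy h0 (encode_eq e A) (fun d hd => ?_) (by omega) (by omega)
    (by omega) (by omega) fun σ' hσ' => h σ' _ ?_ hk₁'
  · obtain ⟨ρ, -, rfl⟩ := List.mem_map.1 hd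
    refine ⟨fun t ht => ?_, fun j hj => ?_⟩
    · obtain ⟨t, -, rfl⟩ := List.mem_map.1 ht
      simp
    · have := hΛ ρ j hj
      simp only
      omega
  · rw [h6]
    exact hσ'

/-- The conditions under which the arc consistency algorithm works on an instance. -/
theorem arcConsistency_bounds [IsEmpty (L.Relations 0)] (A : FiniteInstance L) :
    (A.card + 1 + (allTuples e A).length) * (D.values + 1) ≤ spaceFactor D r * (A.size e + 1) ∧
    D.values ≤ spaceFactor D r * (A.size e + 1) ∧ 2 ≤ spaceFactor D r * (A.size e + 1) ∧
    (A.encode e).length + A.card ≤ spaceFactor D r * (A.size e + 1) ∧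
    A.size e ≤ spaceFactor D r * (A.size e + 1) := by
  obtain ⟨h1, h2, h3, -, h5⟩ := instance_bounds (Λ := ⟨fun _ _ => 0, fun _ _ => 0, 0⟩) (e := e) A
  have hsf := spaceFactor_mul (D := D) (r := r) (A.size e + 1)
  have h8 : D.values ≤ D.values * (A.size e + 1) := Nat.le_mul_of_pos_right _ (Nat.succ_pos _)
  have h10 : (r + 1) * (A.size e + 1) = r * (A.size e + 1) + (A.size e + 1) := by ring
  have h11 : (A.card + 1 + (allTuples e A).length) * (D.values + 1) ≤
      D.values * (A.size e + 1) + (A.size e + 1) := by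
    calc _ ≤ (A.size e + 1) * (D.values + 1) := Nat.mul_le_mul_right _ h5
      _ = _ := by ring
  refine ⟨by omega, by omega, by omega, by omega, by omega⟩

/-- The sequential algorithm. -/
theorem exists_sequential [L.IsRelational] [IsEmpty (L.Relations 0)] (hD : D.Valid)
    (hg : Λ.glob < D.labels)
    (hΛ : ∀ ρ : Fin r, ∀ j < (e ρ).1, Λ.up ρ j < D.labels ∧ Λ.down ρ j < D.labels)
    {Q : FiniteInstance L → Prop}
    (hQ : ∀ A, Q A → ∀ a < A.card, ∀ z, D.Result (Λ.graph A.card (allTuples e A))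
      (A.card + 1 + (allTuples e A).length) A.card a z → z = 1)
    (hQ' : ∀ A, (∀ a < A.card, D.Result (Λ.graph A.card (allTuples e A))
      (A.card + 1 + (allTuples e A).length) A.card a 1) → Q A) :
    ∃ (P : Program) (c : ℕ), ∀ A : FiniteInstance L,
      Answers P 1 (A.encode e) (c * (A.size e + 1) ^ 2) (c * (A.size e + 1)) (Q A) := by
  set body := Cmd.seq (Cmd.parse Λ (arities e)) (Cmd.testAll D) with hbody
  -- The factor 6 is the overhead of compilation, applied to the costs of parsing, of propagation
  -- and of the loop around it. The summand `8 * spaceFactor D r + 40` pays for the memory layout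
  -- required by `Exec.steps`.
  refine ⟨body.compile 0, 6 * (3 * r + 50 + timeFactor D + 12) + 8 * spaceFactor D r + 40,
    fun A => ?_⟩
  obtain ⟨s, hs⟩ : ∃ s, s = A.size e + 1 := ⟨_, rfl⟩
  obtain ⟨-, -, -, hq, hN⟩ := instance_bounds (Λ := Λ) (e := e) A
  obtain ⟨b1, b2, b3, b4, b5⟩ := arcConsistency_bounds (e := e) (D := D) A
  have htime := D.time_le hq hN (by omega)
  have hwp : body.Wp (A.encode e) (spaceFactor D r * (A.size e + 1))
      (fun σ' _ => (σ'.reg .ans = 1 ∧ ∀ a < A.card, D.Result (Λ.graph A.card (allTuples e A))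
        (A.card + 1 + (allTuples e A).length) A.card a 1) ∨
        (σ'.reg .ans = 0 ∧ ∃ a < A.card, D.Result (Λ.graph A.card (allTuples e A))
        (A.card + 1 + (allTuples e A).length) A.card a 0)) ⟨fun _ => 0, fun _ _ => 0⟩
      (A.card * (D.time (Λ.graph A.card (allTuples e A)).length
        (A.card + 1 + (allTuples e A).length) + 5) + 7 + (3 * r + 50) * (A.size e + 1)) := by
    refine Cmd.wp_seq (wp_parse_instance hg hΛ A rfl rfl (fun _ _ => rfl) fun σ' k' hσ' hk' => ?_)
    obtain ⟨k', rfl⟩ := Nat.exists_eq_add_of_le' hk'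
    rw [← Nat.add_assoc]
    exact Cmd.wp_testAll hD hσ'.graph hσ'.one hσ'.nodes hσ'.num (by omega)
      (fun d hd => graph_lt e A hg hΛ hd) b1 b2 (by omega) fun _ _ h => h
  obtain ⟨σ', t, k', hexec, ht, hpost⟩ := hwp
  have hn : A.card ≤ s := by omega
  have htb : 6 * t ≤ 6 * (3 * r + 50 + timeFactor D + 12) * s ^ 2 := by
    rw [← hs] at ht htime
    have h1 : A.card * (D.time (Λ.graph A.card (allTuples e A)).length
        (A.card + 1 + (allTuples e A).length) + 5) ≤ s * (timeFactor D * s + 5) :=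
      Nat.mul_le_mul hn (by omega)
    have h2 : s ≤ s ^ 2 := Nat.le_self_pow (by norm_num) s
    have h3 : (3 * r + 50) * s ≤ (3 * r + 50) * s ^ 2 := Nat.mul_le_mul_left _ h2
    have h4 : s * (timeFactor D * s + 5) = timeFactor D * s ^ 2 + 5 * s := by ring
    have h5 : (3 * r + 50 + timeFactor D + 12) * s ^ 2 =
        (3 * r + 50) * s ^ 2 + timeFactor D * s ^ 2 + 12 * s ^ 2 := by ring
    have h6 : 6 * (3 * r + 50 + timeFactor D + 12) * s ^ 2 =
      6 * ((3 * r + 50 + timeFactor D + 12) * s ^ 2) := by ring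
    omega
  have hc : (6 * (3 * r + 50 + timeFactor D + 12) + 8 * spaceFactor D r + 40) * s =
      6 * (3 * r + 50 + timeFactor D + 12) * s + 8 * (spaceFactor D r * s) + 40 * s := by ring
  have hspace : 40 + 8 * (spaceFactor D r * s) ≤
      (6 * (3 * r + 50 + timeFactor D + 12) + 8 * spaceFactor D r + 40) * s := by omega
  rw [← hs] at hexec b4 b5 ⊢
  obtain ⟨m', u, hu, hm', -, hsteps⟩ := hexec.steps hspace
    (fun a => (inputMem_encode_le e A a).trans b5) 0 (Proc.init 0).mem
    (fun i _ => by rw [Nat.zero_add]) ⟨fun r => by simp [Proc.init], fun j x => by simp [Proc.init]⟩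
    ⟨fun _ => Nat.zero_le _, fun _ _ => Nat.zero_le _⟩
  refine answers_of_steps hsteps (hu.trans (htb.trans (Nat.mul_le_mul_right _ (by omega)))) ?_
    (fun a => (inputMem_encode_le e A a).trans (by omega)) (by omega) (fun hq => ?_) fun hq => ?_
  · simp [Proc.Halted]
  · have hans : m' 0 = σ'.reg .ans := hm'.reg .ans
    rcases hpost with ⟨h, -⟩ | ⟨-, a, ha, hr⟩
    · simpa [hans] using h
    · exact absurd (hQ A hq a ha 0 hr) (by decide)
  · have hans : m' 0 = σ'.reg .ans := hm'.reg .ans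
    rcases hpost with ⟨-, h⟩ | ⟨h, -⟩
    · exact absurd (hQ' A h) hq
    · simpa [hans] using h

/-- The code with which a processor puts the number of elements into `num`, the number of elements
from its own index on into `rest`, and the least of its index and the number of elements into
`ans`. -/
def startCode : List Instr := [.read 1 2, .sub 20 1 0, .sub 0 1 20]

/-- There are more processors than elements, and an index may exceed the bound on numbers in
structured programs. Two truncated subtractions replace `i` by `n - (n - i)`, the minimum of `i` and
`n`, before the compiled code starts. The input is read from address 0 because cell 2 is initially
0. -/
theorem steps_startCode {P : Program} {input : List ℕ} {s n : ℕ} (hP : CodeAt P 0 startCode)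
    (hs : 30 ≤ s) (hlen : 0 < input.length) (hn : inputMem input 0 = n) (i : ℕ) :
    ∃ m, Represents m ⟨fun r => if r = .num then n else if r = .rest then n - i else
      if r = .ans then n - (n - i) else 0, fun _ _ => 0⟩ ∧
      Steps P input s 3 (Proc.init i) ⟨3, m⟩ := by
  refine ⟨_, ?_, Steps.cons hP.head ?_ ?_ rfl <| Steps.cons hP.tail.head ?_ trivial rfl <|
    Steps.cons hP.tail.tail.head ?_ trivial rfl <| Steps.refl _⟩
  · constructor
    · intro r
      cases r <;> simp [Instr.next, Proc.init, Reg.cell, Reg.ctorIdx, hn]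
    · intro j x
      simp only [Instr.next, Proc.init, Arr.cell]
      rw [Function.update_of_ne (by omega), Function.update_of_ne (by omega),
        Function.update_of_ne (by omega), if_neg (by omega)]
  · simp only [Instr.Fits]; omega
  · simpa [Instr.ReadsBelow, Proc.init] using hlen
  · simp only [Instr.Fits]; omega
  · simp only [Instr.Fits]; omega

/-- The parallel algorithm. -/
theorem exists_parallel [L.IsRelational] [IsEmpty (L.Relations 0)] (hD : D.Valid)
    (hg : Λ.glob < D.labels)
    (hΛ : ∀ ρ : Fin r, ∀ j < (e ρ).1, Λ.up ρ j < D.labels ∧ Λ.down ρ j < D.labels)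
    {Q : FiniteInstance L → Prop}
    (hQ : ∀ A, Q A → ∀ a < A.card, ∀ z, D.Result (Λ.graph A.card (allTuples e A))
      (A.card + 1 + (allTuples e A).length) A.card a z → z = 1)
    (hQ' : ∀ A, (∀ a < A.card, D.Result (Λ.graph A.card (allTuples e A))
      (A.card + 1 + (allTuples e A).length) A.card a 1) → Q A) :
    ∃ (P : Program) (c : ℕ), ∀ A : FiniteInstance L,
      Answers P (c * (A.size e + 1)) (A.encode e) (c * (A.size e + 1)) (c * (A.size e + 1))
        (Q A) := by
  classical
  set body := Cmd.seq (Cmd.parse Λ (arities e)) (Cmd.testOne D) with hbody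
  set pc := startCode.length + (body.compile 3).length with hpc
  obtain ⟨P, hP⟩ : ∃ P, P = startCode ++ (body.compile 3 ++ combineCode pc) := ⟨_, rfl⟩
  have hPstart : CodeAt P 0 startCode := hP ▸ codeAt_append [] startCode _
  have hPbody : CodeAt P 3 (body.compile 3) := hP ▸ codeAt_append startCode _ _
  have hPcomb : CodeAt P pc (combineCode pc) := by
    have := codeAt_append (startCode ++ body.compile 3) (combineCode pc) []
    rwa [List.append_nil, List.append_assoc, ← hP, List.length_append] at this
  have hPlen : P.length = pc + 10 := by
    rw [hP, List.length_append, List.length_append, hpc]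
    simp [combineCode]; omega
  -- The same constant bounds time, addresses and contents, and sets the number of processors; it
  -- must also cover the loop that combines up to `A.card` results.
  refine ⟨P, 6 * (3 * r + 50 + timeFactor D + 12) + 8 * spaceFactor D r + 60, fun A => ?_⟩
  obtain ⟨s, hs⟩ : ∃ s, s = A.size e + 1 := ⟨_, rfl⟩
  obtain ⟨h1, -, -, hq, hN⟩ := instance_bounds (Λ := Λ) (e := e) A
  obtain ⟨b1, b2, b3, b4, b5⟩ := arcConsistency_bounds (e := e) (D := D) A
  have htime := D.time_le hq hN (by omega)
  have hlen := length_encode e A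
  have hn0 : inputMem (A.encode e) 0 = A.card := by rw [encode_eq]; rfl
  have hc : (6 * (3 * r + 50 + timeFactor D + 12) + 8 * spaceFactor D r + 60) * s =
      6 * ((3 * r + 50) * s + timeFactor D * s + 12 * s) + 8 * (spaceFactor D r * s) + 60 * s := by
    ring
  rw [← hs] at htime b1 b2 b3 b4 b5 ⊢
  rw [hc]
  set c := 6 * ((3 * r + 50) * s + timeFactor D * s + 12 * s) + 8 * (spaceFactor D r * s) + 60 * s
    with hcdef
  have hproc : ∀ i, ∃ t M z, t ≤ 6 * ((3 * r + 50) * s + timeFactor D * s + 11) + 3 ∧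
      Steps P (A.encode e) c t (Proc.init i) ⟨pc, M⟩ ∧
      ReadyToCombine (A.encode e).length A.card (fun _ => 2 - z) i M ∧
      (i < A.card → D.Result (Λ.graph A.card (allTuples e A))
        (A.card + 1 + (allTuples e A).length) A.card i z) := by
    intro i
    obtain ⟨m₀, hm₀, hst₀⟩ := steps_startCode (input := A.encode e) (s := c) hPstart (by omega)
      (by omega) hn0 i
    have hwp : body.Wp (A.encode e) (spaceFactor D r * (A.size e + 1)) (fun σ' _ =>
        σ'.reg .one = 1 ∧ σ'.reg .rest = A.card - i ∧
        σ'.reg .addr = (A.encode e).length + (A.card - (A.card - i)) ∧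
        σ'.reg .scan = (A.encode e).length ∧ σ'.reg .cnt = A.card ∧ σ'.reg .ans = 1 ∧
        (A.card - i ≠ 0 → ∃ z, D.Result (Λ.graph A.card (allTuples e A))
          (A.card + 1 + (allTuples e A).length) A.card (A.card - (A.card - i)) z ∧
          σ'.reg .res = 2 - z))
        ⟨fun r => if r = .num then A.card else if r = .rest then A.card - i else
          if r = .ans then A.card - (A.card - i) else 0, fun _ _ => 0⟩
        (D.time (Λ.graph A.card (allTuples e A)).length
          (A.card + 1 + (allTuples e A).length) + 11 + (3 * r + 50) * (A.size e + 1)) := by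
      refine Cmd.wp_seq (wp_parse_instance hg hΛ A (by simp; rfl) (by simp; rfl) (fun _ _ => rfl)
        fun σ' k' hσ' hk' => ?_)
      obtain ⟨k', rfl⟩ := Nat.exists_eq_add_of_le' hk'
      rw [← Nat.add_assoc, ← hs]
      refine Cmd.wp_testOne hD hσ'.graph hσ'.one hσ'.nodes hσ'.num hσ'.ans
        (by simpa using hσ'.drop.length) (by omega)
        (fun d hd => graph_lt e A hg hΛ hd) b1 b2 b3 (by omega) ?_
      intro σ'' _ c1 c2 c3 c4 c5 c6 c7
      rw [hσ'.rest] at c2 c7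
      exact ⟨c1, c2, c3, c4, c5, c6, c7⟩
    rw [← hs] at hwp
    obtain ⟨σ', t, k', hexec, ht, f1, f2, f3, f4, f5, f6, f7⟩ := hwp
    obtain ⟨m', u, hu, hm', -, hsteps⟩ := hexec.steps (P := P) (s := c) (by omega)
      (fun a => (inputMem_encode_le e A a).trans b5) 3 m₀ hPbody hm₀
      ⟨fun r => by simp only; split_ifs <;> omega, fun _ _ => Nat.zero_le _⟩
    have hsteps' := hst₀.trans hsteps
    have e1 : m' 20 = A.card - i := (hm'.reg .rest).trans f2
    have e2 : m' 18 = (A.encode e).length + (A.card - (A.card - i)) := (hm'.reg .addr).trans f3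
    have e3 : m' 22 = σ'.reg .res := hm'.reg .res
    have e4 : m' 19 = (A.encode e).length := (hm'.reg .scan).trans f4
    have e5 : m' 7 = A.card := (hm'.reg .cnt).trans f5
    have e6 : m' 4 = 1 := (hm'.reg .one).trans f1
    have e7 : m' 0 = 1 := (hm'.reg .ans).trans f6
    have hu' : 3 + u ≤ 6 * ((3 * r + 50) * s + timeFactor D * s + 11) + 3 := by
      clear f7
      omega
    by_cases hi : i < A.card
    · have hii : A.card - (A.card - i) = i := Nat.sub_sub_self hi.le
      rw [hii] at e2 f7
      obtain ⟨z, hz, hz'⟩ := f7 (Nat.sub_ne_zero_of_lt hi)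
      exact ⟨3 + u, m', z, hu', hsteps', ⟨e1, fun _ => e2, fun _ => e3.trans hz', e4, e5, e6,
        e7⟩, fun _ => hz⟩
    · exact ⟨3 + u, m', 0, hu', hsteps', ⟨e1, fun h => absurd h hi, fun h => absurd h hi, e4,
        e5, e6, e7⟩, fun h => absurd h hi⟩
  -- The arrival times differ between processors; only their common linear bound is used.
  choose t M z ht hst hM hz using hproc
  have hans := answers_of_combine (p := c) (s := c) (result := fun i => 2 - z i) hPcomb hPlen
    (by omega) (by omega) (fun i _ => hst i) (fun i _ => ht i)
    (fun i _ => ⟨(hM i).rest, (hM i).addr, (hM i).res, (hM i).scan, (hM i).cnt, (hM i).one,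
      (hM i).ans⟩)
    (fun j hj => by have := hD.result_le (hz j hj); omega) (by omega) (by omega)
    (by omega) (fun a => (inputMem_encode_le e A a).trans (by omega)) (T' := c) (by omega)
  have hiff : (∀ j < A.card, 2 - z j = 1) ↔ Q A := by
    constructor
    · intro h
      refine hQ' A fun a ha => ?_
      have h1 := h a ha
      have h2 := hz a ha
      rwa [show z a = 1 by omega] at h2
    · intro h a ha
      rw [hQ A h a ha _ (hz a ha)]
  rwa [hiff] at hans

end Main

end RAM

theorem theorem9 {L : FirstOrder.Language} [L.IsRelational] [IsEmpty (L.Relations 0)]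
    {r : ℕ} (e : Fin r ≃ Σ k, L.Relations k)
    (B : Type*) [L.Structure B]
    (horb : Finite (Quotient (orbitSetoid L B)))
    (hpp : {S : Set (Fin 2 → B) | PPDefinable L S}.Finite)
    (hpac : PACDecides L B) :
    (∃ (P : RAM.Program) (c : ℕ), ∀ A : FiniteInstance L,
      RAM.Answers P 1 (A.encode e) (c * (A.size e + 1) ^ 2) (c * (A.size e + 1))
        (Nonempty (A.Carrier →[L] B))) ∧
    (∃ (P : RAM.Program) (c : ℕ), ∀ A : FiniteInstance L,
      RAM.Answers P (c * (A.size e + 1)) (A.encode e) (c * (A.size e + 1)) (c * (A.size e + 1))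
        (Nonempty (A.Carrier →[L] B))) := by
  obtain ⟨D, Λ, hD, hg, hΛ, hres⟩ := RAM.exists_arcData e B horb hpp
  have hQ : ∀ A : FiniteInstance L, Nonempty (A.Carrier →[L] B) → ∀ a < A.card, ∀ z,
      D.Result (Λ.graph A.card (RAM.allTuples e A))
        (A.card + 1 + (RAM.allTuples e A).length) A.card a z → z = 1 :=
    fun A hA a ha z hz => (hres A ⟨a, ha⟩ z hz).2.2 hA
  -- Accepting every peek establishes the peek arc consistency condition, and only here is the
  -- hypothesis on `B` used that this condition yields a homomorphism.
  have hQ' : ∀ A : FiniteInstance L, (∀ a < A.card, D.Result (Λ.graph A.card (RAM.allTuples e A))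
      (A.card + 1 + (RAM.allTuples e A).length) A.card a 1) → Nonempty (A.Carrier →[L] B) :=
    fun A hA => hpac A.Carrier fun a => (hres A a 1 (hA a a.2)).2.1 rfl
  exact ⟨RAM.exists_sequential hD hg hΛ hQ hQ', RAM.exists_parallel hD hg hΛ hQ hQ'⟩
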